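/- Let $V=\{1,\dots,n\}$ be a set of spins with local Hilbert spaces $\mathbb C^d$, $d\ge 1$. Let $H=\sum_{X\in S}\lambda_X h_X$, where $S$ is a set of subsets of $V$, each $h_X$ is Hermitian with support exactly $X$ (the smallest set of spins on which it acts non-trivially) and operator norm $\|h_X\|=1$, and $\lambda_X\in[-1,1]$. Assume that $|X|\le k$ for all $X\in S$ and that every $X\in S$ intersects at most $\mathfrak d$ other elements of $S$, where $\mathfrak d\ge 1$ (i.e. the interaction graph, with vertex set $S$ and an edge between distinct intersecting subsystems, has maximum degree at most $\mathfrak d$). Let $A$ be an operator with $\mathrm{supp}(A)\in S$, let $\rho=\bigotimes_{v\in V}\rho_v$ be a product of one-spin density matrices, and put $$\langle A(t)\rangle=\mathrm{tr}\left(e^{iHt}Ae^{-iHt}\rho\right),\qquad t^*=\frac1{2e\,\mathfrak d}.$$ **Proposition.** There is a deterministic algorithm which, for all such data, every real $t$ with $|t|<t^*$ and every $\varepsilon>0$, outputs a number $\hat f_A(t)$ with $$\left|\langle A(t)\rangle-\hat f_A(t)\right|\le\varepsilon\|A\|$$ in run time at most $$p\left(\left(\frac1{1-|t|/t^*}\cdot\frac1\varepsilon\right)^{1/\log(t^*/|t|)}\right),$$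 where $p$ is a polynomial that depends only on $d$, $k$ and $\mathfrak d$; in particular the run time is independent of the system size $n$. (For $t=0$ the exponent is read as its limit $0$.) Here the algorithm is a finite program, the same for all data, on a random access machine with exact arithmetic at unit cost: addition, subtraction and multiplication of natural numbers, field operations on complex numbers, comparison of natural numbers and of real parts, and reading or writing a memory cell each take one unit of time. It has random access to a read-only input that contains $d$, $\mathfrak d$, $t$, $t^*$, $\varepsilon$; for each label of an $X\in S$ the list of its spins, the list of its neighbours in the interaction graph, $\lambda_X$ and the entries of $h_X$ as a $d^{|X|}\times d^{|X|}$ matrix; the entries of the matrices $\rho_v$; the label of $\mathrm{supp}(A)$ and the entries of $A$ as a matrix on $\mathrm{supp}(A)$. -/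

import Mathlib

open scoped ComplexOrder

noncomputable section

namespace ShortTime

/-! ### Spin systems, local Hamiltonians, product states -/

/-- Operators on `n` spins of local dimension `d`, i.e. on the `n`-fold tensor power of `ℂ^d`, as
matrices in the product basis; a basis vector is a configuration `Fin n → Fin d`. -/
abbrev Op (n d : ℕ) : Type := Matrix (Fin n → Fin d) (Fin n → Fin d) ℂ

/-- `B` acts on the subsystem `X` : it is an operator on the spins of `X` tensored with the identity
on the other spins. -/
def ActsOn {n d : ℕ} (X : Finset (Fin n)) (B : Op n d) : Prop :=
  ∃ b : Matrix (X → Fin d) (X → Fin d) ℂ, ∀ σ τ : Fin n → Fin d,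
    ((∀ v, v ∉ X → σ v = τ v) → B σ τ = b (fun v => σ v) (fun v => τ v)) ∧
    (¬ (∀ v, v ∉ X → σ v = τ v) → B σ τ = 0)

/-- `X` is the support of `B`, the smallest subsystem on which `B` acts. -/
def IsSupport {n d : ℕ} (B : Op n d) (X : Finset (Fin n)) : Prop :=
  IsLeast {Y : Finset (Fin n) | ActsOn Y B} X

/-- The operator norm with respect to the Hilbert space norm. -/
def opNorm {n d : ℕ} (B : Op n d) : ℝ :=
  ‖Matrix.toEuclideanCLM (n := Fin n → Fin d) (𝕜 := ℂ) B‖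

/-- A Hamiltonian `∑ X ∈ S, λ_X h_X`. The set `S` of subsystems is numbered by
`Fin numTerms`: distinct labels carry distinct subsystems. -/
structure LocalHamiltonian (n d : ℕ) where
  numTerms : ℕ
  region : Fin numTerms → Finset (Fin n)
  region_injective : Function.Injective region
  coeff : Fin numTerms → ℝ
  abs_coeff_le : ∀ x, |coeff x| ≤ 1
  term : Fin numTerms → Op n d
  term_isHermitian : ∀ x, (term x).IsHermitian
  term_support : ∀ x, IsSupport (term x) (region x)
  term_norm : ∀ x, opNorm (term x) = 1

namespace LocalHamiltonian

variable {n d : ℕ} (H : LocalHamiltonian n d)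

/-- The Hamiltonian as an operator. -/
def toOp : Op n d := ∑ x, (H.coeff x : ℂ) • H.term x

/-- Every term acts on at most `k` spins. -/
def IsLocal (k : ℕ) : Prop := ∀ x, (H.region x).card ≤ k

/-- The interaction graph: distinct subsystems are adjacent when they overlap. -/
def interactionGraph : SimpleGraph (Fin H.numTerms) where
  Adj x y := x ≠ y ∧ (H.region x ∩ H.region y).Nonempty
  symm := ⟨fun _ _ h => ⟨h.1.symm, by rw [Finset.inter_comm]; exact h.2⟩⟩
  loopless := ⟨fun _ h => h.1 rfl⟩

instance : DecidableRel H.interactionGraph.Adj := fun x y =>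
  inferInstanceAs (Decidable (x ≠ y ∧ (H.region x ∩ H.region y).Nonempty))

end LocalHamiltonian

/-- A product state, given by a density matrix for every spin. -/
structure ProductState (n d : ℕ) where
  site : Fin n → Matrix (Fin d) (Fin d) ℂ
  posSemidef : ∀ v, (site v).PosSemidef
  trace_eq_one : ∀ v, (site v).trace = 1

/-- The density operator, the tensor product of the one-spin density matrices. -/
def ProductState.toOp {n d : ℕ} (ρ : ProductState n d) : Op n d :=
  Matrix.of fun σ τ => ∏ v, ρ.site v (σ v) (τ v)

/-- `⟨A(t)⟩ = tr (e^{iHt} A e^{-iHt} ρ)`. -/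
def expectation {n d : ℕ} (H : LocalHamiltonian n d) (A : Op n d) (ρ : ProductState n d)
    (t : ℝ) : ℂ :=
  (NormedSpace.exp ((Complex.I * t) • H.toOp) * A * NormedSpace.exp ((-(Complex.I * t)) • H.toOp)
    * ρ.toOp).trace

/-- The threshold time `t^* = 1 / (2 e 𝔡)`. -/
def tStar (D : ℕ) : ℝ := 1 / (2 * Real.exp 1 * D)

/-! ### The machine model

A random access machine with exact arithmetic. It has arrays of natural numbers (addresses, counters,
labels) and arrays of complex numbers, random access to a read-only input, and runs a finite
program. Every arithmetic operation, memory access, input access, comparison and assignment costs one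
unit of time. -/

/-- Names of the tables of natural numbers in the input. -/
inductive NatTable
  | dim | degreeBound | observable | numSites | site | numNeighbors | neighbor

/-- Names of the tables of complex numbers in the input. -/
inductive NumTable
  | time | threshold | precision | coeff | term | state | observable

/-- The read-only input: each table has two (resp. three) indices. -/
structure Input where
  nat : NatTable → ℕ → ℕ → ℕ
  num : NumTable → ℕ → ℕ → ℕ → ℂ

/-- The memory: `nat a i` and `num a i` are the `i`-th cells of the `a`-th arrays. -/
structure Memory where
  nat : ℕ → ℕ → ℕ
  num : ℕ → ℕ → ℂ

/-- The memory at the start of every run. -/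
def Memory.blank : Memory := ⟨fun _ _ => 0, fun _ _ => 0⟩

/-- Expressions with natural values; `sub` is truncated. -/
inductive NatExpr
  | const (c : ℕ)
  | read (a : ℕ) (i : NatExpr)
  | input (q : NatTable) (i j : NatExpr)
  | add (x y : NatExpr)
  | sub (x y : NatExpr)
  | mul (x y : NatExpr)

namespace NatExpr

def eval (I : Input) (s : Memory) : NatExpr → ℕ
  | const c => c
  | read a i => s.nat a (i.eval I s)
  | input q i j => I.nat q (i.eval I s) (j.eval I s)
  | add x y => x.eval I s + y.eval I s
  | sub x y => x.eval I s - y.eval I s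
  | mul x y => x.eval I s * y.eval I s

/-- The number of operations in an evaluation. -/
def cost : NatExpr → ℕ
  | const _ => 1
  | read _ i => i.cost + 1
  | input _ i j => i.cost + j.cost + 1
  | add x y => x.cost + y.cost + 1
  | sub x y => x.cost + y.cost + 1
  | mul x y => x.cost + y.cost + 1

end NatExpr

/-- Expressions with complex values. -/
inductive NumExpr
  | ofNat (x : NatExpr)
  | imagUnit
  | read (a : ℕ) (i : NatExpr)
  | input (q : NumTable) (i j l : NatExpr)
  | add (x y : NumExpr)
  | sub (x y : NumExpr)
  | mul (x y : NumExpr)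
  | div (x y : NumExpr)

namespace NumExpr

def eval (I : Input) (s : Memory) : NumExpr → ℂ
  | ofNat x => (x.eval I s : ℂ)
  | imagUnit => Complex.I
  | read a i => s.num a (i.eval I s)
  | input q i j l => I.num q (i.eval I s) (j.eval I s) (l.eval I s)
  | add x y => x.eval I s + y.eval I s
  | sub x y => x.eval I s - y.eval I s
  | mul x y => x.eval I s * y.eval I s
  | div x y => x.eval I s / y.eval I s

/-- The number of operations in an evaluation. -/
def cost : NumExpr → ℕ
  | ofNat x => x.cost + 1
  | imagUnit => 1
  | read _ i => i.cost + 1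
  | input _ i j l => i.cost + j.cost + l.cost + 1
  | add x y => x.cost + y.cost + 1
  | sub x y => x.cost + y.cost + 1
  | mul x y => x.cost + y.cost + 1
  | div x y => x.cost + y.cost + 1

end NumExpr

/-- Comparisons: of natural numbers, and of real parts of complex numbers. -/
inductive Test
  | natLt (x y : NatExpr)
  | natEq (x y : NatExpr)
  | numLt (x y : NumExpr)

namespace Test

def Holds (I : Input) (s : Memory) : Test → Prop
  | natLt x y => x.eval I s < y.eval I s
  | natEq x y => x.eval I s = y.eval I s
  | numLt x y => (x.eval I s).re < (y.eval I s).re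

def cost : Test → ℕ
  | natLt x y => x.cost + y.cost + 1
  | natEq x y => x.cost + y.cost + 1
  | numLt x y => x.cost + y.cost + 1

end Test

/-- Programs: `setNat a i e` writes the value of `e` into cell `i` of array `a`. -/
inductive Prog
  | skip
  | setNat (a : ℕ) (i e : NatExpr)
  | setNum (a : ℕ) (i : NatExpr) (e : NumExpr)
  | seq (p q : Prog)
  | branch (b : Test) (p q : Prog)
  | loop (b : Test) (p : Prog)

def Memory.writeNat (s : Memory) (a i x : ℕ) : Memory :=
  { s with nat := Function.update s.nat a (Function.update (s.nat a) i x) }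

def Memory.writeNum (s : Memory) (a i : ℕ) (x : ℂ) : Memory :=
  { s with num := Function.update s.num a (Function.update (s.num a) i x) }

/-- `Runs I p s s' T` : on input `I`, the program `p` started in memory `s` halts in memory `s'` after
exactly `T` units of time. -/
inductive Runs (I : Input) : Prog → Memory → Memory → ℕ → Prop
  | skip (s : Memory) : Runs I .skip s s 1
  | setNat (a : ℕ) (i e : NatExpr) (s : Memory) :
      Runs I (.setNat a i e) s (s.writeNat a (i.eval I s) (e.eval I s)) (i.cost + e.cost + 1)
  | setNum (a : ℕ) (i : NatExpr) (e : NumExpr) (s : Memory) :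
      Runs I (.setNum a i e) s (s.writeNum a (i.eval I s) (e.eval I s)) (i.cost + e.cost + 1)
  | seq {p q : Prog} {s s' s'' : Memory} {T T' : ℕ} :
      Runs I p s s' T → Runs I q s' s'' T' → Runs I (.seq p q) s s'' (T + T')
  | branchTrue {b : Test} {p q : Prog} {s s' : Memory} {T : ℕ} :
      b.Holds I s → Runs I p s s' T → Runs I (.branch b p q) s s' (b.cost + T)
  | branchFalse {b : Test} {p q : Prog} {s s' : Memory} {T : ℕ} :
      ¬ b.Holds I s → Runs I q s s' T → Runs I (.branch b p q) s s' (b.cost + T)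
  | loopDone {b : Test} {p : Prog} {s : Memory} :
      ¬ b.Holds I s → Runs I (.loop b p) s s b.cost
  | loopStep {b : Test} {p : Prog} {s s' s'' : Memory} {T T' : ℕ} :
      b.Holds I s → Runs I p s s' T → Runs I (.loop b p) s' s'' T' →
        Runs I (.loop b p) s s'' (b.cost + T + T')

/-- The machine is deterministic: the final memory and the run time are determined by the program,
the input and the initial memory. -/
theorem Runs.deterministic {I : Input} {p : Prog} {s s₁ : Memory} {T₁ : ℕ}
    (h₁ : Runs I p s s₁ T₁) :
    ∀ {s₂ : Memory} {T₂ : ℕ}, Runs I p s s₂ T₂ → s₁ = s₂ ∧ T₁ = T₂ := by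
  induction h₁ with
  | skip s => intro _ _ h; cases h; exact ⟨rfl, rfl⟩
  | setNat a i e s => intro _ _ h; cases h; exact ⟨rfl, rfl⟩
  | setNum a i e s => intro _ _ h; cases h; exact ⟨rfl, rfl⟩
  | seq _ _ ih ih' =>
    intro _ _ h
    cases h with
    | seq g g' =>
      obtain ⟨rfl, rfl⟩ := ih g
      obtain ⟨rfl, rfl⟩ := ih' g'
      exact ⟨rfl, rfl⟩
  | branchTrue hb _ ih =>
    intro _ _ h
    cases h with
    | branchTrue _ g => obtain ⟨rfl, rfl⟩ := ih g; exact ⟨rfl, rfl⟩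
    | branchFalse hn _ => exact absurd hb hn
  | branchFalse hb _ ih =>
    intro _ _ h
    cases h with
    | branchTrue hn _ => exact absurd hn hb
    | branchFalse _ g => obtain ⟨rfl, rfl⟩ := ih g; exact ⟨rfl, rfl⟩
  | loopDone hb =>
    intro _ _ h
    cases h with
    | loopDone _ => exact ⟨rfl, rfl⟩
    | loopStep hn _ _ => exact absurd hn hb
  | loopStep hb _ _ ih ih' =>
    intro _ _ h
    cases h with
    | loopDone hn => exact absurd hb hn
    | loopStep _ g g' =>
      obtain ⟨rfl, rfl⟩ := ih g
      obtain ⟨rfl, rfl⟩ := ih' g'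
      exact ⟨rfl, rfl⟩

/-! ### How an instance is presented to the machine

Subsystems are named by their labels, spins by their positions in `Fin n`. The interaction graph is
given by adjacency lists. An operator acting on `X` is given by its matrix on the spins of
`X`, of size `d ^ |X|`. The size of the whole system is not among the data. Indices out of
range return `0`. -/

/-- The configuration in which the spins of `X`, in increasing order, carry the base-`d` digits of
`a` (least significant digit first), all other spins being in state `0`. -/
def localConfig {n d : ℕ} [NeZero d] (X : Finset (Fin n)) (a : ℕ) : Fin n → Fin d :=
  fun v => if v ∈ X then Fin.ofNat d (a / d ^ (X.filter (· < v)).card) else 0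

/-- Entry `(a, b)` of the matrix on the spins of `X` of an operator acting on `X`. -/
def localEntry {n d : ℕ} [NeZero d] (X : Finset (Fin n)) (B : Op n d) (a b : ℕ) : ℂ :=
  if a < d ^ X.card ∧ b < d ^ X.card then B (localConfig X a) (localConfig X b) else 0

/-- The `i`-th element, in increasing order, of a finite set of labels or spins. -/
def nthElement {m : ℕ} (s : Finset (Fin m)) (i : ℕ) : ℕ :=
  ((s.sort (· ≤ ·)).map (fun v : Fin m => (v : ℕ))).getD i 0

/-- The input tables for the Hamiltonian `H`, with bound `D` on the degrees in the interaction graph,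
the observable `A` with support `H.region o`, the product state `ρ`, time `t` and precision `ε`. -/
def instanceInput {n d : ℕ} [NeZero d] (D : ℕ) (H : LocalHamiltonian n d) (A : Op n d)
    (o : Fin H.numTerms) (ρ : ProductState n d) (t ε : ℝ) : Input where
  nat
    | .dim, _, _ => d
    | .degreeBound, _, _ => D
    | .observable, _, _ => o
    | .numSites, x, _ => if h : x < H.numTerms then (H.region ⟨x, h⟩).card else 0
    | .site, x, i => if h : x < H.numTerms then nthElement (H.region ⟨x, h⟩) i else 0
    | .numNeighbors, x, _ => if h : x < H.numTerms then H.interactionGraph.degree ⟨x, h⟩ else 0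
    | .neighbor, x, i =>
        if h : x < H.numTerms then nthElement (H.interactionGraph.neighborFinset ⟨x, h⟩) i else 0
  num
    | .time, _, _, _ => t
    | .threshold, _, _, _ => tStar D
    | .precision, _, _, _ => ε
    | .coeff, x, _, _ => if h : x < H.numTerms then (H.coeff ⟨x, h⟩ : ℂ) else 0
    | .term, x, a, b =>
        if h : x < H.numTerms then localEntry (H.region ⟨x, h⟩) (H.term ⟨x, h⟩) a b else 0
    | .state, v, a, b =>
        if h : v < n ∧ a < d ∧ b < d then ρ.site ⟨v, h.1⟩ ⟨a, h.2.1⟩ ⟨b, h.2.2⟩ else 0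
    | .observable, a, b, _ => localEntry (H.region o) A a b

/-- The quantity `((1 / (1 - |t| / t^*)) (1 / ε)) ^ (1 / log (t^* / |t|))`. At `t = 0` the exponent is
`0`, its limit as `t` tends to `0`. -/
def runTimeScale (D : ℕ) (t ε : ℝ) : ℝ :=
  ((1 / (1 - |t| / tStar D)) * (1 / ε)) ^ (1 / Real.log (tStar D / |t|))

end ShortTime

end

/-! # Simulation of short-time quantum dynamics in time independent of the system size

Conjugation with `exp (itH)` is the exponential of a commutator, so the expectation is the sum of
`(it)^m / m!` times the expectation of the `m`-fold commutator of `H` with `A` (`hasSum_adPow`,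
`hasSum_expectation`). Expanding `H` into its terms, a nested commutator vanishes unless each of its
labels equals or neighbours a label further inside (`LocalHamiltonian.nested_cons_eq_zero`). Hence there
are at most `m! (D + 1)^m` labellings that count, the `m`-fold commutator has norm at most
`m! (2 (D + 1))^m ‖A‖` (`LocalHamiltonian.norm_adPow_le`), and up to the threshold time, because of
`D + 1 ≤ e D`, the series is dominated by the geometric series with ratio `τ = |t| / t^*`
(`norm_expectation_sub_le`). The algorithm evaluates the Taylor polynomial of the least degree `M` with
`τ^(M + 1) / (1 - τ) ≤ ε`.

That polynomial involves only terms near the observable, but they may be too many for a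
computation in the tensor product of all their spins: the number of labels within distance `M` grows
like `D^M`. A single nested commutator, however, involves at most `M` labels, which form a connected
set together with the label of the observable. The algorithm therefore runs through `3^(D (M + 1))`
explorations of the interaction graph. At each new label an exploration either rejects it, or accepts
it into the Hamiltonian, or accepts it without putting it into the Hamiltonian and changes its sign.
The Taylor polynomials for the resulting small Hamiltonians are added with these signs. For a given
nested commutator, the two ways to accept a label that does not occur in it cancel, so that only the
exploration which accepts precisely the labels of the commutator survives (`Input.sumRuns_eq_greedy`,
`Input.sum_sign_explore`). This is an inclusion-exclusion over connected sets, and the signed sum is the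
Taylor polynomial of the full evolution (`output_eq`).

Each exploration chooses at most `D (M + 1) + 1` subsystems, and all loops have length at most
`K^(M + 1)`, where `K` depends only on `d`, `k` and `D` (`ens_algorithm`). For a fixed program the run
time is polynomial in the bound on the lengths of the loops (`Prog.exists_bound_le`), hence polynomial
in `e^M`. The minimality of `M` bounds `e^M` by the run time scale (`exp_le_runTimeScale`).
-/

namespace ShortTime

/-! ### Expressions and memory -/

instance : Add NatExpr := ⟨.add⟩
instance : Sub NatExpr := ⟨.sub⟩
instance : Mul NatExpr := ⟨.mul⟩
instance (c : ℕ) : OfNat NatExpr c := ⟨.const c⟩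
instance : Add NumExpr := ⟨.add⟩
instance : Sub NumExpr := ⟨.sub⟩
instance : Mul NumExpr := ⟨.mul⟩
instance : Div NumExpr := ⟨.div⟩
instance (c : ℕ) : OfNat NumExpr c := ⟨.ofNat (.const c)⟩

section Eval

variable (I : Input) (s : Memory)

@[simp] theorem NatExpr.eval_add' (x y : NatExpr) : (x + y).eval I s = x.eval I s + y.eval I s := rfl
@[simp] theorem NatExpr.eval_sub' (x y : NatExpr) : (x - y).eval I s = x.eval I s - y.eval I s := rfl
@[simp] theorem NatExpr.eval_mul' (x y : NatExpr) : (x * y).eval I s = x.eval I s * y.eval I s := rfl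
@[simp] theorem NatExpr.eval_ofNat (c : ℕ) :
    (ofNat(c) : NatExpr).eval I s = (OfNat.ofNat c : ℕ) := rfl
@[simp] theorem NatExpr.eval_read (a : ℕ) (i : NatExpr) :
    (NatExpr.read a i).eval I s = s.nat a (i.eval I s) := rfl
@[simp] theorem NatExpr.eval_input (q : NatTable) (i j : NatExpr) :
    (NatExpr.input q i j).eval I s = I.nat q (i.eval I s) (j.eval I s) := rfl
@[simp] theorem NumExpr.eval_add' (x y : NumExpr) : (x + y).eval I s = x.eval I s + y.eval I s := rfl
@[simp] theorem NumExpr.eval_sub' (x y : NumExpr) : (x - y).eval I s = x.eval I s - y.eval I s := rfl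
@[simp] theorem NumExpr.eval_mul' (x y : NumExpr) : (x * y).eval I s = x.eval I s * y.eval I s := rfl
@[simp] theorem NumExpr.eval_div' (x y : NumExpr) : (x / y).eval I s = x.eval I s / y.eval I s := rfl
@[simp] theorem NumExpr.eval_ofNat' (c : ℕ) :
    (ofNat(c) : NumExpr).eval I s = ((OfNat.ofNat c : ℕ) : ℂ) := rfl
@[simp] theorem NumExpr.eval_ofNatExpr (x : NatExpr) :
    (NumExpr.ofNat x).eval I s = (x.eval I s : ℂ) := rfl
@[simp] theorem NumExpr.eval_imagUnit : NumExpr.imagUnit.eval I s = Complex.I := rfl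
@[simp] theorem NumExpr.eval_read (a : ℕ) (i : NatExpr) :
    (NumExpr.read a i).eval I s = s.num a (i.eval I s) := rfl
@[simp] theorem NumExpr.eval_input (q : NumTable) (i j l : NatExpr) :
    (NumExpr.input q i j l).eval I s = I.num q (i.eval I s) (j.eval I s) (l.eval I s) := rfl

@[simp] theorem Test.holds_natLt (x y : NatExpr) :
    (Test.natLt x y).Holds I s ↔ x.eval I s < y.eval I s := Iff.rfl
@[simp] theorem Test.holds_natEq (x y : NatExpr) :
    (Test.natEq x y).Holds I s ↔ x.eval I s = y.eval I s := Iff.rfl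
@[simp] theorem Test.holds_numLt (x y : NumExpr) :
    (Test.numLt x y).Holds I s ↔ (x.eval I s).re < (y.eval I s).re := Iff.rfl

variable {s}

@[simp] theorem Memory.writeNat_nat (a i x b j : ℕ) :
    (s.writeNat a i x).nat b j = if b = a ∧ j = i then x else s.nat b j := by
  unfold Memory.writeNat
  by_cases h : b = a
  · subst h; by_cases h' : j = i <;> simp [h']
  · simp [h]
@[simp] theorem Memory.writeNat_num (a i x : ℕ) : (s.writeNat a i x).num = s.num := rfl
@[simp] theorem Memory.writeNum_nat (a i : ℕ) (x : ℂ) : (s.writeNum a i x).nat = s.nat := rfl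
@[simp] theorem Memory.writeNum_num (a i : ℕ) (x : ℂ) (b j : ℕ) :
    (s.writeNum a i x).num b j = if b = a ∧ j = i then x else s.num b j := by
  unfold Memory.writeNum
  by_cases h : b = a
  · subst h; by_cases h' : j = i <;> simp [h']
  · simp [h]

end Eval

/-! ### A program logic with time bounds -/

namespace Prog

/-- The arrays of natural numbers that a program may write. -/
def natWrites : Prog → List ℕ
  | skip => []
  | setNat a _ _ => [a]
  | setNum _ _ _ => []
  | seq p q => p.natWrites ++ q.natWrites
  | branch _ p q => p.natWrites ++ q.natWrites
  | loop _ p => p.natWrites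

/-- The arrays of complex numbers that a program may write. -/
def numWrites : Prog → List ℕ
  | skip => []
  | setNat _ _ _ => []
  | setNum a _ _ => [a]
  | seq p q => p.numWrites ++ q.numWrites
  | branch _ p q => p.numWrites ++ q.numWrites
  | loop _ p => p.numWrites

/-- A bound for the run time when every execution of a loop makes at most `Z` iterations. -/
def bound (Z : ℕ) : Prog → ℕ
  | skip => 1
  | setNat _ i e => i.cost + e.cost + 1
  | setNum _ i e => i.cost + e.cost + 1
  | seq p q => p.bound Z + q.bound Z
  | branch b p q => b.cost + (p.bound Z + q.bound Z)
  | loop b p => b.cost + Z * (b.cost + p.bound Z)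

/-- For a fixed program, the run time is polynomial in the bound on the lengths of the loops. -/
theorem exists_bound_le (p : Prog) : ∃ c q : ℕ, ∀ Z, p.bound Z ≤ c * (Z + 1) ^ q := by
  have mono : ∀ {c c' q q' Z : ℕ}, c ≤ c' → q ≤ q' → c * (Z + 1) ^ q ≤ c' * (Z + 1) ^ q' :=
    fun h h' => Nat.mul_le_mul h (Nat.pow_le_pow_right (by omega) h')
  induction p with
  | skip => exact ⟨1, 0, fun Z => by simp [bound]⟩
  | setNat a i e => exact ⟨i.cost + e.cost + 1, 0, fun Z => by simp [bound]⟩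
  | setNum a i e => exact ⟨i.cost + e.cost + 1, 0, fun Z => by simp [bound]⟩
  | seq p q ihp ihq =>
    obtain ⟨c, k, h⟩ := ihp
    obtain ⟨c', k', h'⟩ := ihq
    refine ⟨c + c', k + k', fun Z => ?_⟩
    rw [add_mul]
    exact Nat.add_le_add ((h Z).trans (mono le_rfl (by omega))) ((h' Z).trans (mono le_rfl (by omega)))
  | branch b p q ihp ihq =>
    obtain ⟨c, k, h⟩ := ihp
    obtain ⟨c', k', h'⟩ := ihq
    refine ⟨b.cost + (c + c'), k + k', fun Z => ?_⟩
    rw [add_mul, add_mul]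
    refine Nat.add_le_add ?_ (Nat.add_le_add ((h Z).trans (mono le_rfl (by omega)))
      ((h' Z).trans (mono le_rfl (by omega))))
    simpa using mono (c := b.cost) (Z := Z) le_rfl (Nat.zero_le (k + k'))
  | loop b p ih =>
    obtain ⟨c, k, h⟩ := ih
    refine ⟨b.cost + (b.cost + c), k + 1, fun Z => ?_⟩
    have h1 : b.cost ≤ b.cost * (Z + 1) ^ (k + 1) := by
      simpa using mono (c := b.cost) (Z := Z) le_rfl (Nat.zero_le (k + 1))
    have h2 : b.cost ≤ b.cost * (Z + 1) ^ k := by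
      simpa using mono (c := b.cost) (Z := Z) le_rfl (Nat.zero_le k)
    calc b.cost + Z * (b.cost + p.bound Z)
        ≤ b.cost * (Z + 1) ^ (k + 1) + (Z + 1) * (b.cost * (Z + 1) ^ k + c * (Z + 1) ^ k) := by
          gcongr
          · omega
          · exact h Z
      _ = _ := by ring

end Prog

/-- The memories `s` and `s'` coincide outside the arrays of natural numbers in `W` and the arrays of
complex numbers in `V`. -/
structure Agree (W V : List ℕ) (s s' : Memory) : Prop where
  nat : ∀ a, a ∉ W → s'.nat a = s.nat a
  num : ∀ a, a ∉ V → s'.num a = s.num a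

namespace Agree

variable {W V W' V' : List ℕ} {s s' s'' : Memory}

theorem rfl' : Agree W V s s := ⟨fun _ _ => rfl, fun _ _ => rfl⟩

theorem trans (h : Agree W V s s') (h' : Agree W V s' s'') : Agree W V s s'' :=
  ⟨fun a ha => (h'.nat a ha).trans (h.nat a ha), fun a ha => (h'.num a ha).trans (h.num a ha)⟩

theorem mono (h : Agree W V s s') (hW : W ⊆ W') (hV : V ⊆ V') : Agree W' V' s s' :=
  ⟨fun a ha => h.nat a fun h' => ha (hW h'), fun a ha => h.num a fun h' => ha (hV h')⟩

theorem writeNat {a i x : ℕ} (ha : a ∈ W) (h : Agree W V s s') : Agree W V s (s'.writeNat a i x) :=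
  ⟨fun b hb => by
    rw [← h.nat b hb]; funext j; simp [show b ≠ a from fun e => hb (e ▸ ha)], h.num⟩

theorem writeNum {a i : ℕ} {x : ℂ} (ha : a ∈ V) (h : Agree W V s s') :
    Agree W V s (s'.writeNum a i x) :=
  ⟨h.nat, fun b hb => by
    rw [← h.num b hb]; funext j; simp [show b ≠ a from fun e => hb (e ▸ ha)]⟩

end Agree

/-- A run changes only the arrays that the program may write. -/
theorem Runs.agree {I : Input} {p : Prog} {s s' : Memory} {T : ℕ} (h : Runs I p s s' T) :
    Agree p.natWrites p.numWrites s s' := by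
  induction h with
  | skip s => exact .rfl'
  | setNat a i e s => exact Agree.rfl'.writeNat (by simp [Prog.natWrites])
  | setNum a i e s => exact Agree.rfl'.writeNum (by simp [Prog.numWrites])
  | seq _ _ ih ih' =>
    exact (ih.mono (List.subset_append_left ..) (List.subset_append_left ..)).trans
      (ih'.mono (List.subset_append_right ..) (List.subset_append_right ..))
  | branchTrue _ _ ih => exact ih.mono (List.subset_append_left ..) (List.subset_append_left ..)
  | branchFalse _ _ ih => exact ih.mono (List.subset_append_right ..) (List.subset_append_right ..)
  | loopDone _ => exact .rfl'
  | loopStep _ _ _ ih ih' => exact Agree.trans ih ih'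

/-- On input `I`, the program `p` started in `s` halts, within the time that loops of at most `Z`
iterations allow, in a memory that satisfies `Q`. -/
def Ens (I : Input) (Z : ℕ) (p : Prog) (s : Memory) (Q : Memory → Prop) : Prop :=
  ∃ s' T, Runs I p s s' T ∧ T ≤ p.bound Z ∧ Q s'

namespace Ens

variable {I : Input} {Z : ℕ} {p q : Prog} {s : Memory} {Q Q' : Memory → Prop}

theorem imp (h : Ens I Z p s Q) (h' : ∀ s', Agree p.natWrites p.numWrites s s' → Q s' → Q' s') :
    Ens I Z p s Q' := by
  obtain ⟨s', T, hr, hT, hQ⟩ := h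
  exact ⟨s', T, hr, hT, h' s' hr.agree hQ⟩

theorem skip (h : Q s) : Ens I Z .skip s Q := ⟨s, 1, .skip s, le_rfl, h⟩

theorem setNat {a : ℕ} {i e : NatExpr} (h : Q (s.writeNat a (i.eval I s) (e.eval I s))) :
    Ens I Z (.setNat a i e) s Q := ⟨_, _, .setNat a i e s, le_rfl, h⟩

theorem setNum {a : ℕ} {i : NatExpr} {e : NumExpr}
    (h : Q (s.writeNum a (i.eval I s) (e.eval I s))) :
    Ens I Z (.setNum a i e) s Q := ⟨_, _, .setNum a i e s, le_rfl, h⟩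

theorem seq (h : Ens I Z p s fun s' => Ens I Z q s' Q) : Ens I Z (.seq p q) s Q := by
  obtain ⟨s', T, hr, hT, s'', T', hr', hT', hQ⟩ := h
  exact ⟨s'', _, hr.seq hr', Nat.add_le_add hT hT', hQ⟩

/-- Sequential composition; the second part may use that the first one left most arrays alone. -/
theorem seq' (h : Ens I Z p s Q')
    (h' : ∀ s', Agree p.natWrites p.numWrites s s' → Q' s' → Ens I Z q s' Q) :
    Ens I Z (.seq p q) s Q := (h.imp h').seq

/-- An assignment followed by `q`, the values of the index and of the right-hand side being known. -/
theorem setNat_seq {a k v : ℕ} {i e : NatExpr} (hi : i.eval I s = k) (he : e.eval I s = v)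
    (h : Ens I Z q (s.writeNat a k v) Q) : Ens I Z (.seq (.setNat a i e) q) s Q :=
  seq (setNat (by rwa [hi, he]))

theorem setNum_seq {a k : ℕ} {v : ℂ} {i : NatExpr} {e : NumExpr} (hi : i.eval I s = k)
    (he : e.eval I s = v) (h : Ens I Z q (s.writeNum a k v) Q) :
    Ens I Z (.seq (.setNum a i e) q) s Q :=
  seq (setNum (by rwa [hi, he]))

theorem branch {b : Test} (h : b.Holds I s → Ens I Z p s Q) (h' : ¬ b.Holds I s → Ens I Z q s Q) :
    Ens I Z (.branch b p q) s Q := by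
  by_cases hb : b.Holds I s
  · obtain ⟨s', T, hr, hT, hQ⟩ := h hb
    exact ⟨s', _, .branchTrue hb hr, by simp only [Prog.bound]; omega, hQ⟩
  · obtain ⟨s', T, hr, hT, hQ⟩ := h' hb
    exact ⟨s', _, .branchFalse hb hr, by simp only [Prog.bound]; omega, hQ⟩

/-- A loop of exactly `N` iterations: `Inv i` holds after `i` of them, and the condition of the loop
fails for the first time after the last one. -/
theorem loop {b : Test} {N : ℕ} (hN : N ≤ Z) (Inv : ℕ → Memory → Prop) (h0 : Inv 0 s)
    (hstep : ∀ i < N, ∀ s', Agree p.natWrites p.numWrites s s' → Inv i s' →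
      b.Holds I s' ∧ Ens I Z p s' (Inv (i + 1)))
    (hend : ∀ s', Agree p.natWrites p.numWrites s s' → Inv N s' → ¬ b.Holds I s') :
    Ens I Z (.loop b p) s (Inv N) := by
  have key : ∀ k i, i + k = N → ∀ s', Agree p.natWrites p.numWrites s s' → Inv i s' →
      ∃ s'' T, Runs I (.loop b p) s' s'' T ∧ T ≤ b.cost + k * (b.cost + p.bound Z) ∧ Inv N s'' := by
    intro k
    induction k with
    | zero =>
      rintro i rfl s' ha hi
      exact ⟨s', _, .loopDone (hend s' ha hi), by simp, hi⟩
    | succ k ih =>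
      intro i hi s' ha hinv
      obtain ⟨hb, s₁, T₁, hr₁, hT₁, hinv₁⟩ := hstep i (by omega) s' ha hinv
      obtain ⟨s₂, T₂, hr₂, hT₂, hinv₂⟩ := ih (i + 1) (by omega) s₁ (ha.trans hr₁.agree) hinv₁
      refine ⟨s₂, _, .loopStep hb hr₁ hr₂, ?_, hinv₂⟩
      rw [add_mul]; omega
  obtain ⟨s', T, hr, hT, hQ⟩ := key N 0 (by omega) s .rfl' h0
  exact ⟨s', T, hr, hT.trans (Nat.add_le_add_left (Nat.mul_le_mul_right _ hN) _), hQ⟩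

end Ens

/-! ### Registers and counting loops -/

/-- The content of cell `0` of an array, used as a register. -/
abbrev reg (a : ℕ) : NatExpr := .read a 0

/-- The content of cell `0` of an array of complex numbers. -/
abbrev numReg (a : ℕ) : NumExpr := .read a 0

/-- Assignment to a register. -/
abbrev setReg (a : ℕ) (e : NatExpr) : Prog := .setNat a 0 e

/-- Assignment to a complex register. -/
abbrev setNumReg (a : ℕ) (e : NumExpr) : Prog := .setNum a 0 e

/-- Sequential composition of programs. -/
infixr:60 " ;; " => Prog.seq

/-- Run `p` with the register `r` equal to `0`, `1`, … as long as `r` is less than `e`. -/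
def forLoop (r : ℕ) (e : NatExpr) (p : Prog) : Prog :=
  setReg r 0 ;; .loop (.natLt (reg r) e) (p ;; setReg r (reg r + 1))

@[simp] theorem natWrites_forLoop (r : ℕ) (e : NatExpr) (p : Prog) :
    (forLoop r e p).natWrites = r :: (p.natWrites ++ [r]) := rfl
@[simp] theorem numWrites_forLoop (r : ℕ) (e : NatExpr) (p : Prog) :
    (forLoop r e p).numWrites = p.numWrites ++ [] := rfl

/-- An assignment to a register, after which only the value of the register matters. -/
theorem Ens.setReg_seq {I : Input} {Z a v : ℕ} {e : NatExpr} {q : Prog} {s : Memory}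
    {Q : Memory → Prop} (he : e.eval I s = v)
    (h : ∀ s', Agree [a] [] s s' → s'.nat a 0 = v → Ens I Z q s' Q) :
    Ens I Z (setReg a e ;; q) s Q :=
  Ens.setNat_seq rfl he (h _ (.writeNat (by simp) .rfl') (by simp))

theorem Ens.setNumReg_seq {I : Input} {Z a : ℕ} {v : ℂ} {e : NumExpr} {q : Prog} {s : Memory}
    {Q : Memory → Prop} (he : e.eval I s = v)
    (h : ∀ s', Agree [] [a] s s' → s'.num a 0 = v → Ens I Z q s' Q) :
    Ens I Z (setNumReg a e ;; q) s Q :=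
  Ens.setNum_seq rfl he (h _ (.writeNum (by simp) .rfl') (by simp))

/-- A counting loop of `N` iterations with invariant `Inv`; the invariant must not depend on the
counter `r`. -/
theorem Ens.forLoop {I : Input} {Z N r : ℕ} {e : NatExpr} {p : Prog} {s : Memory}
    (hN : N ≤ Z) (hr : r ∉ p.natWrites)
    (he : ∀ s', Agree (r :: p.natWrites) p.numWrites s s' → e.eval I s' = N)
    (Inv : ℕ → Memory → Prop) (h0 : Inv 0 s)
    (hInv : ∀ i s' x, Inv i s' → Inv i (s'.writeNat r 0 x))
    (hstep : ∀ i < N, ∀ s', Agree (r :: p.natWrites) p.numWrites s s' → s'.nat r 0 = i → Inv i s' →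
      Ens I Z p s' (Inv (i + 1))) :
    Ens I Z (forLoop r e p) s (Inv N) := by
  have hag : ∀ {s'}, Agree (p ;; setReg r (reg r + 1)).natWrites
      (p ;; setReg r (reg r + 1)).numWrites (s.writeNat r 0 0) s' →
      Agree (r :: p.natWrites) p.numWrites s s' := fun h =>
    (Agree.rfl'.writeNat (by simp)).trans
      (h.mono (by simp [Prog.natWrites]) (by simp [Prog.numWrites]))
  refine (Ens.setNat ?_).seq
  refine (Ens.loop hN (fun i s' => s'.nat r 0 = i ∧ Inv i s') ⟨by simp, hInv _ _ _ h0⟩ ?_ ?_).imp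
    fun _ _ h => h.2
  · rintro i hi s' ha ⟨hri, hinv⟩
    have ha' := hag ha
    refine ⟨by simp [hri, he s' ha', hi], ?_⟩
    refine (hstep i hi s' ha' hri hinv).seq' fun s'' ha'' h => Ens.setNat ⟨?_, hInv _ _ _ h⟩
    simp [ha''.nat r hr, hri]
  · rintro s' ha ⟨hri, -⟩
    simp [hri, he s' (hag ha)]

/-! ### The quantities that the algorithm computes -/

namespace Input

variable (I : Input)

/-- The dimension of the state space of one spin. -/
abbrev d : ℕ := I.nat .dim 0 0
/-- The bound on the degrees in the interaction graph. -/
abbrev degreeBound : ℕ := I.nat .degreeBound 0 0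
/-- The label of the subsystem of the observable. -/
abbrev obs : ℕ := I.nat .observable 0 0
/-- The number of spins of the subsystem `x`. -/
abbrev numSites (x : ℕ) : ℕ := I.nat .numSites x 0
/-- The `i`-th spin of the subsystem `x`. -/
abbrev site (x i : ℕ) : ℕ := I.nat .site x i
/-- The number of neighbours of the label `x` in the interaction graph. -/
abbrev numNbrs (x : ℕ) : ℕ := I.nat .numNeighbors x 0

/-- The neighbours of the label `x` in the interaction graph. -/
def nbrs (x : ℕ) : List ℕ := (List.range (I.numNbrs x)).map (I.nat .neighbor x)

/-- Append a spin to a list of spins unless it is there already. -/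
def addSite (L : List ℕ) (v : ℕ) : List ℕ := if v ∈ L then L else L ++ [v]

/-- Append the first `i` spins of the subsystem `x` to a list of spins. -/
def addSites (L : List ℕ) (x i : ℕ) : List ℕ :=
  (List.range i).foldl (fun L i => addSite L (I.site x i)) L

/-- The spins of the subsystems with labels in `B`, without repetitions. -/
def layout (B : List ℕ) : List ℕ := B.foldl (fun L x => I.addSites L x (I.numSites x)) []

/-- The state of the spin `v` in the configuration of the spins in `L` with number `σ`; the spin at
position `i` of `L` carries the `i`-th digit. -/
def digit (L : List ℕ) (σ v : ℕ) : ℕ := σ / I.d ^ L.idxOf v % I.d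

/-- The number of the restriction to the first `i` spins of `x` of the configuration `σ`. -/
def localCode (L : List ℕ) (x i σ : ℕ) : ℕ :=
  ∑ l ∈ Finset.range i, I.digit L σ (I.site x l) * I.d ^ l

/-- The part of the number `σ` which is due to the first `i` spins of `x`. -/
def share (L : List ℕ) (x i σ : ℕ) : ℕ :=
  ∑ l ∈ Finset.range i, I.digit L σ (I.site x l) * I.d ^ L.idxOf (I.site x l)

open Classical in
/-- The matrix on the spins in `L` of the operator which has the matrix `f` on the spins of `x` and
is the identity elsewhere. The two configurations coincide off `x` iff the numbers compared here are
equal. -/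
noncomputable def embed (L : List ℕ) (f : ℕ → ℕ → ℂ) (x σ τ : ℕ) : ℂ :=
  if σ + I.share L x (I.numSites x) τ = τ + I.share L x (I.numSites x) σ then
    f (I.localCode L x (I.numSites x) σ) (I.localCode L x (I.numSites x) τ)
  else 0

/-- The matrix on the spins in `L` of the part of the Hamiltonian with labels in `B`. -/
noncomputable def hamMatrix (L B : List ℕ) (σ τ : ℕ) : ℂ :=
  (B.map fun x => I.embed L (fun a b => I.num .coeff x 0 0 * I.num .term x a b) x σ τ).sum

/-- The matrix of the observable on the spins in `L`. -/
noncomputable def obsMatrix (L : List ℕ) : ℕ → ℕ → ℂ :=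
  I.embed L (fun a b => I.num .observable a b 0) I.obs

/-- The matrix of the product state of the spins in `L`. -/
noncomputable def stateMatrix (L : List ℕ) (σ τ : ℕ) : ℂ :=
  (L.map fun v => I.num .state v (I.digit L σ v) (I.digit L τ v)).prod

/-- The `m`-fold commutator of the Hamiltonian with the observable, on the spins in `L`. -/
noncomputable def commMatrix (L B : List ℕ) : ℕ → ℕ → ℕ → ℂ
  | 0, σ, τ => I.obsMatrix L σ τ
  | m + 1, σ, τ => ∑ υ ∈ Finset.range (I.d ^ L.length),
      (I.hamMatrix L B σ υ * commMatrix L B m υ τ - commMatrix L B m σ υ * I.hamMatrix L B υ τ)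

/-- `(it)^m / m!` -/
noncomputable def taylorCoeff : ℕ → ℂ
  | 0 => 1
  | m + 1 => taylorCoeff m * (Complex.I * I.num .time 0 0 0) / (m + 1 : ℕ)

/-- The Taylor polynomial of degree `M` of the time evolution under the part of the Hamiltonian with
labels in `B`. -/
noncomputable def taylorValue (B : List ℕ) (M : ℕ) : ℂ :=
  ∑ m ∈ Finset.range (M + 1), I.taylorCoeff m *
    ∑ σ ∈ Finset.range (I.d ^ (I.layout B).length), ∑ τ ∈ Finset.range (I.d ^ (I.layout B).length),
      I.commMatrix (I.layout B) B m σ τ * I.stateMatrix (I.layout B) τ σ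

end Input

/-- A stage of an exploration of the interaction graph: the list `cand` of candidates, of which an
initial part has been dealt with, the labels `seen` so far, the list `chosen` of labels that enter the
Hamiltonian, and the sign with which the result counts. -/
structure Exploration where
  cand : List ℕ
  seen : Finset ℕ
  chosen : List ℕ
  sign : ℂ

namespace Input

variable (I : Input)

/-- The start of an exploration at the label of the observable. -/
def start : Exploration := ⟨I.nbrs I.obs, {I.obs}, [I.obs], 1⟩

/-- Deal with the `u`-th candidate. If it is new, then `g = 0` rejects it, `g = 1` accepts it into the
connected set but not into the Hamiltonian, at the price of a sign, and any other `g` accepts it into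
both. If there is no new candidate, only `g = 0` counts. -/
def step (u g : ℕ) (e : Exploration) : Exploration :=
  let y := e.cand.getD u I.obs
  if y ∈ e.seen then (if g = 0 then e else { e with sign := 0 })
  else if g = 0 then { e with seen := insert y e.seen }
  else if g = 1 then ⟨e.cand ++ I.nbrs y, insert y e.seen, e.chosen, -e.sign⟩
  else ⟨e.cand ++ I.nbrs y, insert y e.seen, e.chosen ++ [y], e.sign⟩

/-- The exploration after `u` steps, steered by the base-3 digits of `w`. -/
def explore (w : ℕ) : ℕ → Exploration
  | 0 => I.start
  | u + 1 => I.step u (w / 3 ^ u % 3) (explore w u)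

/-- The number of steps of an exploration for the Taylor polynomial of degree `M`. -/
abbrev steps (M : ℕ) : ℕ := I.degreeBound * (M + 1)

/-- The result of the algorithm: the signed sum over all explorations of the Taylor polynomials for
the labels that they choose. -/
noncomputable def output (M : ℕ) : ℂ :=
  ∑ w ∈ Finset.range (3 ^ I.steps M), (I.explore w (I.steps M)).sign *
    I.taylorValue (I.explore w (I.steps M)).chosen M

end Input

/-! ### Division with remainder -/

/-- `q := x / b` -/
def divInto (q : ℕ) (x b : NatExpr) : Prog :=
  setReg q 0 ;; .loop (.natLt (reg q * b + b) (x + 1)) (setReg q (reg q + 1))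

/-- `q := q % b` -/
def modReg (q : ℕ) (b : NatExpr) : Prog := .loop (.natLt b (reg q + 1)) (setReg q (reg q - b))

/-- `q := x / b % c` -/
def digitInto (q : ℕ) (x b c : NatExpr) : Prog := divInto q x b ;; modReg q c

@[simp] theorem natWrites_divInto (q : ℕ) (x b : NatExpr) :
    (divInto q x b).natWrites = [q, q] := rfl
@[simp] theorem numWrites_divInto (q : ℕ) (x b : NatExpr) : (divInto q x b).numWrites = [] := rfl
@[simp] theorem natWrites_digitInto (q : ℕ) (x b c : NatExpr) :
    (digitInto q x b c).natWrites = [q, q, q] := rfl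
@[simp] theorem numWrites_digitInto (q : ℕ) (x b c : NatExpr) :
    (digitInto q x b c).numWrites = [] := rfl

section

variable {I : Input} {Z : ℕ} {s : Memory}

theorem ens_divInto {q X p : ℕ} {x b : NatExpr} (hp : 0 < p) (hX : X ≤ Z)
    (hx : ∀ s', Agree [q] [] s s' → x.eval I s' = X)
    (hb : ∀ s', Agree [q] [] s s' → b.eval I s' = p) :
    Ens I Z (divInto q x b) s fun s' => s'.nat q 0 = X / p := by
  refine (Ens.setNat ?_).seq
  have hag : ∀ {s'}, Agree (setReg q (reg q + 1)).natWrites (setReg q (reg q + 1)).numWrites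
      (s.writeNat q (NatExpr.eval I s 0) (NatExpr.eval I s 0)) s' → Agree [q] [] s s' := fun h =>
    (Agree.rfl'.writeNat (by simp)).trans h
  refine Ens.loop (N := X / p) ((Nat.div_le_self _ _).trans hX) (fun i s' => s'.nat q 0 = i)
    (by simp) ?_ ?_
  · intro i hi s' h hq
    refine ⟨?_, Ens.setNat (by simp [hq])⟩
    have h1 : (i + 1) * p ≤ X := (Nat.le_div_iff_mul_le hp).1 hi
    simp [hq, hx s' (hag h), hb s' (hag h)]
    linarith
  · intro s' h hq
    have h1 := Nat.lt_div_mul_add hp (a := X)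
    simp [hq, hx s' (hag h), hb s' (hag h)]
    omega

theorem ens_modReg {q X p : ℕ} {b : NatExpr} (hp : 0 < p) (hX : X ≤ Z) (hq : s.nat q 0 = X)
    (hb : ∀ s', Agree [q] [] s s' → b.eval I s' = p) :
    Ens I Z (modReg q b) s fun s' => s'.nat q 0 = X % p := by
  refine (Ens.loop (N := X / p) ((Nat.div_le_self _ _).trans hX)
    (fun i s' => s'.nat q 0 = X - i * p) (by simp [hq]) ?_ ?_).imp fun s' _ h => ?_
  · intro i hi s' h hq
    have h1 : (i + 1) * p ≤ X := (Nat.le_div_iff_mul_le hp).1 hi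
    have h2 : i * p + p ≤ X := by linarith
    refine ⟨?_, Ens.setNat ?_⟩
    · simp [hq, hb s' h]; omega
    · simp [hq, hb s' h, add_mul]; omega
  · intro s' h hq
    have h1 := Nat.lt_div_mul_add hp (a := X)
    simp [hq, hb s' h]; omega
  · rw [h, mul_comm, ← Nat.mod_eq_sub_mul_div]

theorem ens_digitInto {q X p r : ℕ} {x b c : NatExpr} (hp : 0 < p) (hr : 0 < r) (hX : X ≤ Z)
    (hx : ∀ s', Agree [q] [] s s' → x.eval I s' = X)
    (hb : ∀ s', Agree [q] [] s s' → b.eval I s' = p)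
    (hc : ∀ s', Agree [q] [] s s' → c.eval I s' = r) :
    Ens I Z (digitInto q x b c) s fun s' => s'.nat q 0 = X / p % r :=
  (ens_divInto hp hX hx hb).seq' fun _ h hq =>
    (ens_modReg hr ((Nat.div_le_self _ _).trans hX) hq fun s' h' =>
      hc s' ((h.mono (by simp) (by simp)).trans h'))

end

/-! ### The arrays used by the algorithm -/

-- Names that begin with `r` stand for arrays of natural numbers, names that begin with `c` for
-- arrays of complex numbers. The output is expected in cell `0` of `cOut`.

local notation "rM" => (0 : ℕ)
local notation "rW" => (1 : ℕ)
local notation "rCode" => (2 : ℕ)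
local notation "rU" => (3 : ℕ)
local notation "rG" => (4 : ℕ)
local notation "rY" => (5 : ℕ)
local notation "rCandLen" => (6 : ℕ)
local notation "rChosenLen" => (7 : ℕ)
local notation "rCand" => (8 : ℕ)
local notation "rChosen" => (9 : ℕ)
local notation "rSeen" => (10 : ℕ)
local notation "rStamp" => (11 : ℕ)
local notation "rWeight" => (12 : ℕ)
local notation "rSites" => (13 : ℕ)
local notation "rLen" => (14 : ℕ)
local notation "rDim" => (15 : ℕ)
local notation "rI" => (16 : ℕ)
local notation "rJ" => (17 : ℕ)
local notation "rV" => (18 : ℕ)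
local notation "rRow" => (19 : ℕ)
local notation "rCol" => (20 : ℕ)
local notation "rA" => (21 : ℕ)
local notation "rB" => (22 : ℕ)
local notation "rXA" => (23 : ℕ)
local notation "rXB" => (24 : ℕ)
local notation "rP" => (25 : ℕ)
local notation "rDA" => (26 : ℕ)
local notation "rDB" => (27 : ℕ)
local notation "rT" => (28 : ℕ)
local notation "rK" => (29 : ℕ)
local notation "rNum" => (30 : ℕ)
local notation "rSteps" => (31 : ℕ)

local notation "cOut" => (0 : ℕ)
local notation "cTau" => (1 : ℕ)
local notation "cTail" => (2 : ℕ)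
local notation "cSign" => (3 : ℕ)
local notation "cVal" => (4 : ℕ)
local notation "cHam" => (5 : ℕ)
local notation "cComm" => (6 : ℕ)
local notation "cNext" => (7 : ℕ)
local notation "cState" => (8 : ℕ)
local notation "cAcc" => (9 : ℕ)
local notation "cCoeff" => (10 : ℕ)

/-! ### The spins of a list of subsystems -/

/-- The memory holds the list `L` of spins and the place values of its members. -/
structure Layout (I : Input) (L : List ℕ) (s : Memory) : Prop where
  len : s.nat rLen 0 = L.length
  dim : s.nat rDim 0 = I.d ^ L.length
  sites : ∀ i (h : i < L.length), s.nat rSites i = L[i]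
  weight : ∀ v ∈ L, s.nat rWeight v = I.d ^ L.idxOf v

theorem Layout.agree {I : Input} {L : List ℕ} {s s' : Memory} {W V : List ℕ} (h : Layout I L s)
    (ha : Agree W V s s') (h12 : rWeight ∉ W) (h13 : rSites ∉ W) (h14 : rLen ∉ W)
    (h15 : rDim ∉ W) : Layout I L s' := by
  refine ⟨?_, ?_, ?_, ?_⟩
  · rw [ha.nat _ h14, h.len]
  · rw [ha.nat _ h15, h.dim]
  · rw [ha.nat _ h13]; exact h.sites
  · rw [ha.nat _ h12]; exact h.weight

/-- In round `w`, the spins in `L` are the ones that carry the stamp `w + 1`. Stamps from earlier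
rounds are smaller, so that nothing has to be erased between the rounds. -/
structure LayoutInv (I : Input) (w : ℕ) (L : List ℕ) (s : Memory) : Prop where
  layout : Layout I L s
  stamp_le : ∀ v, s.nat rStamp v ≤ w + 1
  stamp : ∀ v, s.nat rStamp v = w + 1 ↔ v ∈ L

theorem LayoutInv.agree {I : Input} {L : List ℕ} {w : ℕ} {s s' : Memory} {W V : List ℕ}
    (h : LayoutInv I w L s) (ha : Agree W V s s') (h11 : rStamp ∉ W) (h12 : rWeight ∉ W)
    (h13 : rSites ∉ W) (h14 : rLen ∉ W) (h15 : rDim ∉ W) : LayoutInv I w L s' := by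
  refine ⟨h.layout.agree ha h12 h13 h14 h15, ?_, ?_⟩
  · rw [ha.nat _ h11]; exact h.stamp_le
  · rw [ha.nat _ h11]; exact h.stamp

/-- The dimension of the state space of one spin, as an expression. -/
abbrev dimE : NatExpr := .input .dim 0 0
/-- The label of the observable, as an expression. -/
abbrev obsE : NatExpr := .input .observable 0 0
/-- The number of spins of a subsystem, as an expression. -/
abbrev numSitesE (x : NatExpr) : NatExpr := .input .numSites x 0
/-- A spin of a subsystem, as an expression. -/
abbrev siteE (x i : NatExpr) : NatExpr := .input .site x i

/-- Append the spin in `rV` to the list of spins unless it carries the stamp of the current round. -/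
def addSiteProg : Prog :=
  .branch (.natEq (.read rStamp (reg rV)) (reg rW + 1)) .skip
    (.setNat rStamp (reg rV) (reg rW + 1) ;;
     .setNat rWeight (reg rV) (reg rDim) ;;
     .setNat rSites (reg rLen) (reg rV) ;;
     setReg rLen (reg rLen + 1) ;;
     setReg rDim (reg rDim * dimE))

/-- List the spins of the chosen subsystems. -/
def layoutProg : Prog :=
  setReg rLen 0 ;; setReg rDim 1 ;;
  forLoop rJ (reg rChosenLen) (forLoop rI (numSitesE (.read rChosen (reg rJ)))
    (setReg rV (siteE (.read rChosen (reg rJ)) (reg rI)) ;; addSiteProg))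

section

variable {I : Input} {Z : ℕ} {s : Memory}

theorem ens_addSite {w v : ℕ} {L : List ℕ} (h : LayoutInv I w L s) (hw : s.nat rW 0 = w)
    (hv : s.nat rV 0 = v) :
    Ens I Z addSiteProg s (LayoutInv I w (Input.addSite L v)) := by
  refine Ens.branch (fun hb => Ens.skip ?_) fun hb => ?_
  · simp [hw, hv, h.stamp] at hb
    simpa [Input.addSite, hb] using h
  · simp [hw, hv, h.stamp] at hb
    refine .setNat_seq hv (show _ = w + 1 by simp [hw]) (.setNat_seq (k := v) (by simp [hv])
      (show _ = I.d ^ L.length by simp [h.layout.dim]) (.setNat_seq (k := L.length)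
      (by simp [h.layout.len]) (show _ = v by simp [hv]) (.setNat_seq rfl
      (show _ = L.length + 1 by simp [h.layout.len]) (.setNat ?_))))
    simp only [Input.addSite, hb, if_false]
    refine ⟨⟨?_, ?_, ?_, ?_⟩, ?_, ?_⟩
    · simp
    · simp [h.layout.dim, pow_succ]
    · intro i hi
      rcases Nat.lt_or_ge i L.length with h' | h'
      · simp [h.layout.sites, h', h'.ne]
      · obtain rfl : i = L.length := by simp at hi; omega
        simp
    · intro v' hv'
      by_cases h1 : v' ∈ L
      · have h2 : v' ≠ v := fun e => hb (e ▸ h1)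
        simp [h2, h.layout.weight _ h1, List.idxOf_append_of_mem h1]
      · obtain rfl : v' = v := by simpa [h1] using hv'
        simp [h.layout.dim, List.idxOf_append_of_notMem h1]
    · intro v'
      by_cases h1 : v' = v
      · simp [h1]
      · simp [h1, h.stamp_le]
    · intro v'
      by_cases h1 : v' = v
      · simp [h1]
      · simp [h1, h.stamp]

theorem ens_layout {w : ℕ} {B : List ℕ} (hw : s.nat rW 0 = w) (hst : ∀ v, s.nat rStamp v ≤ w)
    (hlen : s.nat rChosenLen 0 = B.length)
    (hB : ∀ i (h : i < B.length), s.nat rChosen i = B[i]) (hZ : B.length ≤ Z)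
    (hk : ∀ x ∈ B, I.numSites x ≤ Z) :
    Ens I Z layoutProg s (LayoutInv I w (I.layout B)) := by
  refine .setNat_seq rfl rfl (.setNat_seq rfl rfl ?_)
  set s₀ := (s.writeNat rLen 0 0).writeNat rDim 0 1 with hs₀
  change Ens I Z _ s₀ _
  have h0 : LayoutInv I w [] s₀ := by
    refine ⟨⟨by simp [hs₀], by simp [hs₀], by simp, by simp⟩, fun v => ?_, fun v => ?_⟩
    · simpa [hs₀] using (hst v).trans (Nat.le_succ w)
    · simpa [hs₀] using ((hst v).trans_lt (Nat.lt_succ_self w)).ne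
  have hw₀ : s₀.nat rW 0 = w := by simp [hs₀, hw]
  have hlen₀ : s₀.nat rChosenLen 0 = B.length := by simp [hs₀, hlen]
  have hB₀ : ∀ i (h : i < B.length), s₀.nat rChosen i = B[i] := by simpa [hs₀] using hB
  clear_value s₀
  have := Ens.forLoop (I := I) (s := s₀) (r := rJ) (e := reg rChosenLen)
    (p := (forLoop rI (numSitesE (.read rChosen (reg rJ)))
    (setReg rV (siteE (.read rChosen (reg rJ)) (reg rI)) ;; addSiteProg))) hZ (by decide)
    (fun s' h => by simp [h.nat rChosenLen (by decide), hlen₀])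
    (fun j s' => LayoutInv I w ((B.take j).foldl (fun L x => I.addSites L x (I.numSites x)) []) s')
    (by simpa using h0)
    (fun i s' x h => h.agree (Agree.rfl'.writeNat (W := [rJ]) (V := []) (by simp)) (by decide)
      (by decide) (by decide) (by decide) (by decide)) ?_
  · simpa [Input.layout] using this
  · intro j hj s₁ ha hrj hinv
    have hBj : s₁.nat rChosen j = B[j] := by rw [ha.nat rChosen (by decide), hB₀ j hj]
    have h2 := Ens.forLoop (I := I) (Z := Z) (s := s₁) (r := rI)
      (e := numSitesE (.read rChosen (reg rJ)))
      (p := (setReg rV (siteE (.read rChosen (reg rJ)) (reg rI)) ;; addSiteProg))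
      (hk B[j] (List.getElem_mem hj)) (by decide)
      (fun s' h => by
        simp [h.nat rChosen (by decide), h.nat rJ (by decide), hrj, hBj])
      (fun i s' => LayoutInv I w (I.addSites
        ((B.take j).foldl (fun L x => I.addSites L x (I.numSites x)) []) B[j] i) s')
      (by simpa [Input.addSites] using hinv)
      (fun i s' x h => h.agree (Agree.rfl'.writeNat (W := [rI]) (V := []) (by simp)) (by decide)
        (by decide) (by decide) (by decide) (by decide)) ?_
    · rw [List.take_add_one, List.foldl_append]
      simpa [hj] using h2
    · intro i hi s₂ ha₂ hri hinv₂
      refine (Ens.setNat ?_).seq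
      have h3 : I.addSites ((B.take j).foldl (fun L x => I.addSites L x (I.numSites x)) []) B[j]
          (i + 1) = Input.addSite (I.addSites ((B.take j).foldl
          (fun L x => I.addSites L x (I.numSites x)) []) B[j] i) (I.site B[j] i) := by
        rw [Input.addSites, List.range_succ, List.foldl_append]; rfl
      rw [h3]
      refine ens_addSite (hinv₂.agree (Agree.rfl'.writeNat (W := [rV]) (V := []) (by simp))
        (by decide) (by decide) (by decide) (by decide) (by decide)) ?_ ?_
      · simp [ha₂.nat rW (by decide), ha.nat rW (by decide), hw₀]
      · simp [ha₂.nat rChosen (by decide), ha₂.nat rJ (by decide), hrj, hri, hBj]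

end

/-! ### Matrices on the spins of a list -/

/-- The place value of the spin in `rV`, as an expression. -/
abbrev weightE : NatExpr := .read rWeight (reg rV)

/-- Compute the numbers of the restrictions to `x` of the configurations in `rRow` and `rCol`, and the
two numbers whose equality decides whether these configurations coincide off `x`. -/
def splitConfigs (x : NatExpr) : Prog :=
  setReg rA 0 ;; setReg rB 0 ;; setReg rXA (reg rRow) ;; setReg rXB (reg rCol) ;; setReg rP 1 ;;
  forLoop rI (numSitesE x)
    (setReg rV (siteE x (reg rI)) ;;
     digitInto rDA (reg rRow) weightE dimE ;;
     digitInto rDB (reg rCol) weightE dimE ;;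
     setReg rA (reg rA + reg rDA * reg rP) ;;
     setReg rB (reg rB + reg rDB * reg rP) ;;
     setReg rXA (reg rXA + reg rDB * weightE) ;;
     setReg rXB (reg rXB + reg rDA * weightE) ;;
     setReg rP (reg rP * dimE))

@[simp] theorem natWrites_splitConfigs (x : NatExpr) : (splitConfigs x).natWrites =
    [rA, rB, rXA, rXB, rP, rI, rV, rDA, rDA, rDA, rDB, rDB, rDB, rA, rB, rXA, rXB, rP, rI] := rfl
@[simp] theorem numWrites_splitConfigs (x : NatExpr) : (splitConfigs x).numWrites = [] := rfl

/-- Add to `cAcc` the entry in row `rRow` and column `rCol` of the operator that has the entries `f`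
on the spins of `x`. -/
def addEntry (x : NatExpr) (f : NumExpr) : Prog :=
  splitConfigs x ;;
  .branch (.natEq (reg rXA) (reg rXB)) (setNumReg cAcc (numReg cAcc + f)) .skip

/-- Compute an entry of the matrix of the chosen part of the Hamiltonian. -/
def hamEntry : Prog :=
  setNumReg cAcc 0 ;;
  forLoop rJ (reg rChosenLen)
    (addEntry (.read rChosen (reg rJ))
      (.input .coeff (.read rChosen (reg rJ)) 0 0 *
        .input .term (.read rChosen (reg rJ)) (reg rA) (reg rB)))

/-- Compute an entry of the matrix of the observable. -/
def obsEntry : Prog :=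
  setNumReg cAcc 0 ;; addEntry obsE (.input .observable (reg rA) (reg rB) 0)

/-- Compute an entry of the matrix of the product state. -/
def stateEntry : Prog :=
  setNumReg cAcc 1 ;;
  forLoop rI (reg rLen)
    (setReg rV (.read rSites (reg rI)) ;;
     digitInto rDA (reg rRow) weightE dimE ;;
     digitInto rDB (reg rCol) weightE dimE ;;
     setNumReg cAcc (numReg cAcc * .input .state (reg rV) (reg rDA) (reg rDB)))

/-- The entry in row `i` and column `j` of the matrix stored in the array `a`. -/
abbrev entryE (a : ℕ) (i j : ℕ) : NumExpr := .read a (reg i * reg rDim + reg j)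

/-- Compute an entry of the commutator of the matrices in `cHam` and `cComm`. -/
def commEntry : Prog :=
  setNumReg cAcc 0 ;;
  forLoop rT (reg rDim)
    (setNumReg cAcc (numReg cAcc +
      (entryE cHam rRow rT * entryE cComm rT rCol - entryE cComm rRow rT * entryE cHam rT rCol)))

/-- Store the matrix whose entries are computed by `p` in the array `a`. -/
def fill (a : ℕ) (p : Prog) : Prog :=
  forLoop rRow (reg rDim) (forLoop rCol (reg rDim)
    (p ;; .setNum a (reg rRow * reg rDim + reg rCol) (numReg cAcc)))

/-- Compute the expectation of the operator in `cComm` in the state in `cState`. -/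
def contract : Prog :=
  setNumReg cAcc 0 ;;
  forLoop rRow (reg rDim) (forLoop rCol (reg rDim)
    (setNumReg cAcc (numReg cAcc + entryE cComm rRow rCol * entryE cState rCol rRow)))

/-- Compute the Taylor polynomial of degree `rM` for the chosen labels; in round `m` of the loop, `cComm`
holds the `m`-fold commutator and `cCoeff` the Taylor coefficient. -/
def taylorProg : Prog :=
  layoutProg ;; fill cHam hamEntry ;; fill cState stateEntry ;; fill cComm obsEntry ;;
  setNumReg cVal 0 ;; setNumReg cCoeff 1 ;;
  forLoop rK (reg rM + 1)
    (contract ;; setNumReg cVal (numReg cVal + numReg cCoeff * numReg cAcc) ;;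
     fill cNext commEntry ;; fill cComm (setNumReg cAcc (entryE cNext rRow rCol)) ;;
     setNumReg cCoeff (numReg cCoeff * (.imagUnit * .input .time 0 0 0) / .ofNat (reg rK + 1)))

/-- The array `a` holds the matrix `F` of size `N`. -/
def HoldsMatrix (s : Memory) (a N : ℕ) (F : ℕ → ℕ → ℂ) : Prop :=
  ∀ i < N, ∀ j < N, s.num a (i * N + j) = F i j

theorem HoldsMatrix.agree {s s' : Memory} {a N : ℕ} {F : ℕ → ℕ → ℂ} {W V : List ℕ}
    (h : HoldsMatrix s a N F) (ha : Agree W V s s') (hV : a ∉ V) : HoldsMatrix s' a N F := by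
  unfold HoldsMatrix
  rw [ha.num a hV]
  exact h

section

variable {I : Input} {Z : ℕ} {s : Memory} {L : List ℕ}

theorem ens_digit {q r σ v : ℕ} (h : Layout I L s) (hd : 0 < I.d) (hq : q ∉ [rWeight, rV, r])
    (hσ : s.nat r 0 = σ) (hσZ : σ ≤ Z) (hv : s.nat rV 0 = v) (hvL : v ∈ L) :
    Ens I Z (digitInto q (reg r) weightE dimE) s fun s' => s'.nat q 0 = I.digit L σ v := by
  simp only [List.mem_cons, List.not_mem_nil, or_false, not_or] at hq
  refine ens_digitInto (pow_pos hd _) hd hσZ ?_ ?_ ?_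
  · intro s' ha
    simp [ha.nat r (by simp [Ne.symm hq.2.2]), hσ]
  · intro s' ha
    simp [ha.nat rWeight (by simpa using Ne.symm hq.1), ha.nat rV (by simpa using Ne.symm hq.2.1), hv,
      h.weight v hvL]
  · intro s' _
    simp

theorem ens_splitConfigs {x : NatExpr} {X σ τ : ℕ} (h : Layout I L s) (hd : 0 < I.d)
    (hx : ∀ s', Agree (splitConfigs x).natWrites [] s s' → x.eval I s' = X)
    (hX : ∀ i < I.numSites X, I.site X i ∈ L) (hXZ : I.numSites X ≤ Z)
    (hσ : s.nat rRow 0 = σ) (hτ : s.nat rCol 0 = τ) (hσZ : σ ≤ Z) (hτZ : τ ≤ Z) :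
    Ens I Z (splitConfigs x) s fun s' =>
      s'.nat rA 0 = I.localCode L X (I.numSites X) σ ∧
      s'.nat rB 0 = I.localCode L X (I.numSites X) τ ∧
      s'.nat rXA 0 = σ + I.share L X (I.numSites X) τ ∧
      s'.nat rXB 0 = τ + I.share L X (I.numSites X) σ := by
  have hag : Agree [rA, rB, rXA, rXB, rP] [] s
      (((((s.writeNat rA 0 0).writeNat rB 0 0).writeNat rXA 0 σ).writeNat rXB 0 τ).writeNat rP 0 1) :=
    .writeNat (by simp) (.writeNat (by simp) (.writeNat (by simp) (.writeNat (by simp)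
      (.writeNat (by simp) .rfl'))))
  refine .setNat_seq rfl rfl (.setNat_seq rfl rfl (.setNat_seq rfl (show _ = σ by simp [hσ])
    (.setNat_seq rfl (show _ = τ by simp [hτ]) (.setNat_seq rfl rfl ?_))))
  set s₀ := ((((s.writeNat rA 0 0).writeNat rB 0 0).writeNat rXA 0 σ).writeNat rXB 0 τ).writeNat
    rP 0 1 with hs₀
  change Ens I Z _ s₀ _
  have hi₀ : s₀.nat rA 0 = 0 ∧ s₀.nat rB 0 = 0 ∧ s₀.nat rXA 0 = σ ∧ s₀.nat rXB 0 = τ ∧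
      s₀.nat rP 0 = 1 := by simp [hs₀]
  replace h := h.agree hag (by decide) (by decide) (by decide) (by decide)
  replace hσ : s₀.nat rRow 0 = σ := by simpa [hs₀] using hσ
  replace hτ : s₀.nat rCol 0 = τ := by simpa [hs₀] using hτ
  replace hx : ∀ s', Agree (splitConfigs x).natWrites [] s₀ s' → x.eval I s' = X := fun s' h' =>
    hx s' ((hag.mono (by simp) (by simp)).trans h')
  clear_value s₀
  refine (Ens.forLoop (N := I.numSites X) hXZ (by simp [Prog.natWrites]) ?_ (fun i s' =>
    s'.nat rA 0 = I.localCode L X i σ ∧ s'.nat rB 0 = I.localCode L X i τ ∧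
    s'.nat rXA 0 = σ + I.share L X i τ ∧ s'.nat rXB 0 = τ + I.share L X i σ ∧
    s'.nat rP 0 = I.d ^ i) ?_ ?_ ?_).imp ?_
  · intro s' ha
    have := hx s' (ha.mono (by simp [Prog.natWrites]) (by simp [Prog.numWrites]))
    simp [this]
  · simpa [Input.localCode, Input.share] using hi₀
  · intro i s' y h'
    simpa using h'
  · rintro i hi s₁ ha hri ⟨h1, h2, h3, h4, h5⟩
    have hxs : x.eval I s₁ = X :=
      hx s₁ (ha.mono (by simp [Prog.natWrites]) (by simp [Prog.numWrites]))
    have hL := h.agree ha (by simp [Prog.natWrites]) (by simp [Prog.natWrites])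
      (by simp [Prog.natWrites]) (by simp [Prog.natWrites])
    have hσ₁ : s₁.nat rRow 0 = σ := by rw [ha.nat _ (by simp [Prog.natWrites]), hσ]
    have hτ₁ : s₁.nat rCol 0 = τ := by rw [ha.nat _ (by simp [Prog.natWrites]), hτ]
    have hv := hX i hi
    refine .setNat_seq rfl (show _ = I.site X i by simp [hxs, hri]) ?_
    refine .seq' (ens_digit (v := I.site X i) (σ := σ) (hL.agree (W := [rV]) (V := [])
      (.writeNat (by simp) .rfl') (by decide) (by decide) (by decide) (by decide)) hd (by decide)
      (by simp [hσ₁]) hσZ (by simp) hv) fun s₂ ha₂ hd₂ => ?_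
    refine .seq' (ens_digit (v := I.site X i) (σ := τ) ((hL.agree (W := [rV]) (V := [])
      (.writeNat (by simp) .rfl') (by decide) (by decide) (by decide) (by decide)).agree ha₂
      (by decide) (by decide) (by decide) (by decide)) hd (by decide)
      (by simp [ha₂.nat rCol (by decide), hτ₁]) hτZ (by simp [ha₂.nat rV (by decide)]) hv)
      fun s₃ ha₃ hd₃ => ?_
    have hvs : s₃.nat rV 0 = I.site X i := by
      simp [ha₃.nat rV (by decide), ha₂.nat rV (by decide)]
    have hws : s₃.nat rWeight (I.site X i) = I.d ^ L.idxOf (I.site X i) := by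
      rw [ha₃.nat rWeight (by decide), ha₂.nat rWeight (by decide)]
      simp [hL.weight _ hv]
    have hda : s₃.nat rDA 0 = I.digit L σ (I.site X i) := by rw [ha₃.nat rDA (by decide), hd₂]
    have e : ∀ r, r ∉ [rV, rDA, rDB] → s₃.nat r 0 = s₁.nat r 0 := by
      intro r hr
      simp only [List.mem_cons, List.not_mem_nil, or_false, not_or] at hr
      rw [ha₃.nat r (by simp [hr]), ha₂.nat r (by simp [hr])]
      simp [hr]
    refine .setNat_seq rfl (show _ = I.localCode L X (i + 1) σ by
      simp [Input.localCode, Finset.sum_range_succ, e rA (by decide), e rP (by decide), h1, hda, h5]) ?_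
    refine .setNat_seq rfl (show _ = I.localCode L X (i + 1) τ by
      simp [Input.localCode, Finset.sum_range_succ, e rB (by decide), e rP (by decide), h2, hd₃, h5]) ?_
    refine .setNat_seq rfl (show _ = σ + I.share L X (i + 1) τ by
      simp [Input.share, Finset.sum_range_succ, e rXA (by decide), h3, hd₃, hvs, hws, add_assoc]) ?_
    refine .setNat_seq rfl (show _ = τ + I.share L X (i + 1) σ by
      simp [Input.share, Finset.sum_range_succ, e rXB (by decide), h4, hda, hvs, hws, add_assoc]) ?_
    exact .setNat (by simp [e rP (by decide), h5, pow_succ])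
  · exact fun s' _ h' => ⟨h'.1, h'.2.1, h'.2.2.1, h'.2.2.2.1⟩

theorem ens_addEntry {x : NatExpr} {f : NumExpr} {F : ℕ → ℕ → ℂ} {z : ℂ} {X σ τ : ℕ}
    (h : Layout I L s) (hd : 0 < I.d)
    (hx : ∀ s', Agree (splitConfigs x).natWrites [] s s' → x.eval I s' = X)
    (hf : ∀ s', Agree (splitConfigs x).natWrites [] s s' →
      f.eval I s' = F (s'.nat rA 0) (s'.nat rB 0))
    (hX : ∀ i < I.numSites X, I.site X i ∈ L) (hXZ : I.numSites X ≤ Z)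
    (hσ : s.nat rRow 0 = σ) (hτ : s.nat rCol 0 = τ) (hσZ : σ ≤ Z) (hτZ : τ ≤ Z)
    (hz : s.num cAcc 0 = z) :
    Ens I Z (addEntry x f) s fun s' => s'.num cAcc 0 = z + I.embed L F X σ τ := by
  refine .seq' (ens_splitConfigs h hd hx hX hXZ hσ hτ hσZ hτZ) ?_
  rintro s' ha ⟨h1, h2, h3, h4⟩
  have hz' : s'.num cAcc 0 = z := by
    rw [ha.num cAcc (by simp), hz]
  refine Ens.branch (fun hb => Ens.setNum ?_) fun hb => Ens.skip ?_
  · simp only [Test.holds_natEq, NatExpr.eval_read, NatExpr.eval_ofNat, h3, h4] at hb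
    simp [Input.embed, hb, hz', hf s' (ha.mono (by simp) (by simp)),
      h1, h2]
  · simp only [Test.holds_natEq, NatExpr.eval_read, NatExpr.eval_ofNat, h3, h4] at hb
    simp [Input.embed, hb, hz']

end

/-- The memory holds the list `B` of chosen labels. -/
structure HoldsChosen (B : List ℕ) (s : Memory) : Prop where
  len : s.nat rChosenLen 0 = B.length
  get : ∀ i (h : i < B.length), s.nat rChosen i = B[i]

theorem HoldsChosen.agree {B : List ℕ} {s s' : Memory} {W V : List ℕ} (h : HoldsChosen B s)
    (ha : Agree W V s s') (h7 : rChosenLen ∉ W) (h9 : rChosen ∉ W) : HoldsChosen B s' :=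
  ⟨by rw [ha.nat _ h7, h.len], by rw [ha.nat _ h9]; exact h.get⟩

section

variable {I : Input} {Z : ℕ} {s : Memory} {L : List ℕ} {σ τ : ℕ}

theorem ens_hamEntry {B : List ℕ} (h : Layout I L s) (hB : HoldsChosen B s) (hd : 0 < I.d)
    (hX : ∀ x ∈ B, ∀ i < I.numSites x, I.site x i ∈ L) (hXZ : ∀ x ∈ B, I.numSites x ≤ Z)
    (hBZ : B.length ≤ Z)
    (hσ : s.nat rRow 0 = σ) (hτ : s.nat rCol 0 = τ) (hσZ : σ ≤ Z) (hτZ : τ ≤ Z) :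
    Ens I Z hamEntry s fun s' => s'.num cAcc 0 = I.hamMatrix L B σ τ := by
  refine .setNumReg_seq (show _ = (0 : ℂ) by simp) fun s₀ ha₀ hz₀ => ?_
  replace h := h.agree ha₀ (by decide) (by decide) (by decide) (by decide)
  replace hB := hB.agree ha₀ (by decide) (by decide)
  rw [← ha₀.nat rRow (by decide)] at hσ
  rw [← ha₀.nat rCol (by decide)] at hτ
  refine (Ens.forLoop hBZ (by decide) (fun s' ha => by simp [ha.nat rChosenLen (by decide), hB.len])
    (fun j s' => s'.num cAcc 0 = I.hamMatrix L (B.take j) σ τ) (by simpa [Input.hamMatrix] using hz₀)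
    (fun i s' x h => by simpa using h) ?_).imp fun s' _ h' => by simpa using h'
  intro j hj s₁ ha hrj hinv
  have hx : ∀ s', Agree (splitConfigs (.read rChosen (reg rJ))).natWrites [] s₁ s' →
      s'.nat rChosen (s'.nat rJ 0) = B[j] := by
    intro s' ha'
    rw [ha'.nat rChosen (by decide), ha'.nat rJ (by decide), hrj, ha.nat rChosen (by decide),
      hB.get j hj]
  refine (ens_addEntry (X := B[j]) (σ := σ) (τ := τ)
    (F := fun a b => I.num .coeff B[j] 0 0 * I.num .term B[j] a b)
    (h.agree ha (by decide) (by decide) (by decide) (by decide)) hd (fun s' ha' => hx s' ha')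
    (fun s' ha' => by simp [hx s' ha']) (hX _ (List.getElem_mem hj)) (hXZ _ (List.getElem_mem hj))
    (by rw [ha.nat _ (by decide), hσ]) (by rw [ha.nat _ (by decide), hτ]) hσZ hτZ hinv).imp
    fun s' _ h' => ?_
  rw [h', Input.hamMatrix, Input.hamMatrix, List.take_add_one]
  simp [hj]

theorem ens_obsEntry (h : Layout I L s) (hd : 0 < I.d)
    (hX : ∀ i < I.numSites I.obs, I.site I.obs i ∈ L) (hXZ : I.numSites I.obs ≤ Z)
    (hσ : s.nat rRow 0 = σ) (hτ : s.nat rCol 0 = τ) (hσZ : σ ≤ Z) (hτZ : τ ≤ Z) :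
    Ens I Z obsEntry s fun s' => s'.num cAcc 0 = I.obsMatrix L σ τ := by
  refine .setNumReg_seq (show _ = (0 : ℂ) by simp) fun s₀ ha₀ hz₀ => ?_
  rw [← ha₀.nat _ (by decide)] at hσ hτ
  refine (ens_addEntry (X := I.obs) (σ := σ) (τ := τ) (F := fun a b => I.num .observable a b 0)
    (h.agree ha₀ (by decide) (by decide) (by decide) (by decide)) hd (fun s' ha' => rfl)
    (fun s' ha' => by simp) hX hXZ hσ hτ hσZ hτZ hz₀).imp
    fun s' _ h' => by simpa [Input.obsMatrix] using h'

theorem ens_stateEntry (h : Layout I L s) (hd : 0 < I.d) (hLZ : L.length ≤ Z)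
    (hσ : s.nat rRow 0 = σ) (hτ : s.nat rCol 0 = τ) (hσZ : σ ≤ Z) (hτZ : τ ≤ Z) :
    Ens I Z stateEntry s fun s' => s'.num cAcc 0 = I.stateMatrix L σ τ := by
  refine .setNumReg_seq (show _ = (1 : ℂ) by simp) fun s₀ ha₀ hz₀ => ?_
  replace h := h.agree ha₀ (by decide) (by decide) (by decide) (by decide)
  rw [← ha₀.nat rRow (by decide)] at hσ
  rw [← ha₀.nat rCol (by decide)] at hτ
  refine (Ens.forLoop hLZ (by decide) (fun s' ha => by simp [ha.nat rLen (by decide), h.len])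
    (fun j s' => s'.num cAcc 0 =
      ((L.take j).map fun v => I.num .state v (I.digit L σ v) (I.digit L τ v)).prod)
    (by simpa using hz₀) (fun i s' x h => by simpa using h) ?_).imp
    fun s' _ h' => by simpa [Input.stateMatrix] using h'
  intro j hj s₁ ha hrj hinv
  replace h := h.agree ha (by decide) (by decide) (by decide) (by decide)
  rw [← ha.nat rRow (by decide)] at hσ
  rw [← ha.nat rCol (by decide)] at hτ
  refine .setReg_seq (show _ = L[j] by simp [hrj, h.sites j hj]) fun s₂ ha₂ hv₂ => ?_
  replace h := h.agree ha₂ (by decide) (by decide) (by decide) (by decide)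
  rw [← ha₂.nat rRow (by decide)] at hσ
  rw [← ha₂.nat rCol (by decide)] at hτ
  refine .seq' (ens_digit h hd (by decide) hσ hσZ hv₂ (List.getElem_mem hj)) fun s₃ ha₃ hd₃ => ?_
  refine .seq' (ens_digit (h.agree ha₃ (by decide) (by decide) (by decide) (by decide)) hd
    (by decide) ((ha₃.nat rCol (by decide)).symm ▸ hτ) hτZ ((ha₃.nat rV (by decide)).symm ▸ hv₂)
    (List.getElem_mem hj)) fun s₄ ha₄ hd₄ => Ens.setNum ?_
  have hacc : s₄.num cAcc 0 =
      ((L.take j).map fun v => I.num .state v (I.digit L σ v) (I.digit L τ v)).prod := by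
    rw [ha₄.num cAcc (by decide), ha₃.num cAcc (by decide), ha₂.num cAcc (by decide), hinv]
  have hv₄ : s₄.nat rV 0 = L[j] := by rw [ha₄.nat rV (by decide), ha₃.nat rV (by decide), hv₂]
  have hd₄' : s₄.nat rDA 0 = I.digit L σ L[j] := by rw [ha₄.nat rDA (by decide), hd₃]
  rw [List.take_add_one]
  simp only [NumExpr.eval_mul', NumExpr.eval_read, NumExpr.eval_input, NatExpr.eval_read,
    NatExpr.eval_ofNat, hacc, hv₄, hd₄', hd₄, Memory.writeNum_num]
  simp [hj]

theorem ens_commEntry {N : ℕ} {F G : ℕ → ℕ → ℂ} (hN : N ≤ Z) (hdim : s.nat rDim 0 = N)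
    (hF : HoldsMatrix s cHam N F) (hG : HoldsMatrix s cComm N G)
    (hσ : s.nat rRow 0 = σ) (hτ : s.nat rCol 0 = τ) (hσN : σ < N) (hτN : τ < N) :
    Ens I Z commEntry s fun s' =>
      s'.num cAcc 0 = ∑ υ ∈ Finset.range N, (F σ υ * G υ τ - G σ υ * F υ τ) := by
  refine .setNumReg_seq (show _ = (0 : ℂ) by simp) fun s₀ ha₀ hz₀ => ?_
  replace hF := hF.agree ha₀ (by decide)
  replace hG := hG.agree ha₀ (by decide)
  rw [← ha₀.nat _ (by decide)] at hσ hτ hdim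
  refine (Ens.forLoop hN (by decide) (fun s' ha => by simp [ha.nat rDim (by decide), hdim])
    (fun j s' => s'.num cAcc 0 = ∑ υ ∈ Finset.range j, (F σ υ * G υ τ - G σ υ * F υ τ))
    (by simpa using hz₀) (fun i s' x h => by simpa using h) ?_)
  intro j hj s₁ ha hrj hinv
  replace hF := hF.agree ha (by decide)
  replace hG := hG.agree ha (by decide)
  rw [← ha.nat _ (by decide)] at hσ hτ hdim
  refine Ens.setNum ?_
  simp [Finset.sum_range_succ, hinv, hσ, hτ, hdim, hrj, hF _ hσN _ hj, hF _ hj _ hτN, hG _ hσN _ hj,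
    hG _ hj _ hτN]
  ring

theorem ens_fill {a N : ℕ} {p : Prog} {F : ℕ → ℕ → ℂ} (hN : N ≤ Z) (hdim : s.nat rDim 0 = N)
    (hpd : rDim ∉ p.natWrites) (hpr : rRow ∉ p.natWrites) (hpc : rCol ∉ p.natWrites)
    (hpa : a ∉ p.numWrites)
    (hp : ∀ i < N, ∀ j < N, ∀ s', Agree (rRow :: rCol :: p.natWrites) (a :: p.numWrites) s s' →
      s'.nat rRow 0 = i → s'.nat rCol 0 = j → Ens I Z p s' fun s'' => s''.num cAcc 0 = F i j) :
    Ens I Z (fill a p) s fun s' => HoldsMatrix s' a N F := by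
  have hsub : ∀ {s₁ s' : Memory}, Agree (rCol :: (p ;; Prog.setNum a (reg rRow * reg rDim + reg rCol)
      (numReg cAcc)).natWrites) (p ;; Prog.setNum a (reg rRow * reg rDim + reg rCol)
      (numReg cAcc)).numWrites s₁ s' →
      Agree (rRow :: rCol :: p.natWrites) (a :: p.numWrites) s₁ s' := fun h => by
    refine h.mono ?_ ?_ <;> simp [Prog.natWrites, Prog.numWrites]
  have hsub' : ∀ {s₁ s' : Memory}, Agree (rRow :: (forLoop rCol (reg rDim) (p ;; Prog.setNum a
      (reg rRow * reg rDim + reg rCol) (numReg cAcc))).natWrites) (forLoop rCol (reg rDim)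
      (p ;; Prog.setNum a (reg rRow * reg rDim + reg rCol) (numReg cAcc))).numWrites s₁ s' →
      Agree (rRow :: rCol :: p.natWrites) (a :: p.numWrites) s₁ s' := fun h => by
    refine h.mono ?_ ?_ <;> simp [Prog.natWrites, Prog.numWrites]
  have hdim' : ∀ {s₁}, Agree (rRow :: rCol :: p.natWrites) (a :: p.numWrites) s s₁ →
      s₁.nat rDim 0 = N := fun h => by rw [h.nat rDim (by simp [hpd]), hdim]
  -- Both loops keep the entries before the current position in the row-major order.
  let Inv : ℕ → Memory → Prop := fun l s' => ∀ i < N, ∀ j < N, i * N + j < l →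
    s'.num a (i * N + j) = F i j
  refine (Ens.forLoop hN (by simp [Prog.natWrites, hpr]) (fun s' ha => by simp [hdim' (hsub' ha)])
    (fun i s' => Inv (i * N) s') (by simp [Inv]) (fun i s' x h => h) ?_).imp fun s' _ h i hi j hj => ?_
  · intro i hi s₁ ha hri hinv
    have hs₁ := hsub' ha
    refine (Ens.forLoop hN (by simp [Prog.natWrites, hpc])
      (fun s' ha' => by simp [hdim' (hs₁.trans (hsub ha'))])
      (fun j s' => Inv (i * N + j) s') (by simpa using hinv) (fun i s' x h => h) ?_).imp
      fun s' _ h => by simpa [add_mul] using h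
    intro j hj s₂ ha₂ hrj hinv₂
    have hri₂ : s₂.nat rRow 0 = i := by rw [ha₂.nat rRow (by simp [Prog.natWrites, hpr]), hri]
    refine .seq' (hp i hi j hj s₂ (hs₁.trans (hsub ha₂)) hri₂ hrj) fun s₃ ha₃ hacc =>
      Ens.setNum fun i' hi' j' hj' hlt => ?_
    have e1 : s₃.nat rRow 0 = i := by rw [ha₃.nat rRow hpr, hri₂]
    have e2 : s₃.nat rCol 0 = j := by rw [ha₃.nat rCol hpc, hrj]
    have e3 : s₃.nat rDim 0 = N := by rw [ha₃.nat rDim hpd, hdim' (hs₁.trans (hsub ha₂))]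
    by_cases heq : i' * N + j' = i * N + j
    · have hmod : j' = j := by
        have := congrArg (· % N) heq
        simpa [Nat.mod_eq_of_lt hj', Nat.mod_eq_of_lt hj, Nat.add_mod] using this
      have hi : i' = i := by
        subst hmod
        exact Nat.eq_of_mul_eq_mul_right (by omega) (Nat.add_right_cancel heq)
      simp [e1, e2, e3, hacc, hmod, hi]
    · simp only [NatExpr.eval_add', NatExpr.eval_mul', NatExpr.eval_read, NatExpr.eval_ofNat, e1, e2,
        e3, Memory.writeNum_num, heq, and_false, if_false]
      rw [ha₃.num a hpa]
      exact hinv₂ i' hi' j' hj' (by omega)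
  · refine h i hi j hj ?_
    calc i * N + j < i * N + N := by omega
      _ = (i + 1) * N := by ring
      _ ≤ N * N := Nat.mul_le_mul_right _ hi

theorem ens_contract {N : ℕ} {F G : ℕ → ℕ → ℂ} (hN : N ≤ Z) (hdim : s.nat rDim 0 = N)
    (hF : HoldsMatrix s cComm N F) (hG : HoldsMatrix s cState N G) :
    Ens I Z contract s fun s' =>
      s'.num cAcc 0 = ∑ i ∈ Finset.range N, ∑ j ∈ Finset.range N, F i j * G j i := by
  refine .setNumReg_seq (show _ = (0 : ℂ) by simp) fun s₀ ha₀ hz₀ => ?_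
  replace hF := hF.agree ha₀ (by decide)
  replace hG := hG.agree ha₀ (by decide)
  rw [← ha₀.nat _ (by decide)] at hdim
  refine Ens.forLoop hN (by decide) (fun s' ha => by simp [ha.nat rDim (by decide), hdim])
    (fun i s' => s'.num cAcc 0 = ∑ i ∈ Finset.range i, ∑ j ∈ Finset.range N, F i j * G j i)
    (by simpa using hz₀) (fun i s' x h => by simpa using h) ?_
  intro i hi s₁ ha hri hinv
  replace hF := hF.agree ha (by decide)
  replace hG := hG.agree ha (by decide)
  rw [← ha.nat _ (by decide)] at hdim
  refine (Ens.forLoop hN (by decide) (fun s' ha => by simp [ha.nat rDim (by decide), hdim])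
    (fun j s' => s'.num cAcc 0 = (∑ i ∈ Finset.range i, ∑ j ∈ Finset.range N, F i j * G j i) +
      ∑ j ∈ Finset.range j, F i j * G j i)
    (by simpa using hinv) (fun i s' x h => by simpa using h) ?_).imp
    fun s' _ h => by rw [h, Finset.sum_range_succ]
  intro j hj s₂ ha₂ hrj hinv₂
  refine Ens.setNum ?_
  replace hF := hF.agree ha₂ (by decide)
  replace hG := hG.agree ha₂ (by decide)
  rw [← ha₂.nat _ (by decide)] at hdim hri
  simp [hinv₂, Finset.sum_range_succ _ j, hri, hrj, hdim, hF _ hi _ hj, hG _ hj _ hi, add_assoc]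

end

/-! ### The Taylor polynomial for a list of labels -/

theorem Input.mem_addSite {L : List ℕ} {v v' : ℕ} :
    v' ∈ Input.addSite L v ↔ v' ∈ L ∨ v' = v := by
  unfold Input.addSite
  split_ifs with h
  · exact ⟨.inl, fun h' => h'.elim id fun e => e ▸ h⟩
  · simp

theorem Input.mem_addSites {I : Input} {L : List ℕ} {x k v : ℕ} :
    v ∈ I.addSites L x k ↔ v ∈ L ∨ ∃ i < k, v = I.site x i := by
  induction k with
  | zero => simp [Input.addSites]
  | succ k ih =>
    have : I.addSites L x (k + 1) = Input.addSite (I.addSites L x k) (I.site x k) := by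
      rw [Input.addSites, List.range_succ, List.foldl_append]; rfl
    rw [this, Input.mem_addSite, ih, or_assoc]
    refine or_congr_right ⟨?_, ?_⟩
    · rintro (⟨i, hi, rfl⟩ | rfl)
      exacts [⟨i, by omega, rfl⟩, ⟨k, by omega, rfl⟩]
    · rintro ⟨i, hi, rfl⟩
      rcases Nat.lt_succ_iff_lt_or_eq.1 hi with h | rfl
      exacts [.inl ⟨i, h, rfl⟩, .inr rfl]

theorem Input.mem_layout {I : Input} {B : List ℕ} {v : ℕ} :
    v ∈ I.layout B ↔ ∃ x ∈ B, ∃ i < I.numSites x, v = I.site x i := by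
  have : ∀ L : List ℕ, v ∈ B.foldl (fun L x => I.addSites L x (I.numSites x)) L ↔
      v ∈ L ∨ ∃ x ∈ B, ∃ i < I.numSites x, v = I.site x i := by
    induction B with
    | nil => simp
    | cons x B ih => intro L; rw [List.foldl_cons, ih, Input.mem_addSites, or_assoc]; simp
  simpa [Input.layout] using this []

theorem Input.nodup_addSite {L : List ℕ} {v : ℕ} (h : L.Nodup) : (Input.addSite L v).Nodup := by
  unfold Input.addSite
  split_ifs with h'
  · exact h
  · exact List.Nodup.append h (by simp) (by simpa using h')

theorem Input.nodup_layout (I : Input) (B : List ℕ) : (I.layout B).Nodup := by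
  have : ∀ L : List ℕ, L.Nodup →
      (B.foldl (fun L x => I.addSites L x (I.numSites x)) L).Nodup := by
    induction B with
    | nil => simp
    | cons x B ih =>
      refine fun L hL => ih _ ?_
      beta_reduce
      unfold Input.addSites
      generalize I.numSites x = k
      induction k with
      | zero => simpa using hL
      | succ k ih' =>
        rw [List.range_succ, List.foldl_append]
        exact Input.nodup_addSite ih'
  exact this [] List.nodup_nil

theorem Input.length_layout_le {I : Input} {B : List ℕ} {k : ℕ} (hk : ∀ x, I.numSites x ≤ k) :
    (I.layout B).length ≤ k * B.length := by
  have h1 : ∀ (L : List ℕ) (v : ℕ), (Input.addSite L v).length ≤ L.length + 1 := by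
    intro L v; unfold Input.addSite; split_ifs <;> simp
  have h2 : ∀ (x : ℕ) (L : List ℕ), (I.addSites L x (I.numSites x)).length ≤ L.length + k := by
    intro x L
    refine le_trans ?_ (Nat.add_le_add_left (hk x) _)
    generalize I.numSites x = i
    induction i with
    | zero => simp [Input.addSites]
    | succ i ih =>
      rw [Input.addSites, List.range_succ, List.foldl_append]
      exact (h1 _ _).trans (Nat.succ_le_succ ih)
  have h3 : ∀ L : List ℕ, (B.foldl (fun L x => I.addSites L x (I.numSites x)) L).length ≤
      L.length + k * B.length := by
    induction B with
    | nil => simp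
    | cons x B ih =>
      intro L
      have := ih (I.addSites L x (I.numSites x))
      have := h2 x L
      simp only [List.foldl_cons, List.length_cons, mul_add, mul_one]
      omega
  simpa [Input.layout] using h3 []

theorem ens_taylor {I : Input} {Z w M : ℕ} {s : Memory} {B : List ℕ} (hd : 0 < I.d)
    (hw : s.nat rW 0 = w) (hM : s.nat rM 0 = M) (hst : ∀ v, s.nat rStamp v ≤ w)
    (hB : HoldsChosen B s) (hobs : I.obs ∈ B) (hBZ : B.length ≤ Z) (hk : ∀ x ∈ B, I.numSites x ≤ Z)
    (hMZ : M + 1 ≤ Z) (hLZ : (I.layout B).length ≤ Z) (hdZ : I.d ^ (I.layout B).length ≤ Z) :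
    Ens I Z taylorProg s fun s' =>
      s'.num cVal 0 = I.taylorValue B M ∧ ∀ v, s'.nat rStamp v ≤ w + 1 := by
  have hX : ∀ x ∈ B, ∀ i < I.numSites x, I.site x i ∈ I.layout B := fun x hx i hi =>
    Input.mem_layout.2 ⟨x, hx, i, hi, rfl⟩
  refine .seq' (ens_layout hw hst hB.len hB.get hBZ hk) fun s₁ ha₁ hinv => ?_
  have hl := hinv.layout
  have hst' := hinv.stamp_le
  replace hB := hB.agree ha₁ (by decide) (by decide)
  rw [← ha₁.nat rM (by decide)] at hM
  clear ha₁ hw hst hinv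
  set N := I.d ^ (I.layout B).length
  refine .seq' (ens_fill (F := I.hamMatrix (I.layout B) B) hdZ hl.dim (by decide) (by decide)
    (by decide) (by decide) fun i hi j hj s' ha hr hc => ens_hamEntry
      (hl.agree ha (by decide) (by decide) (by decide) (by decide))
      (hB.agree ha (by decide) (by decide)) hd hX hk hBZ hr hc (hi.le.trans hdZ) (hj.le.trans hdZ))
    fun s₂ ha₂ hham => ?_
  replace hl := hl.agree ha₂ (by decide) (by decide) (by decide) (by decide)
  replace hB := hB.agree ha₂ (by decide) (by decide)
  rw [← ha₂.nat _ (by decide)] at hM hst'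
  refine .seq' (ens_fill (F := I.stateMatrix (I.layout B)) hdZ hl.dim (by decide) (by decide)
    (by decide) (by decide) fun i hi j hj s' ha hr hc => ens_stateEntry
      (hl.agree ha (by decide) (by decide) (by decide) (by decide)) hd hLZ hr hc (hi.le.trans hdZ)
      (hj.le.trans hdZ)) fun s₃ ha₃ hstate => ?_
  replace hl := hl.agree ha₃ (by decide) (by decide) (by decide) (by decide)
  replace hham := hham.agree ha₃ (by decide)
  rw [← ha₃.nat _ (by decide)] at hM hst'
  refine .seq' (ens_fill (F := I.commMatrix (I.layout B) B 0) hdZ hl.dim (by decide) (by decide)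
    (by decide) (by decide) fun i hi j hj s' ha hr hc => ens_obsEntry
      (hl.agree ha (by decide) (by decide) (by decide) (by decide)) hd (hX _ hobs) (hk _ hobs) hr hc
      (hi.le.trans hdZ) (hj.le.trans hdZ)) fun s₄ ha₄ hcomm => ?_
  replace hl := hl.agree ha₄ (by decide) (by decide) (by decide) (by decide)
  replace hham := hham.agree ha₄ (by decide)
  replace hstate := hstate.agree ha₄ (by decide)
  rw [← ha₄.nat _ (by decide)] at hM hst'
  refine .setNumReg_seq (show _ = (0 : ℂ) by simp) fun s₅ ha₅ hval => ?_
  refine .setNumReg_seq (show _ = (1 : ℂ) by simp) fun s₆ ha₆ hcoeff => ?_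
  replace hl := (hl.agree ha₅ (by decide) (by decide) (by decide) (by decide)).agree ha₆
    (by decide) (by decide) (by decide) (by decide)
  replace hham := (hham.agree ha₅ (by decide)).agree ha₆ (by decide)
  replace hstate := (hstate.agree ha₅ (by decide)).agree ha₆ (by decide)
  replace hcomm := (hcomm.agree ha₅ (by decide)).agree ha₆ (by decide)
  rw [← ha₅.nat _ (by decide), ← ha₆.nat _ (by decide)] at hM hst'
  rw [← ha₆.num _ (by decide)] at hval
  clear ha₂ ha₃ ha₄ ha₅ ha₆
  refine (Ens.forLoop hMZ (by decide) (fun s' ha => by simp [ha.nat rM (by decide), hM])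
    (fun m s' => s'.num cVal 0 = (∑ m ∈ Finset.range m, I.taylorCoeff m *
        ∑ σ ∈ Finset.range N, ∑ τ ∈ Finset.range N,
          I.commMatrix (I.layout B) B m σ τ * I.stateMatrix (I.layout B) τ σ) ∧
      s'.num cCoeff 0 = I.taylorCoeff m ∧ HoldsMatrix s' cComm N (I.commMatrix (I.layout B) B m))
    ⟨by simpa using hval, hcoeff, hcomm⟩ (fun _ _ _ h => h) ?_).imp
    fun s' ha h => ⟨h.1, by rw [ha.nat rStamp (by decide)]; exact hst'⟩
  rintro m hm t₁ ha hrm ⟨hval, hcoeff, hcomm⟩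
  replace hham := hham.agree ha (by decide)
  replace hstate := hstate.agree ha (by decide)
  have hdim := hl.dim
  rw [← ha.nat _ (by decide)] at hdim
  refine .seq' (ens_contract hdZ hdim hcomm hstate) fun t₂ ha₂ hacc => ?_
  replace hham := hham.agree ha₂ (by decide)
  replace hcomm := hcomm.agree ha₂ (by decide)
  rw [← ha₂.nat _ (by decide)] at hdim hrm
  rw [← ha₂.num _ (by decide)] at hval hcoeff
  refine .setNumReg_seq (show _ = (∑ m ∈ Finset.range (m + 1), I.taylorCoeff m *
        ∑ σ ∈ Finset.range N, ∑ τ ∈ Finset.range N,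
          I.commMatrix (I.layout B) B m σ τ * I.stateMatrix (I.layout B) τ σ) by
      rw [Finset.sum_range_succ, ← hval, ← hcoeff, ← hacc]; rfl) fun t₃ ha₃ hval₃ => ?_
  replace hham := hham.agree ha₃ (by decide)
  replace hcomm := hcomm.agree ha₃ (by decide)
  rw [← ha₃.nat _ (by decide)] at hdim hrm
  rw [← ha₃.num _ (by decide)] at hcoeff
  refine .seq' (ens_fill (F := I.commMatrix (I.layout B) B (m + 1)) hdZ hdim (by decide) (by decide)
    (by decide) (by decide) fun i hi j hj s' ha hr hc => ens_commEntry hdZ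
      (by rw [ha.nat _ (by decide), hdim]) (hham.agree ha (by decide)) (hcomm.agree ha (by decide))
      hr hc hi hj) fun t₄ ha₄ hnext => ?_
  rw [← ha₄.nat _ (by decide)] at hdim hrm
  rw [← ha₄.num _ (by decide)] at hcoeff hval₃
  refine .seq' (ens_fill (F := I.commMatrix (I.layout B) B (m + 1)) hdZ hdim (by decide) (by decide)
    (by decide) (by decide) fun i hi j hj s' ha hr hc => Ens.setNum ?_) fun t₅ ha₅ hcomm₅ => ?_
  · have h1 := hnext.agree ha (by decide)
    have h2 : s'.nat rDim 0 = N := by rw [ha.nat _ (by decide), hdim]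
    simp [hr, hc, h2, h1 i hi j hj]
  rw [← ha₅.nat _ (by decide)] at hrm
  rw [← ha₅.num _ (by decide)] at hcoeff hval₃
  refine Ens.setNum ⟨by simpa using hval₃, ?_, ?_⟩
  · simp [hcoeff, hrm, Input.taylorCoeff]
  · exact hcomm₅.agree (Agree.writeNum (W := []) (V := [cCoeff]) (by simp) .rfl') (by decide)

/-! ### The exploration of the interaction graph -/

/-- Append the neighbours of the label in `rY` to the candidates. -/
def appendNbrs : Prog :=
  forLoop rI (.input .numNeighbors (reg rY) 0)
    (.setNat rCand (reg rCandLen) (.input .neighbor (reg rY) (reg rI)) ;;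
     setReg rCandLen (reg rCandLen + 1))

/-- Start the exploration number `rW` at the label of the observable. -/
def exploreStart : Prog :=
  setReg rY obsE ;; .setNat rSeen (reg rY) (reg rW + 1) ;; setReg rCandLen 0 ;; appendNbrs ;;
  setReg rChosen obsE ;; setReg rChosenLen 1 ;; setNumReg cSign 1 ;; setReg rCode (reg rW)

/-- Deal with candidate number `rU` as the next base-3 digit of `rCode` demands. -/
def exploreStep : Prog :=
  divInto rT (reg rCode) 3 ;; setReg rG (reg rCode - reg rT * 3) ;; setReg rCode (reg rT) ;;
  .branch (.natLt (reg rU) (reg rCandLen)) (setReg rY (.read rCand (reg rU))) (setReg rY obsE) ;;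
  .branch (.natEq (.read rSeen (reg rY)) (reg rW + 1))
    (.branch (.natEq (reg rG) 0) .skip (setNumReg cSign 0))
    (.setNat rSeen (reg rY) (reg rW + 1) ;;
     .branch (.natEq (reg rG) 0) .skip
       (appendNbrs ;;
        .branch (.natEq (reg rG) 1) (setNumReg cSign (0 - numReg cSign))
          (.setNat rChosen (reg rChosenLen) (reg rY) ;; setReg rChosenLen (reg rChosenLen + 1))))

/-- The memory holds the list `C` of candidates. -/
structure HoldsCand (C : List ℕ) (s : Memory) : Prop where
  len : s.nat rCandLen 0 = C.length
  get : ∀ i (h : i < C.length), s.nat rCand i = C[i]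

theorem HoldsCand.agree {C : List ℕ} {s s' : Memory} {W V : List ℕ} (h : HoldsCand C s)
    (ha : Agree W V s s') (h6 : rCandLen ∉ W) (h8 : rCand ∉ W) : HoldsCand C s' :=
  ⟨by rw [ha.nat _ h6, h.len], by rw [ha.nat _ h8]; exact h.get⟩

/-- In round `w`, the labels in `S` are the ones that carry the stamp `w + 1`. -/
structure HoldsSeen (w : ℕ) (S : Finset ℕ) (s : Memory) : Prop where
  le : ∀ y, s.nat rSeen y ≤ w + 1
  iff : ∀ y, s.nat rSeen y = w + 1 ↔ y ∈ S

theorem HoldsSeen.agree {w : ℕ} {S : Finset ℕ} {s s' : Memory} {W V : List ℕ} (h : HoldsSeen w S s)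
    (ha : Agree W V s s') (h10 : rSeen ∉ W) : HoldsSeen w S s' :=
  ⟨by rw [ha.nat _ h10]; exact h.le, by rw [ha.nat _ h10]; exact h.iff⟩

/-- In round `w`, the memory holds the stage `e` of an exploration. -/
structure HoldsExploration (w : ℕ) (e : Exploration) (s : Memory) : Prop where
  cand : HoldsCand e.cand s
  seen : HoldsSeen w e.seen s
  chosen : HoldsChosen e.chosen s
  sign : s.num cSign 0 = e.sign

section

variable {I : Input} {Z w : ℕ} {s : Memory}

theorem ens_appendNbrs {C : List ℕ} {y : ℕ} (h : HoldsCand C s) (hy : s.nat rY 0 = y)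
    (hZ : I.numNbrs y ≤ Z) : Ens I Z appendNbrs s (HoldsCand (C ++ I.nbrs y)) := by
  refine Ens.forLoop hZ (by decide) (fun s' ha => by simp [ha.nat rY (by decide), hy])
    (fun i => HoldsCand (C ++ (List.range i).map (I.nat .neighbor y))) (by simpa using h)
    (fun i s' x h => h.agree (Agree.writeNat (W := [rI]) (V := []) (by simp) .rfl') (by decide)
      (by decide)) ?_
  intro i hi s₁ ha hri hinv
  have hy₁ : s₁.nat rY 0 = y := by rw [ha.nat rY (by decide), hy]
  refine .setNat_seq (show _ = C.length + i by simp [hinv.len])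
    (show _ = I.nat .neighbor y i by simp [hy₁, hri]) (.setNat ⟨?_, ?_⟩)
  · simp [hinv.len, add_assoc]
  · intro l hl
    have hl' : l < C.length + i + 1 := by simpa [add_assoc] using hl
    rcases Nat.lt_succ_iff_lt_or_eq.1 hl' with h1 | rfl
    · have h2 := hinv.get l (by simpa using h1)
      simp only [List.range_succ, List.map_append, ← List.append_assoc]
      rw [List.getElem_append_left (by simpa using h1)]
      simpa [h1.ne] using h2
    · simp [List.range_succ, ← List.append_assoc]

theorem HoldsSeen.insert {S : Finset ℕ} (h : HoldsSeen w S s) (y : ℕ) :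
    HoldsSeen w (insert y S) (s.writeNat rSeen y (w + 1)) := by
  refine ⟨fun z => ?_, fun z => ?_⟩
  · by_cases hz : z = y <;> simp [hz, h.le]
  · by_cases hz : z = y <;> simp [hz, h.iff]

theorem ens_exploreStart (hw : s.nat rW 0 = w) (hs : ∀ y, s.nat rSeen y ≤ w)
    (hZ : I.numNbrs I.obs ≤ Z) :
    Ens I Z exploreStart s fun s' => HoldsExploration w I.start s' ∧ s'.nat rCode 0 = w := by
  refine .setReg_seq (show _ = I.obs by simp) fun s₁ ha₁ hy => ?_
  have hs₁ : HoldsSeen w ∅ s₁ := by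
    refine ⟨fun y => ?_, fun y => ?_⟩ <;> rw [ha₁.nat _ (by decide)]
    · exact (hs y).trans (Nat.le_succ w)
    · simpa using ((hs y).trans_lt (Nat.lt_succ_self w)).ne
  rw [← ha₁.nat _ (by decide)] at hw
  have ha₂ : Agree [rSeen] [] s₁ (s₁.writeNat rSeen I.obs (w + 1)) := .writeNat (by simp) .rfl'
  refine .setNat_seq (show _ = I.obs by simp [hy]) (show _ = w + 1 by simp [hw]) ?_
  have hs₂ := hs₁.insert I.obs
  set s₂ := s₁.writeNat rSeen I.obs (w + 1)
  clear_value s₂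
  rw [← ha₂.nat _ (by decide)] at hw hy
  refine .setReg_seq (show _ = 0 by simp) fun s₃ ha₃ hc₃ => ?_
  rw [← ha₃.nat _ (by decide)] at hw hy
  refine .seq' (ens_appendNbrs (C := []) ⟨by simpa using hc₃, by simp⟩ hy hZ) fun s₄ ha₄ hc => ?_
  rw [← ha₄.nat _ (by decide)] at hw
  refine .setReg_seq (show _ = I.obs by simp) fun s₅ ha₅ hB => ?_
  rw [← ha₅.nat _ (by decide)] at hw
  refine .setReg_seq (show _ = 1 by simp) fun s₆ ha₆ hl => ?_
  rw [← ha₆.nat _ (by decide)] at hw hB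
  refine .setNumReg_seq (show _ = (1 : ℂ) by simp) fun s₇ ha₇ hsign => ?_
  rw [← ha₇.nat _ (by decide)] at hw hB hl
  refine Ens.setNat ⟨⟨?_, ?_, ?_, ?_⟩, by simp [hw]⟩
  · exact (((hc.agree ha₅ (by decide) (by decide)).agree ha₆ (by decide) (by decide)).agree ha₇
      (by decide) (by decide)).agree (.writeNat (W := [rCode]) (V := []) (by simp) .rfl') (by decide)
      (by decide)
  · exact (((((hs₂.agree ha₃ (by decide)).agree ha₄ (by decide)).agree ha₅ (by decide)).agree ha₆
      (by decide)).agree ha₇ (by decide)).agree (.writeNat (W := [rCode]) (V := []) (by simp) .rfl')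
      (by decide)
  · exact ⟨by simpa [Input.start] using hl, by simpa [Input.start] using hB⟩
  · simpa [Input.start] using hsign

theorem ens_exploreStep {u c : ℕ} {e : Exploration} (h : HoldsExploration w e s)
    (hw : s.nat rW 0 = w) (hu : s.nat rU 0 = u) (hc : s.nat rCode 0 = c) (hcZ : c ≤ Z)
    (hZ : ∀ y, I.numNbrs y ≤ Z) :
    Ens I Z exploreStep s fun s' =>
      HoldsExploration w (I.step u (c % 3) e) s' ∧ s'.nat rCode 0 = c / 3 := by
  obtain ⟨hcand, hseen, hchosen, hsign⟩ := h
  refine .seq' (ens_divInto (X := c) (p := 3) (by decide) hcZ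
    (fun s' ha => by simp [ha.nat rCode (by decide), hc]) (fun s' _ => by simp)) fun s₁ ha₁ hq => ?_
  rw [← ha₁.nat _ (by decide)] at hw hu hc
  rw [← ha₁.num _ (by decide)] at hsign
  replace hcand := hcand.agree ha₁ (by decide) (by decide)
  replace hseen := hseen.agree ha₁ (by decide)
  replace hchosen := hchosen.agree ha₁ (by decide) (by decide)
  refine .setReg_seq (show _ = c % 3 by simp [hc, hq]; omega) fun s₂ ha₂ hg => ?_
  rw [← ha₂.nat _ (by decide)] at hw hu hq
  rw [← ha₂.num _ (by decide)] at hsign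
  replace hcand := hcand.agree ha₂ (by decide) (by decide)
  replace hseen := hseen.agree ha₂ (by decide)
  replace hchosen := hchosen.agree ha₂ (by decide) (by decide)
  refine .setReg_seq (show _ = c / 3 by simp [hq]) fun s₃ ha₃ hcode => ?_
  rw [← ha₃.nat _ (by decide)] at hw hu hg
  rw [← ha₃.num _ (by decide)] at hsign
  replace hcand := hcand.agree ha₃ (by decide) (by decide)
  replace hseen := hseen.agree ha₃ (by decide)
  replace hchosen := hchosen.agree ha₃ (by decide) (by decide)
  clear ha₁ ha₂ ha₃ hq hc
  refine .seq' (Q' := fun s' => s'.nat rY 0 = e.cand.getD u I.obs)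
    (.branch (fun hb => .setNat ?_) fun hb => .setNat ?_) fun s₄ ha₄ hy => ?_
  · have hlt : u < e.cand.length := by simpa [hu, hcand.len] using hb
    simp [hu, hcand.get u hlt, hlt]
  · have hlt : ¬ u < e.cand.length := by simpa [hu, hcand.len] using hb
    simp [List.getElem?_eq_none (not_lt.1 hlt)]
  rw [← ha₄.nat _ (by decide)] at hw hu hg hcode
  rw [← ha₄.num _ (by decide)] at hsign
  replace hcand := hcand.agree ha₄ (by decide) (by decide)
  replace hseen := hseen.agree ha₄ (by decide)
  replace hchosen := hchosen.agree ha₄ (by decide) (by decide)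
  clear ha₄
  set y := e.cand.getD u I.obs with hydef
  refine .branch (fun hb => ?_) fun hb => ?_
  · have hmem : y ∈ e.seen := by simpa [hy, hw, hseen.iff] using hb
    refine .branch (fun hb' => .skip ?_) fun hb' => .setNum ?_
    · have h0 : c % 3 = 0 := by simpa [hg] using hb'
      simp only [Input.step, ← hydef, hmem, h0, if_true]
      exact ⟨⟨hcand, hseen, hchosen, hsign⟩, hcode⟩
    · have h0 : c % 3 ≠ 0 := by simpa [hg] using hb'
      simp only [Input.step, ← hydef, hmem, h0, if_true, if_false]
      have ha : Agree [] [cSign] s₄ (s₄.writeNum cSign (NatExpr.eval I s₄ 0) (NumExpr.eval I s₄ 0)) :=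
        .writeNum (by simp) .rfl'
      exact ⟨⟨hcand.agree ha (by decide) (by decide), hseen.agree ha (by decide),
        hchosen.agree ha (by decide) (by decide), by simp⟩, hcode⟩
  · have hmem : y ∉ e.seen := by simpa [hy, hw, hseen.iff] using hb
    refine .setNat_seq (show _ = y by simp [hy]) (show _ = w + 1 by simp [hw]) ?_
    have ha₅ : Agree [rSeen] [] s₄ (s₄.writeNat rSeen y (w + 1)) := .writeNat (by simp) .rfl'
    replace hseen := hseen.insert y
    set s₅ := s₄.writeNat rSeen y (w + 1)
    clear_value s₅
    rw [← ha₅.nat _ (by decide)] at hw hu hg hcode hy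
    rw [← ha₅.num _ (by decide)] at hsign
    replace hcand := hcand.agree ha₅ (by decide) (by decide)
    replace hchosen := hchosen.agree ha₅ (by decide) (by decide)
    refine .branch (fun hb' => .skip ?_) fun hb' => ?_
    · have h0 : c % 3 = 0 := by simpa [hg] using hb'
      simp only [Input.step, ← hydef, hmem, h0, if_true, if_false]
      exact ⟨⟨hcand, hseen, hchosen, hsign⟩, hcode⟩
    have h0 : c % 3 ≠ 0 := by simpa [hg] using hb'
    refine .seq' (ens_appendNbrs hcand hy (hZ _)) fun s₆ ha₆ hcand => ?_
    rw [← ha₆.nat _ (by decide)] at hg hcode hy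
    rw [← ha₆.num _ (by decide)] at hsign
    replace hseen := hseen.agree ha₆ (by decide)
    replace hchosen := hchosen.agree ha₆ (by decide) (by decide)
    refine .branch (fun hb'' => .setNum ?_) fun hb'' => ?_
    · have h1 : c % 3 = 1 := by simpa [hg] using hb''
      simp only [Input.step, ← hydef, hmem, h1, if_true, if_false, one_ne_zero]
      have ha : Agree [] [cSign] s₆ (s₆.writeNum cSign (NatExpr.eval I s₆ 0)
        (NumExpr.eval I s₆ (0 - numReg cSign))) := .writeNum (by simp) .rfl'
      exact ⟨⟨hcand.agree ha (by decide) (by decide), hseen.agree ha (by decide),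
        hchosen.agree ha (by decide) (by decide), by simp [hsign]⟩, hcode⟩
    · have h1 : c % 3 ≠ 1 := by simpa [hg] using hb''
      simp only [Input.step, ← hydef, hmem, h0, h1, if_false]
      refine .setNat_seq (show _ = e.chosen.length by simp [hchosen.len])
        (show _ = y by simp [hy]) (.setNat ?_)
      have ha : Agree [rChosen, rChosenLen] [] s₆ ((s₆.writeNat rChosen e.chosen.length y).writeNat
          rChosenLen (NatExpr.eval I (s₆.writeNat rChosen e.chosen.length y) 0)
          (NatExpr.eval I (s₆.writeNat rChosen e.chosen.length y) (reg rChosenLen + 1))) :=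
        .writeNat (by simp) (.writeNat (by simp) .rfl')
      refine ⟨⟨hcand.agree ha (by decide) (by decide), hseen.agree ha (by decide), ⟨?_, ?_⟩, ?_⟩, ?_⟩
      · simp [hchosen.len]
      · intro i hi
        rcases Nat.lt_or_ge i e.chosen.length with h' | h'
        · simp [hchosen.get, h', h'.ne]
        · obtain rfl : i = e.chosen.length := by simp at hi; omega
          simp
      · simpa using hsign
      · simpa using hcode

theorem Input.length_chosen_explore_le (I : Input) (w u : ℕ) :
    (I.explore w u).chosen.length ≤ u + 1 := by
  induction u with
  | zero => simp [Input.explore, Input.start]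
  | succ u ih =>
    simp only [Input.explore, Input.step]
    split_ifs <;> (try simp only [List.length_append, List.length_singleton]) <;> omega

theorem Input.obs_mem_chosen_explore (I : Input) (w u : ℕ) :
    I.obs ∈ (I.explore w u).chosen := by
  induction u with
  | zero => simp [Input.explore, Input.start]
  | succ u ih =>
    simp only [Input.explore, Input.step]
    split_ifs <;> simp [ih]

end

/-! ### The whole program -/

/-- Put into `rM` the least degree for which the tail of the geometric series is at most the
precision. -/
def chooseDegree : Prog :=
  setNumReg cTau (.input .time 0 0 0 / .input .threshold 0 0 0) ;;
  .branch (.numLt (numReg cTau) 0) (setNumReg cTau (0 - numReg cTau)) .skip ;;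
  setNumReg cTail (numReg cTau / (1 - numReg cTau)) ;;
  setReg rM 0 ;;
  .loop (.numLt (.input .precision 0 0 0) (numReg cTail))
    (setNumReg cTail (numReg cTail * numReg cTau) ;; setReg rM (reg rM + 1))

/-- Sum the signed Taylor polynomials over all explorations. -/
def sumExplorations : Prog :=
  setReg rSteps (.input .degreeBound 0 0 * (reg rM + 1)) ;;
  setReg rNum 1 ;; forLoop rU (reg rSteps) (setReg rNum (reg rNum * 3)) ;;
  setNumReg cOut 0 ;;
  forLoop rW (reg rNum)
    (exploreStart ;; forLoop rU (reg rSteps) exploreStep ;; taylorProg ;;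
     setNumReg cOut (numReg cOut + numReg cSign * numReg cVal))

/-- The algorithm: fix the degree of the Taylor polynomial, then compute the polynomial for the
whole Hamiltonian as a signed sum over explorations. -/
def algorithm : Prog := chooseDegree ;; sumExplorations

theorem ens_chooseDegree {I : Input} {Z M : ℕ} {s : Memory} {t t₀ ε : ℝ}
    (ht : I.num .time 0 0 0 = t) (ht₀ : I.num .threshold 0 0 0 = t₀)
    (hε : I.num .precision 0 0 0 = ε) (hpos : 0 < t₀) (hMZ : M ≤ Z)
    (hlt : ∀ m < M, ε < (|t| / t₀) ^ (m + 1) / (1 - |t| / t₀))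
    (hle : (|t| / t₀) ^ (M + 1) / (1 - |t| / t₀) ≤ ε) :
    Ens I Z chooseDegree s fun s' => s'.nat rM 0 = M := by
  refine .setNumReg_seq (show _ = ((t / t₀ : ℝ) : ℂ) by simp [ht, ht₀]) fun s₁ _ h₁ => ?_
  refine .seq' (Q' := fun s' => s'.num cTau 0 = ((|t| / t₀ : ℝ) : ℂ))
    (.branch (fun hb => .setNum ?_) fun hb => .skip ?_) fun s₂ _ h₂ => ?_
  · have : t / t₀ < 0 := by
      simp only [Test.holds_numLt, NumExpr.eval_read, NatExpr.eval_ofNat, h₁, Complex.ofReal_re] at hb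
      simpa using hb
    have ht : t < 0 := by
      by_contra h'
      exact absurd this (not_lt.2 (div_nonneg (not_lt.1 h') hpos.le))
    simp only [NumExpr.eval_sub', NumExpr.eval_read, NatExpr.eval_ofNat, h₁, abs_of_neg ht]
    simp [neg_div]
  · have : ¬ t / t₀ < 0 := by
      simp only [Test.holds_numLt, NumExpr.eval_read, NatExpr.eval_ofNat, h₁, Complex.ofReal_re] at hb
      simpa using hb
    have ht : 0 ≤ t := by
      by_contra h'
      exact this (div_neg_of_neg_of_pos (not_le.1 h') hpos)
    rw [h₁, abs_of_nonneg ht]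
  set τ := |t| / t₀
  refine .setNumReg_seq (show _ = ((τ ^ 1 / (1 - τ) : ℝ) : ℂ) by
    simp only [NumExpr.eval_sub', NumExpr.eval_div', NumExpr.eval_read, NatExpr.eval_ofNat, h₂]
    simp) fun s₃ ha₃ h₃ => ?_
  rw [← ha₃.num _ (by decide)] at h₂
  refine .setReg_seq (show _ = 0 by simp) fun s₄ ha₄ h₄ => ?_
  rw [← ha₄.num _ (by decide)] at h₂ h₃
  refine (Ens.loop hMZ (fun m s' => s'.nat rM 0 = m ∧ s'.num cTail 0 =
    ((τ ^ (m + 1) / (1 - τ) : ℝ) : ℂ)) ⟨h₄, h₃⟩ ?_ ?_).imp fun _ _ h => h.1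
  · rintro m hm s' ha ⟨hm', hq⟩
    rw [← ha.num _ (by decide)] at h₂
    refine ⟨?_, .setNumReg_seq (show _ = ((τ ^ (m + 1 + 1) / (1 - τ) : ℝ) : ℂ) by
      simp only [NumExpr.eval_mul', NumExpr.eval_read, NatExpr.eval_ofNat, h₂, hq,
        ← Complex.ofReal_mul]
      congr 1; ring) fun s'' ha'' h'' => .setNat ⟨?_, h''⟩⟩
    · simp only [Test.holds_numLt, NumExpr.eval_read, NumExpr.eval_input, NatExpr.eval_ofNat, hq, hε,
        Complex.ofReal_re]
      exact hlt m hm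
    · rw [← ha''.nat _ (by decide)] at hm'
      simp [hm']
  · rintro s' ha ⟨-, hq⟩
    simp only [Test.holds_numLt, NumExpr.eval_read, NumExpr.eval_input, NatExpr.eval_ofNat, hq, hε,
      Complex.ofReal_re, not_lt]
    exact hle

theorem ens_sumExplorations {I : Input} {Z M k : ℕ} {s : Memory} (hd : 0 < I.d)
    (hM : s.nat rM 0 = M) (hseen : ∀ y, s.nat rSeen y = 0) (hstamp : ∀ v, s.nat rStamp v = 0)
    (hk : ∀ x, I.numSites x ≤ k) (hD : ∀ x, I.numNbrs x ≤ I.degreeBound)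
    (hDZ : I.degreeBound ≤ Z) (hMZ : M + 1 ≤ Z) (hkZ : k ≤ Z) (hsZ : I.steps M + 1 ≤ Z)
    (h3Z : 3 ^ I.steps M ≤ Z) (hlZ : k * (I.steps M + 1) ≤ Z)
    (hdZ : I.d ^ (k * (I.steps M + 1)) ≤ Z) :
    Ens I Z sumExplorations s fun s' => s'.num cOut 0 = I.output M := by
  refine .setReg_seq (show _ = I.steps M by simp [hM]) fun s₁ ha₁ hsteps => ?_
  refine .setReg_seq (show _ = 1 by simp) fun s₂ ha₂ hnum => ?_
  rw [← ha₁.nat _ (by decide), ← ha₂.nat _ (by decide)] at hM hseen hstamp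
  rw [← ha₂.nat _ (by decide)] at hsteps
  refine .seq' (Ens.forLoop (Nat.le_of_succ_le hsZ) (by decide)
    (fun s' ha => by simp [ha.nat rSteps (by decide), hsteps]) (fun i s' => s'.nat rNum 0 = 3 ^ i)
    (by simpa using hnum) (fun i s' x h => by simpa using h)
    fun i hi s' ha hri h => .setNat (by simp [h, pow_succ])) fun s₃ ha₃ hnum₃ => ?_
  rw [← ha₃.nat _ (by decide)] at hM hseen hstamp hsteps
  refine .setNumReg_seq (show _ = (0 : ℂ) by simp) fun s₄ ha₄ hout => ?_
  rw [← ha₄.nat _ (by decide)] at hM hseen hstamp hsteps hnum₃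
  clear ha₁ ha₂ ha₃ ha₄
  set N := I.steps M
  refine (Ens.forLoop h3Z (by decide) (fun s' ha => by simp [ha.nat rNum (by decide), hnum₃])
    (fun w s' => s'.num cOut 0 = (∑ w ∈ Finset.range w, (I.explore w N).sign *
      I.taylorValue (I.explore w N).chosen M) ∧ (∀ y, s'.nat rSeen y ≤ w) ∧
      ∀ v, s'.nat rStamp v ≤ w) ⟨by simpa using hout, by simp [hseen], by simp [hstamp]⟩
    (fun _ _ _ h => by simpa using h) ?_).imp fun _ _ h => h.1
  rintro w hw t₁ ha hrw ⟨hout, hseen, hstamp⟩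
  rw [← ha.nat _ (by decide)] at hM hsteps
  clear hnum₃ ha
  refine .seq' (ens_exploreStart hrw hseen ((hD _).trans hDZ)) fun t₂ ha₂ ⟨he, hcode⟩ => ?_
  rw [← ha₂.nat _ (by decide)] at hM hsteps hrw hstamp
  rw [← ha₂.num _ (by decide)] at hout
  refine .seq' (Ens.forLoop (N := N) (Nat.le_of_succ_le hsZ) (by decide)
    (fun s' ha => by simp [ha.nat rSteps (by decide), hsteps])
    (fun u s' => HoldsExploration w (I.explore w u) s' ∧ s'.nat rCode 0 = w / 3 ^ u)
    ⟨he, by simpa using hcode⟩ (fun u s' x h => ?_) fun u hu t₃ ha₃ hru ⟨he, hc⟩ => ?_)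
    fun t₃ ha₃ ⟨he, _⟩ => ?_
  · have ha : Agree [rU] [] s' (s'.writeNat rU 0 x) := .writeNat (by simp) .rfl'
    exact ⟨⟨h.1.cand.agree ha (by decide) (by decide), h.1.seen.agree ha (by decide),
      h.1.chosen.agree ha (by decide) (by decide), h.1.sign⟩, by simpa using h.2⟩
  · rw [← ha₃.nat _ (by decide)] at hrw
    refine (ens_exploreStep he hrw hru hc ((Nat.div_le_self _ _).trans (hw.le.trans h3Z))
      fun y => (hD y).trans hDZ).imp fun _ _ h => ⟨h.1, ?_⟩
    rw [h.2, Nat.div_div_eq_div_mul, pow_succ]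
  rw [← ha₃.nat _ (by decide)] at hM hrw hstamp
  rw [← ha₃.num _ (by decide)] at hout
  have hlen := I.length_chosen_explore_le w N
  have hlay : (I.layout (I.explore w N).chosen).length ≤ k * (N + 1) :=
    (Input.length_layout_le hk).trans (Nat.mul_le_mul_left _ hlen)
  refine .seq' (ens_taylor hd hrw hM hstamp he.chosen (I.obs_mem_chosen_explore w N)
    (hlen.trans hsZ) (fun x _ => (hk x).trans hkZ) hMZ (hlay.trans hlZ)
    ((Nat.pow_le_pow_right hd hlay).trans hdZ)) fun t₄ ha₄ ⟨hval, hst⟩ => .setNum ⟨?_, ?_, ?_⟩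
  · have hsign := he.sign
    rw [← ha₄.num _ (by decide)] at hsign hout
    simp [hsign, hout, hval, Finset.sum_range_succ]
  · have := he.seen.le
    rw [← ha₄.nat _ (by decide)] at this
    exact this
  · exact hst

/-! ### Signed sums over explorations -/

namespace Input

variable (I : Input)

/-- The sum of `φ` over all ways to continue an exploration for `r` steps. -/
noncomputable def sumRuns (φ : Exploration → ℂ) : ℕ → ℕ → Exploration → ℂ
  | 0, _, e => φ e
  | r + 1, u, e => ∑ g ∈ Finset.range 3, sumRuns φ r (u + 1) (I.step u g e)

theorem explore_add_mul (w g a u : ℕ) (h : u ≤ a) :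
    I.explore (w + 3 ^ a * g) u = I.explore w u := by
  induction u with
  | zero => rfl
  | succ u ih =>
    have h1 : 3 ^ a * g = 3 ^ u * (3 * (3 ^ (a - u - 1) * g)) := by
      obtain ⟨c, rfl⟩ := Nat.exists_eq_add_of_lt h
      rw [show u + c + 1 - u - 1 = c by omega]; ring
    have h2 : (w + 3 ^ a * g) / 3 ^ u % 3 = w / 3 ^ u % 3 := by
      rw [h1, Nat.add_mul_div_left _ _ (by positivity), Nat.add_mul_mod_self_left]
    rw [explore, explore, ih (by omega), h2]

/-- A sum over all codes is a sum over the first `a` digits and over all ways to continue. -/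
theorem sum_explore (φ : Exploration → ℂ) (r a : ℕ) :
    ∑ w ∈ Finset.range (3 ^ (a + r)), φ (I.explore w (a + r)) =
      ∑ w ∈ Finset.range (3 ^ a), I.sumRuns φ r a (I.explore w a) := by
  induction r generalizing a with
  | zero => rfl
  | succ r ih =>
    have hrange : ∀ (f : ℕ → ℂ) (n : ℕ), ∑ w ∈ Finset.range (n * 3), f w =
        ∑ w ∈ Finset.range n, ∑ g ∈ Finset.range 3, f (w + n * g) := by
      intro f n
      rw [Finset.sum_comm, mul_comm, show 3 * n = n + n + n by ring, Finset.sum_range_add,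
        Finset.sum_range_add]
      simp [Finset.sum_range_succ, add_comm, mul_two]
    rw [show a + (r + 1) = a + 1 + r by ring, ih, pow_succ, hrange]
    refine Finset.sum_congr rfl fun w hw => ?_
    rw [sumRuns]
    refine Finset.sum_congr rfl fun g hg => ?_
    have hw := Finset.mem_range.1 hw
    have hg := Finset.mem_range.1 hg
    have h3 : (w + 3 ^ a * g) / 3 ^ a % 3 = g := by
      rw [Nat.add_mul_div_left _ _ (by positivity), Nat.div_eq_of_lt hw, zero_add,
        Nat.mod_eq_of_lt hg]
    rw [explore, explore_add_mul _ _ _ _ _ le_rfl, h3]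

open Classical in
/-- The indicator of the event that the exploration which accepts precisely the labels in `rest`
finds all of them within `r` more steps. -/
noncomputable def greedy : ℕ → ℕ → List ℕ → Finset ℕ → Finset ℕ → ℂ
  | 0, _, _, _, rest => if rest = ∅ then 1 else 0
  | r + 1, u, cand, seen, rest =>
    let y := cand.getD u I.obs
    if y ∈ seen then greedy r (u + 1) cand seen rest
    else if y ∈ rest then greedy r (u + 1) (cand ++ I.nbrs y) (insert y seen) (rest.erase y)
    else greedy r (u + 1) cand (insert y seen) rest

/-- A label that has been seen without being accepted is never found. -/
theorem greedy_eq_zero {r u : ℕ} {cand : List ℕ} {seen rest : Finset ℕ} {y : ℕ} (h : y ∈ seen)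
    (h' : y ∈ rest) : I.greedy r u cand seen rest = 0 := by
  induction r generalizing u cand seen rest with
  | zero =>
    rw [greedy, if_neg]
    rintro rfl
    simp at h'
  | succ r ih =>
    simp only [greedy]
    split_ifs with h1 h2
    · exact ih h h'
    · exact ih (Finset.mem_insert_of_mem h)
        (Finset.mem_erase.2 ⟨fun e => h1 (e ▸ h), h'⟩)
    · exact ih (Finset.mem_insert_of_mem h) h'

open Classical in
/-- In the signed sum over the explorations only the greedy one survives: for a label outside `L`,
the two ways to accept it cancel, and a label of `L` has to be chosen. -/
theorem sumRuns_eq_greedy (L : Finset ℕ) (r u : ℕ) (e : Exploration)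
    (he : ∀ y ∈ e.chosen, y ∈ e.seen) :
    I.sumRuns (fun e => e.sign * if ∀ y ∈ L, y ∈ e.chosen then 1 else 0) r u e =
      e.sign * I.greedy r u e.cand e.seen (L.filter (· ∉ e.chosen)) := by
  induction r generalizing u e with
  | zero =>
    simp only [sumRuns, greedy, Finset.filter_eq_empty_iff, not_not]
  | succ r ih =>
    set y := e.cand.getD u I.obs with hy
    by_cases h1 : y ∈ e.seen
    · have h0 : I.step u 0 e = e := by simp only [step, ← hy, h1, if_true]
      have hg : ∀ g, g ≠ 0 → I.step u g e = { e with sign := 0 } := fun g hg => by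
        simp only [step, ← hy, h1, if_true, hg, if_false]
      simp only [sumRuns, Finset.sum_range_succ, Finset.sum_range_zero, zero_add, h0,
        hg 1 one_ne_zero, hg 2 two_ne_zero, greedy, ← hy, h1, if_true]
      rw [ih (u + 1) e he, ih (u + 1) { e with sign := 0 } he]
      simp
    have h0 : I.step u 0 e = { e with seen := insert y e.seen } := by
      simp only [step, ← hy, h1, if_false, if_true]
    have hg1 : I.step u 1 e = ⟨e.cand ++ I.nbrs y, insert y e.seen, e.chosen, -e.sign⟩ := by
      simp only [step, ← hy, h1, if_false, one_ne_zero, if_true]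
    have hg2 : I.step u 2 e =
        ⟨e.cand ++ I.nbrs y, insert y e.seen, e.chosen ++ [y], e.sign⟩ := by
      simp only [step, ← hy, h1, if_false, two_ne_zero, OfNat.ofNat_ne_one]
    have hyc : y ∉ e.chosen := fun h => h1 (he y h)
    have he' : ∀ z ∈ e.chosen, z ∈ insert y e.seen := fun z hz => Finset.mem_insert_of_mem (he z hz)
    simp only [sumRuns, Finset.sum_range_succ, Finset.sum_range_zero, zero_add, h0, hg1, hg2, greedy,
      ← hy, h1, if_false]
    rw [ih (u + 1) _ (by simpa using fun z hz => .inr (he z hz)),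
      ih (u + 1) _ (by simpa using fun z hz => .inr (he z hz)), ih (u + 1) _ (fun z hz => ?_)]
    · dsimp only
      by_cases h2 : y ∈ L
      · have h3 : y ∈ L.filter (· ∉ e.chosen) := Finset.mem_filter.2 ⟨h2, hyc⟩
        have h4 : L.filter (· ∉ e.chosen ++ [y]) = (L.filter (· ∉ e.chosen)).erase y := by
          ext z; simp only [Finset.mem_filter, Finset.mem_erase, List.mem_append, List.mem_singleton]
          tauto
        rw [I.greedy_eq_zero (Finset.mem_insert_self y _) h3,
          I.greedy_eq_zero (Finset.mem_insert_self y _) h3, if_pos h3, h4]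
        simp
      · have h3 : y ∉ L.filter (· ∉ e.chosen) := fun h => h2 (Finset.mem_filter.1 h).1
        have h4 : L.filter (· ∉ e.chosen ++ [y]) = L.filter (· ∉ e.chosen) := by
          refine Finset.filter_congr fun z hz => ?_
          have : z ≠ y := fun h => h2 (h ▸ hz)
          simp [this]
        rw [if_neg h3, h4]
        ring
    · rcases List.mem_append.1 hz with h | h
      · exact he' z h
      · simp [List.mem_singleton.1 h]

/-- Every entry of the list is the label of the observable, or equals or neighbours a later entry or
that label. -/
def Chained : List ℕ → Prop
  | [] => True
  | x :: l => Chained l ∧ ∃ y ∈ I.obs :: l, x = y ∨ x ∈ I.nbrs y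

theorem length_nbrs (x : ℕ) : (I.nbrs x).length = I.numNbrs x := by simp [nbrs]

/-- A chained list is connected to the observable, so the greedy exploration finds all of its entries:
when all candidates have been dealt with, induction along the list shows that none is left. Accepting
a label adds at most `degreeBound` candidates, which bounds the number of steps. The hypotheses are the
invariants of the exploration: `rest` is still to be found, every neighbour of a label found so far is
a candidate, and the first `u` candidates have been seen. -/
theorem greedy_eq_one {l : List ℕ} (hl : I.Chained l) (hD : ∀ x, I.numNbrs x ≤ I.degreeBound)
    {r u : ℕ} {cand : List ℕ} {seen rest : Finset ℕ} (hrest : rest ⊆ l.toFinset.erase I.obs)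
    (hdisj : Disjoint rest seen)
    (hobs : I.obs ∈ seen)
    (hnbr : ∀ x, (x = I.obs ∨ x ∈ l ∧ x ∉ rest) → ∀ z ∈ I.nbrs x, z ∈ cand)
    (hseen : ∀ i < u, ∀ h : i < cand.length, cand[i] ∈ seen)
    (hlen : cand.length + I.degreeBound * rest.card ≤ u + r) :
    I.greedy r u cand seen rest = 1 := by
  induction r generalizing u cand seen rest with
  | zero =>
    rw [greedy, if_pos]
    have hall : ∀ z ∈ cand, z ∈ seen := by
      intro z hz
      obtain ⟨i, hi, rfl⟩ := List.mem_iff_getElem.1 hz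
      exact hseen i (by omega) hi
    have hn : ∀ z ∈ seen, z ∉ rest := fun z h h' => Finset.disjoint_left.1 hdisj h' h
    have key : ∀ l', l' <:+ l → I.Chained l' → ∀ x ∈ l', x ∉ rest := by
      intro l'
      induction l' with
      | nil => simp
      | cons x l' ih =>
        rintro hs ⟨hc, y, hy, hxy⟩
        have ih' := ih ((List.suffix_cons x l').trans hs) hc
        have hx : x ∉ rest := by
          have hy' : y = I.obs ∨ y ∈ l ∧ y ∉ rest := by
            rcases List.mem_cons.1 hy with h | h
            · exact .inl h
            · exact .inr ⟨((List.suffix_cons x l').trans hs).subset h, ih' y h⟩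
          rcases hxy with rfl | h
          · rcases hy' with h | h
            · rw [h]; exact hn _ hobs
            · exact h.2
          · exact hn _ (hall _ (hnbr y hy' x h))
        intro z hz
        rcases List.mem_cons.1 hz with rfl | h
        exacts [hx, ih' z h]
    refine Finset.eq_empty_of_forall_notMem fun z hz => ?_
    have : z ∈ l := by simpa using (Finset.mem_erase.1 (hrest hz)).2
    exact key l List.suffix_rfl hl z this hz
  | succ r ih =>
    simp only [greedy]
    set y := cand.getD u I.obs with hy
    have hget : ∀ h : u < cand.length, cand[u] = y := fun h => by simp [hy, h]
    split_ifs with h1 h2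
    · refine ih hrest hdisj hobs hnbr (fun i hi h => ?_) (by omega)
      rcases Nat.lt_succ_iff_lt_or_eq.1 hi with h' | rfl
      · exact hseen i h' h
      · rw [hget h]; exact h1
    · have hcard := Finset.card_erase_of_mem h2
      have hpos : 0 < rest.card := Finset.card_pos.2 ⟨y, h2⟩
      refine ih ((Finset.erase_subset _ _).trans hrest) ?_ (Finset.mem_insert_of_mem hobs) ?_ ?_ ?_
      · rw [Finset.disjoint_left] at hdisj ⊢
        intro z hz hz'
        rcases Finset.mem_insert.1 hz' with rfl | h
        · simp at hz
        · exact hdisj (Finset.mem_of_mem_erase hz) h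
      · intro x hx z hz
        by_cases hxy : x = y
        · exact List.mem_append_right _ (hxy ▸ hz)
        · refine List.mem_append_left _ (hnbr x (hx.imp_right fun h => ⟨h.1, fun h' => h.2 ?_⟩) z hz)
          exact Finset.mem_erase.2 ⟨hxy, h'⟩
      · intro i hi h
        rw [List.getElem_append]
        split_ifs with h3
        · rcases Nat.lt_succ_iff_lt_or_eq.1 hi with h' | rfl
          · exact Finset.mem_insert_of_mem (hseen i h' h3)
          · rw [hget h3]; exact Finset.mem_insert_self _ _
        · -- A new candidate beyond the end of the old list would make `y` the observable.
          exfalso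
          refine h1 ?_
          rw [hy, List.getD_eq_default _ _ (by omega)]
          exact hobs
      · obtain ⟨c, hc⟩ : ∃ c, rest.card = c + 1 := ⟨rest.card - 1, by omega⟩
        rw [hcard, hc, Nat.add_sub_cancel, List.length_append, length_nbrs]
        rw [hc, mul_add, mul_one] at hlen
        have := hD y
        omega
    · refine ih hrest ?_ (Finset.mem_insert_of_mem hobs) hnbr ?_ (by omega)
      · rw [Finset.disjoint_left] at hdisj ⊢
        intro z hz hz'
        rcases Finset.mem_insert.1 hz' with rfl | h
        · exact h2 hz
        · exact hdisj hz h
      · intro i hi h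
        rcases Nat.lt_succ_iff_lt_or_eq.1 hi with h' | rfl
        · exact Finset.mem_insert_of_mem (hseen i h' h)
        · rw [hget h]; exact Finset.mem_insert_self _ _

open Classical in
/-- The signs of the explorations that choose all entries of a given chained list add up to one. -/
theorem sum_sign_explore {l : List ℕ} {M : ℕ} (hl : I.Chained l) (hM : l.length ≤ M)
    (hD : ∀ x, I.numNbrs x ≤ I.degreeBound) :
    ∑ w ∈ Finset.range (3 ^ I.steps M), (I.explore w (I.steps M)).sign *
      (if ∀ y ∈ l, y ∈ (I.explore w (I.steps M)).chosen then 1 else 0 : ℂ) = 1 := by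
  have h := I.sum_explore
    (fun e => e.sign * if ∀ y ∈ l.toFinset, y ∈ e.chosen then 1 else 0) (I.steps M) 0
  simp only [zero_add, pow_zero, Finset.sum_range_one, List.mem_toFinset] at h
  rw [h, explore]
  have h' := I.sumRuns_eq_greedy l.toFinset (I.steps M) 0 I.start (by simp [start])
  simp only [List.mem_toFinset] at h'
  have hf : l.toFinset.filter (· ∉ I.start.chosen) = l.toFinset.erase I.obs := by
    ext z; simp [start, and_comm]
  rw [h', hf]
  have hcard : (l.toFinset.erase I.obs).card ≤ M :=
    (Finset.card_le_card (Finset.erase_subset _ _)).trans ((List.toFinset_card_le l).trans hM)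
  simp only [start, one_mul]
  refine I.greedy_eq_one hl hD subset_rfl (by simp) (by simp) ?_ (by simp) ?_
  · intro x hx z hz
    have : x = I.obs := by
      rcases hx with h | ⟨h, h'⟩
      · exact h
      · by_contra hne
        exact h' (Finset.mem_erase.2 ⟨hne, List.mem_toFinset.2 h⟩)
    exact this ▸ hz
  · have := hD I.obs
    have h2 := Nat.mul_le_mul_left I.degreeBound hcard
    rw [length_nbrs, zero_add, steps, mul_add, mul_one]
    omega

end Input

/-! ### Time evolution as a series of nested commutators -/

/-- The `m`-fold commutator of `h` with `a`. -/
def adPow {R : Type*} [Ring R] (h a : R) : ℕ → R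
  | 0 => a
  | m + 1 => h * adPow h a m - adPow h a m * h

theorem exp_mul_left {R : Type*} [NormedRing R] [NormedAlgebra ℂ R] [CompleteSpace R] (h a : R) :
    NormedSpace.exp (ContinuousLinearMap.mul ℂ R h) a = NormedSpace.exp h * a := by
  have hpow : ∀ n : ℕ, (ContinuousLinearMap.mul ℂ R h ^ n) a = h ^ n * a := by
    intro n
    induction n with
    | zero => simp
    | succ n ih => rw [pow_succ', pow_succ', mul_apply_eq_comp, ih]; simp [mul_assoc]
  have h1 := (NormedSpace.exp_series_hasSum_exp' (𝕂 := ℂ) (ContinuousLinearMap.mul ℂ R h)).mapL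
    (ContinuousLinearMap.apply ℂ R a)
  have h2 := (NormedSpace.exp_series_hasSum_exp' (𝕂 := ℂ) h).mul_right a
  refine h1.unique (h2.congr_fun fun n => ?_)
  simp [hpow]

theorem exp_mul_right {R : Type*} [NormedRing R] [NormedAlgebra ℂ R] [CompleteSpace R] (h a : R) :
    NormedSpace.exp ((ContinuousLinearMap.mul ℂ R).flip h) a = a * NormedSpace.exp h := by
  have hpow : ∀ n : ℕ, ((ContinuousLinearMap.mul ℂ R).flip h ^ n) a = a * h ^ n := by
    intro n
    induction n with
    | zero => simp
    | succ n ih => rw [pow_succ', pow_succ, mul_apply_eq_comp, ih]; simp [mul_assoc]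
  have h1 := (NormedSpace.exp_series_hasSum_exp' (𝕂 := ℂ)
    ((ContinuousLinearMap.mul ℂ R).flip h)).mapL (ContinuousLinearMap.apply ℂ R a)
  have h2 := (NormedSpace.exp_series_hasSum_exp' (𝕂 := ℂ) h).mul_left a
  refine h1.unique (h2.congr_fun fun n => ?_)
  simp [hpow]

/-- Left and right multiplication by `h` commute, so that conjugation with `exp (z h)` is the
exponential of the commutator with `z h`. -/
theorem hasSum_adPow {R : Type*} [NormedRing R] [NormedAlgebra ℂ R] [CompleteSpace R] (h a : R)
    (z : ℂ) :
    HasSum (fun m : ℕ => (z ^ m / m.factorial) • adPow h a m)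
      (NormedSpace.exp (z • h) * a * NormedSpace.exp ((-z) • h)) := by
  set l := ContinuousLinearMap.mul ℂ R
  have hcomm : Commute (l (z • h)) (l.flip ((-z) • h)) := by
    ext b
    simp [l, mul_assoc]
  have hpow : ∀ m : ℕ, ((l (z • h) + l.flip ((-z) • h)) ^ m) a = z ^ m • adPow h a m := by
    intro m
    induction m with
    | zero => simp [adPow]
    | succ m ih =>
      rw [pow_succ', mul_apply_eq_comp, ih]
      simp [l, adPow, smul_smul, pow_succ', mul_comm, sub_eq_add_neg]
  have h1 := (NormedSpace.exp_series_hasSum_exp' (𝕂 := ℂ) (l (z • h) + l.flip ((-z) • h))).mapL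
    (ContinuousLinearMap.apply ℂ R a)
  have h2 : (ContinuousLinearMap.apply ℂ R a) (NormedSpace.exp (l (z • h) + l.flip ((-z) • h))) =
      NormedSpace.exp (z • h) * a * NormedSpace.exp ((-z) • h) := by
    let _ : NormedAlgebra ℚ (R →L[ℂ] R) := NormedAlgebra.restrictScalars ℚ ℂ _
    rw [NormedSpace.exp_add_of_commute hcomm, ContinuousLinearMap.apply_apply,
      mul_apply_eq_comp, exp_mul_right, exp_mul_left, mul_assoc]
  rw [h2] at h1
  refine h1.congr_fun fun m => ?_
  rw [ContinuousLinearMap.apply_apply, smul_apply, hpow, smul_smul,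
    div_eq_inv_mul]

/-! ### Words of labels -/

/-- Prepending an element to a list. -/
def consEmbedding (α : Type*) : α × List α ↪ List α where
  toFun p := p.1 :: p.2
  inj' := by
    intro p q h
    exact Prod.ext (List.cons.inj h).1 (List.cons.inj h).2

/-- The lists of length `m`. -/
def words (α : Type*) [Fintype α] : ℕ → Finset (List α)
  | 0 => {[]}
  | m + 1 => (Finset.univ ×ˢ words α m).map (consEmbedding α)

theorem sum_words_succ {α β : Type*} [Fintype α] [AddCommMonoid β] (m : ℕ) (f : List α → β) :
    ∑ l ∈ words α (m + 1), f l = ∑ l ∈ words α m, ∑ x, f (x :: l) := by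
  rw [words, Finset.sum_map, Finset.sum_product, Finset.sum_comm]
  rfl

theorem length_of_mem_words {α : Type*} [Fintype α] {m : ℕ} {l : List α} (h : l ∈ words α m) :
    l.length = m := by
  induction m generalizing l with
  | zero => simp [words] at h; simp [h]
  | succ m ih =>
    simp only [words, Finset.mem_map, Finset.mem_product] at h
    obtain ⟨p, ⟨-, hp⟩, rfl⟩ := h
    change (p.1 :: p.2).length = m + 1
    rw [List.length_cons, ih hp]

variable {n d : ℕ}

/-! ### Locality -/

/-- Operators acting on disjoint subsystems commute: in the sum over intermediate configurations only
the one that has been changed on the first subsystem but not on the second contributes. -/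
theorem ActsOn.commute {X Y : Finset (Fin n)} {B C : Op n d} (hB : ActsOn X B) (hC : ActsOn Y C)
    (hXY : Disjoint X Y) : B * C = C * B := by
  have one_sided : ∀ {X Y : Finset (Fin n)} {B C : Op n d}, ActsOn X B → ActsOn Y C →
      Disjoint X Y → ∀ σ τ : Fin n → Fin d, (B * C) σ τ =
        B σ (fun v => if v ∈ X then τ v else σ v) * C (fun v => if v ∈ X then τ v else σ v) τ := by
    rintro X Y B C ⟨b, hb⟩ ⟨c, hc⟩ hXY σ τ
    rw [Matrix.mul_apply]
    refine Finset.sum_eq_single _ (fun υ _ hυ => ?_) (by simp)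
    by_contra hne
    refine hυ (funext fun v => ?_)
    by_cases hv : v ∈ X
    · by_contra hvne
      refine hne (mul_eq_zero_of_right _ ((hc υ τ).2 fun h => hvne ?_))
      rw [h v (Finset.disjoint_left.1 hXY hv), if_pos hv]
    · by_contra hvne
      refine hne (mul_eq_zero_of_left ((hb σ υ).2 fun h => hvne ?_) _)
      rw [← h v hv, if_neg hv]
  ext σ τ
  rw [one_sided hB hC hXY, one_sided hC hB hXY.symm]
  obtain ⟨b, hb⟩ := hB
  obtain ⟨c, hc⟩ := hC
  have hdX : ∀ v ∈ X, v ∉ Y := fun v h => Finset.disjoint_left.1 hXY h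
  have hdY : ∀ v ∈ Y, v ∉ X := fun v h => Finset.disjoint_right.1 hXY h
  by_cases h : ∀ v, v ∉ X → v ∉ Y → σ v = τ v
  · have e1 : B σ (fun v => if v ∈ X then τ v else σ v) =
        B (fun v => if v ∈ Y then τ v else σ v) τ := by
      rw [(hb _ _).1 (fun v hv => by simp [hv]), (hb _ _).1 (fun v hv => ?_)]
      · congr 1 <;> funext v
        · simp [hdX v v.2]
        · simp
      · by_cases hv' : v ∈ Y
        · simp [hv']
        · simp [hv', h v hv hv']
    have e2 : C (fun v => if v ∈ X then τ v else σ v) τ =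
        C σ (fun v => if v ∈ Y then τ v else σ v) := by
      rw [(hc _ _).1 (fun v hv => ?_), (hc _ _).1 (fun v hv => by simp [hv])]
      · congr 1 <;> funext v
        · simp [hdY v v.2]
        · simp
      · by_cases hv' : v ∈ X
        · simp [hv']
        · simp [hv', h v hv' hv]
    rw [e1, e2, mul_comm]
  · push Not at h
    obtain ⟨v, hvX, hvY, hv⟩ := h
    rw [mul_eq_zero_of_right, mul_eq_zero_of_right]
    · exact (hb _ _).2 fun h => hv (by simpa [hvY] using h v hvX)
    · exact (hc _ _).2 fun h => hv (by simpa [hvX] using h v hvY)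

/-- `B` commutes with every operator acting on a subsystem disjoint from `Y`. -/
def CommutesOff (Y : Set (Fin n)) (B : Op n d) : Prop :=
  ∀ (Z : Finset (Fin n)) (C : Op n d), ActsOn Z C → (∀ v ∈ Z, v ∉ Y) → Commute C B

theorem ActsOn.smul {X : Finset (Fin n)} {B : Op n d} (h : ActsOn X B) (z : ℂ) :
    ActsOn X (z • B) := by
  obtain ⟨b, hb⟩ := h
  exact ⟨z • b, fun σ τ => ⟨fun h => by simp [(hb σ τ).1 h], fun h => by simp [(hb σ τ).2 h]⟩⟩

theorem ActsOn.commutesOff {X : Finset (Fin n)} {B : Op n d} (h : ActsOn X B) :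
    CommutesOff (X : Set (Fin n)) B := fun _ _ hC hZ =>
  hC.commute h (Finset.disjoint_left.2 fun v hv => by simpa using hZ v hv)

namespace LocalHamiltonian

variable (H : LocalHamiltonian n d) (A : Op n d)

/-- The term with label `x`, including its coefficient. -/
noncomputable def weighted (x : Fin H.numTerms) : Op n d := (H.coeff x : ℂ) • H.term x

theorem actsOn_weighted (x : Fin H.numTerms) : ActsOn (H.region x) (H.weighted x) :=
  ActsOn.smul (H.term_support x).1 _

/-- The nested commutator of the terms in a list with `A`; the last entry acts first. -/
noncomputable def nested : List (Fin H.numTerms) → Op n d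
  | [] => A
  | x :: l => H.weighted x * nested l - nested l * H.weighted x

/-- A power of the commutator with a sum expands into the nested commutators of its terms. -/
theorem adPow_sum (P : Fin H.numTerms → Prop) [DecidablePred P] (m : ℕ) :
    adPow (∑ x with P x, H.weighted x) A m =
      ∑ l ∈ words (Fin H.numTerms) m, if ∀ x ∈ l, P x then H.nested A l else 0 := by
  induction m with
  | zero => simp [adPow, words, nested]
  | succ m ih =>
    rw [adPow, ih, sum_words_succ, Finset.mul_sum, Finset.sum_mul, ← Finset.sum_sub_distrib]
    refine Finset.sum_congr rfl fun l _ => ?_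
    rw [Finset.sum_mul, Finset.mul_sum, ← Finset.sum_sub_distrib, Finset.sum_filter]
    refine Finset.sum_congr rfl fun x _ => ?_
    simp only [List.forall_mem_cons, nested]
    by_cases hl : ∀ y ∈ l, P y
    · simp only [if_pos hl, and_iff_left hl]
    · simp only [hl, and_false, if_false, mul_zero, zero_mul, sub_self, ite_self]

theorem adPow_toOp (m : ℕ) :
    adPow H.toOp A m = ∑ l ∈ words (Fin H.numTerms) m, H.nested A l := by
  simpa [toOp, weighted] using H.adPow_sum A (fun _ => True) m

variable {A} {o : Fin H.numTerms}

/-- A nested commutator commutes with everything that acts away from the subsystems of its terms and of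
the observable. -/
theorem commutesOff_nested (hA : ActsOn (H.region o) A) (l : List (Fin H.numTerms)) :
    CommutesOff {v | ∃ y ∈ o :: l, v ∈ H.region y} (H.nested A l) := by
  induction l with
  | nil => intro Z C hC hZ; exact hA.commutesOff Z C hC fun v hv h => hZ v hv ⟨o, by simp, h⟩
  | cons x l ih =>
    intro Z C hC hZ
    have h1 : Commute C (H.nested A l) := ih Z C hC fun v hv ⟨y, hy, h⟩ =>
      hZ v hv ⟨y, by simp only [List.mem_cons] at hy ⊢; tauto, h⟩
    have h2 : Commute C (H.weighted x) := (H.actsOn_weighted x).commutesOff Z C hC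
      fun v hv h => hZ v hv ⟨x, by simp, h⟩
    exact (h2.mul_right h1).sub_right (h1.mul_right h2)

/-- A nested commutator vanishes unless its outermost label equals or neighbours a later one or the
label of the observable. -/
theorem nested_cons_eq_zero (hA : ActsOn (H.region o) A) {x : Fin H.numTerms}
    {l : List (Fin H.numTerms)}
    (h : ∀ y ∈ o :: l, x ≠ y ∧ ¬ H.interactionGraph.Adj y x) : H.nested A (x :: l) = 0 := by
  have h1 := H.commutesOff_nested hA l (H.region x) (H.weighted x) (H.actsOn_weighted x) (by
    rintro v hv ⟨y, hy, hvy⟩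
    exact (h y hy).2 ⟨(h y hy).1.symm, ⟨v, Finset.mem_inter.2 ⟨hvy, hv⟩⟩⟩)
  rw [nested, h1.eq, sub_self]

open scoped Matrix.Norms.L2Operator

theorem norm_weighted_le (x : Fin H.numTerms) : ‖H.weighted x‖ ≤ 1 := by
  have h1 : ‖H.term x‖ = 1 := H.term_norm x
  rw [weighted, norm_smul, h1, mul_one, Complex.norm_real]
  exact H.abs_coeff_le x

/-- Every step of a nested commutator has at most `(m + 1) (D + 1)` labels to choose from, and costs
a factor two in the norm. -/
theorem sum_norm_nested_le (hA : ActsOn (H.region o) A) {D : ℕ}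
    (hD : H.interactionGraph.maxDegree ≤ D) (m : ℕ) :
    ∑ l ∈ words (Fin H.numTerms) m, ‖H.nested A l‖ ≤
      m.factorial * (2 * (D + 1)) ^ m * ‖A‖ := by
  induction m with
  | zero => simp [words, nested]
  | succ m ih =>
    rw [sum_words_succ]
    have key : ∀ l ∈ words (Fin H.numTerms) m, ∑ x, ‖H.nested A (x :: l)‖ ≤
        ((m + 1) * (2 * (D + 1)) : ℝ) * ‖H.nested A l‖ := by
      intro l hl
      set U := (o :: l).toFinset.biUnion fun y => insert y (H.interactionGraph.neighborFinset y)
      have hU : U.card ≤ (m + 1) * (D + 1) := by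
        refine (Finset.card_biUnion_le_card_mul _ _ (D + 1) fun y _ => ?_).trans
          (Nat.mul_le_mul_right _ ?_)
        · refine (Finset.card_insert_le _ _).trans (Nat.succ_le_succ ?_)
          rw [SimpleGraph.card_neighborFinset_eq_degree]
          exact (H.interactionGraph.degree_le_maxDegree y).trans hD
        · refine (List.toFinset_card_le _).trans ?_
          simp [length_of_mem_words hl]
      have hz : ∑ x, ‖H.nested A (x :: l)‖ = ∑ x ∈ U, ‖H.nested A (x :: l)‖ := by
        refine (Finset.sum_subset (Finset.subset_univ _) fun x _ hx => ?_).symm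
        rw [H.nested_cons_eq_zero hA, norm_zero]
        intro y hy
        simp only [U, Finset.mem_biUnion, List.mem_toFinset, Finset.mem_insert,
          SimpleGraph.mem_neighborFinset, not_exists, not_and, not_or] at hx
        exact hx y hy
      rw [hz]
      have hx : ∀ x ∈ U, ‖H.nested A (x :: l)‖ ≤ 2 * ‖H.nested A l‖ := by
        intro x _
        rw [nested, two_mul]
        refine (norm_sub_le _ _).trans (add_le_add ?_ ?_)
        · exact (norm_mul_le _ _).trans (mul_le_of_le_one_left (norm_nonneg _) (H.norm_weighted_le x))
        · exact (norm_mul_le _ _).trans (mul_le_of_le_one_right (norm_nonneg _) (H.norm_weighted_le x))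
      refine (Finset.sum_le_card_nsmul _ _ _ hx).trans ?_
      rw [nsmul_eq_mul]
      have : (U.card : ℝ) ≤ (m + 1) * (D + 1) := by exact_mod_cast hU
      calc (U.card : ℝ) * (2 * ‖H.nested A l‖) ≤ ((m + 1) * (D + 1)) * (2 * ‖H.nested A l‖) := by
            gcongr
        _ = _ := by ring
    calc ∑ l ∈ words (Fin H.numTerms) m, ∑ x, ‖H.nested A (x :: l)‖
        ≤ ∑ l ∈ words (Fin H.numTerms) m, ((m + 1) * (2 * (D + 1)) : ℝ) * ‖H.nested A l‖ :=
          Finset.sum_le_sum key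
      _ = ((m + 1) * (2 * (D + 1)) : ℝ) * ∑ l ∈ words (Fin H.numTerms) m, ‖H.nested A l‖ := by
          rw [Finset.mul_sum]
      _ ≤ ((m + 1) * (2 * (D + 1)) : ℝ) * (m.factorial * (2 * (D + 1)) ^ m * ‖A‖) := by gcongr
      _ = _ := by rw [Nat.factorial_succ]; push_cast; ring

theorem norm_adPow_le (hA : ActsOn (H.region o) A) {D : ℕ}
    (hD : H.interactionGraph.maxDegree ≤ D) (m : ℕ) :
    ‖adPow H.toOp A m‖ ≤ m.factorial * (2 * (D + 1)) ^ m * ‖A‖ := by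
  rw [adPow_toOp]
  exact (norm_sum_le _ _).trans (H.sum_norm_nested_le hA hD m)

end LocalHamiltonian

/-! ### Product states -/

variable {n d : ℕ}

open scoped Matrix.Norms.L2Operator in
/-- Every vector state has expectation at most the operator norm. -/
theorem norm_dotProduct_mulVec_le {ι : Type*} [Fintype ι] [DecidableEq ι] (B : Matrix ι ι ℂ)
    (c : ι → ℂ) : ‖c ⬝ᵥ B.mulVec (star c)‖ ≤ ‖B‖ * ∑ i, ‖c i‖ ^ 2 := by
  set x : EuclideanSpace ℂ ι := WithLp.toLp 2 (star c)
  have h1 : c ⬝ᵥ B.mulVec (star c) = inner ℂ x (Matrix.toEuclideanCLM (n := ι) (𝕜 := ℂ) B x) := by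
    rw [EuclideanSpace.inner_eq_star_dotProduct, Matrix.ofLp_toEuclideanCLM, dotProduct_comm]
    simp [x]
  have h2 : ‖x‖ ^ 2 = ∑ i, ‖c i‖ ^ 2 := by
    rw [EuclideanSpace.norm_sq_eq]
    simp [x]
  rw [h1, ← h2, sq, ← mul_assoc]
  refine (norm_inner_le_norm _ _).trans ?_
  rw [mul_comm]
  exact mul_le_mul_of_nonneg_right ((Matrix.toEuclideanCLM (n := ι) (𝕜 := ℂ) B).le_opNorm x)
    (norm_nonneg _)

open scoped Matrix.Norms.L2Operator in
theorem norm_trace_mul_le {ι : Type*} [Fintype ι] [DecidableEq ι] (B C : Matrix ι ι ℂ) :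
    ‖(B * (C.conjTranspose * C)).trace‖ ≤ ‖B‖ * ‖(C.conjTranspose * C).trace‖ := by
  have h1 : (B * (C.conjTranspose * C)).trace = ∑ i, C i ⬝ᵥ B.mulVec (star (C i)) := by
    rw [← mul_assoc, Matrix.trace_mul_comm, ← mul_assoc]
    simp only [Matrix.trace, Matrix.diag, Matrix.mul_apply, Matrix.mulVec, dotProduct, Finset.sum_mul,
      Finset.mul_sum, Matrix.conjTranspose_apply, Pi.star_apply, mul_assoc]
    exact Finset.sum_congr rfl fun i _ => Finset.sum_comm
  have h2 : (C.conjTranspose * C).trace = ((∑ i, ∑ j, ‖C i j‖ ^ 2 : ℝ) : ℂ) := by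
    simp only [Matrix.trace, Matrix.diag, Matrix.mul_apply, Matrix.conjTranspose_apply]
    rw [Finset.sum_comm]
    push_cast
    refine Finset.sum_congr rfl fun i _ => Finset.sum_congr rfl fun j _ => ?_
    rw [← Complex.conj_mul']; rfl
  rw [h1, h2, Complex.norm_real, Real.norm_of_nonneg (by positivity), Finset.mul_sum]
  exact (norm_sum_le _ _).trans (Finset.sum_le_sum fun i _ => norm_dotProduct_mulVec_le B (C i))

open scoped MatrixOrder Matrix.Norms.L2Operator in
theorem exists_conjTranspose_mul_self {ι : Type*} [Fintype ι] [DecidableEq ι] {P : Matrix ι ι ℂ}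
    (hP : P.PosSemidef) : ∃ C : Matrix ι ι ℂ, P = C.conjTranspose * C :=
  CStarAlgebra.nonneg_iff_eq_star_mul_self.mp hP.nonneg

/-- The tensor product of the square roots of the one-spin density matrices shows that a product
state is positive. -/
theorem ProductState.exists_conjTranspose_mul_self (ρ : ProductState n d) :
    ∃ C : Op n d, ρ.toOp = C.conjTranspose * C := by
  choose c hc using fun v => ShortTime.exists_conjTranspose_mul_self (ρ.posSemidef v)
  refine ⟨Matrix.of fun σ τ => ∏ v, c v (σ v) (τ v), ?_⟩
  ext σ τ
  simp only [ProductState.toOp, Matrix.of_apply, Matrix.mul_apply, Matrix.conjTranspose_apply,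
    star_prod, ← Finset.prod_mul_distrib]
  rw [← Fintype.piFinset_univ, ← Finset.prod_univ_sum (fun _ => Finset.univ)
    (fun v a => star (c v a (σ v)) * c v a (τ v))]
  refine Finset.prod_congr rfl fun v _ => ?_
  rw [hc v, Matrix.mul_apply]
  rfl

theorem ProductState.trace_toOp (ρ : ProductState n d) : ρ.toOp.trace = 1 := by
  simp only [Matrix.trace, Matrix.diag, ProductState.toOp, Matrix.of_apply]
  rw [← Fintype.piFinset_univ, ← Finset.prod_univ_sum (fun _ => Finset.univ)
    (fun v a => ρ.site v a a)]
  exact Finset.prod_eq_one fun v _ => ρ.trace_eq_one v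

/-- Expectations in a product state are bounded by the operator norm. -/
theorem ProductState.norm_trace_mul_le (ρ : ProductState n d) (B : Op n d) :
    ‖(B * ρ.toOp).trace‖ ≤ opNorm B := by
  obtain ⟨C, hC⟩ := ρ.exists_conjTranspose_mul_self
  have h := ShortTime.norm_trace_mul_le B C
  rwa [← hC, ρ.trace_toOp, norm_one, mul_one] at h

/-! ### Operators on a list of spins -/

section Extend

variable {r : ℕ} (e : Fin r → Fin n)

/-- A configuration consists of a configuration of the spins in the range of `e` and one of the other
spins. -/
noncomputable def splitEquiv (he : Function.Injective e) :
    (Fin n → Fin d) ≃ (Fin r → Fin d) × ({v // v ∉ Set.range e} → Fin d) :=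
  (Equiv.piEquivPiSubtypeProd (fun v => v ∈ Set.range e) fun _ => Fin d).trans
    (Equiv.prodCongr ((Equiv.ofInjective e he).symm.arrowCongr (Equiv.refl _)) (Equiv.refl _))

theorem splitEquiv_apply (he : Function.Injective e) (σ : Fin n → Fin d) :
    splitEquiv e he σ = (fun i => σ (e i), fun v : {v // v ∉ Set.range e} => σ v) := rfl

/-- The operator which is `b` on the spins in the range of `e` and the identity elsewhere. -/
noncomputable def extendOp (he : Function.Injective e)
    (b : Matrix (Fin r → Fin d) (Fin r → Fin d) ℂ) : Op n d :=
  (b.kronecker (1 : Matrix ({v // v ∉ Set.range e} → Fin d) ({v // v ∉ Set.range e} → Fin d) ℂ)).submatrix (splitEquiv e he)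
    (splitEquiv e he)

variable {e} (he : Function.Injective e)

theorem extendOp_mul (b c : Matrix (Fin r → Fin d) (Fin r → Fin d) ℂ) :
    extendOp e he (b * c) = extendOp e he b * extendOp e he c := by
  rw [extendOp, extendOp, extendOp, Matrix.submatrix_mul_equiv]
  congr 1
  have := Matrix.mul_kronecker_mul b c
    (1 : Matrix ({v // v ∉ Set.range e} → Fin d) ({v // v ∉ Set.range e} → Fin d) ℂ)
    (1 : Matrix ({v // v ∉ Set.range e} → Fin d) ({v // v ∉ Set.range e} → Fin d) ℂ)
  rwa [mul_one] at this

theorem extendOp_sub (b c : Matrix (Fin r → Fin d) (Fin r → Fin d) ℂ) :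
    extendOp e he (b - c) = extendOp e he b - extendOp e he c := by
  ext σ τ
  simp [extendOp, Matrix.kronecker, sub_mul]

/-- Commutators can be computed on the spins on which the operators act. -/
theorem adPow_extendOp (h a : Matrix (Fin r → Fin d) (Fin r → Fin d) ℂ) (m : ℕ) :
    adPow (extendOp e he h) (extendOp e he a) m = extendOp e he (adPow h a m) := by
  induction m with
  | zero => rfl
  | succ m ih => rw [adPow, adPow, ih, extendOp_sub, extendOp_mul, extendOp_mul]

open Classical in
theorem extendOp_apply (b : Matrix (Fin r → Fin d) (Fin r → Fin d) ℂ) (σ τ : Fin n → Fin d) :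
    extendOp e he b σ τ =
      if ∀ v, v ∉ Set.range e → σ v = τ v then b (fun i => σ (e i)) (fun i => τ (e i)) else 0 := by
  have h : (∀ v, v ∉ Set.range e → σ v = τ v) ↔
      (fun v : {v // v ∉ Set.range e} => σ v) = fun v : {v // v ∉ Set.range e} => τ v := by
    simp [funext_iff]
  rw [extendOp, Matrix.submatrix_apply, splitEquiv_apply, splitEquiv_apply, Matrix.kronecker,
    Matrix.kroneckerMap_apply, Matrix.one_apply]
  simp only [h]
  split_ifs <;> simp

/-- The spins outside the range of `e` drop out of the expectation. -/
theorem trace_extendOp_mul (ρ : ProductState n d) (b : Matrix (Fin r → Fin d) (Fin r → Fin d) ℂ) :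
    (extendOp e he b * ρ.toOp).trace =
      ∑ f, ∑ g, b f g * ∏ i, ρ.site (e i) (g i) (f i) := by
  set P : Matrix (Fin r → Fin d) (Fin r → Fin d) ℂ :=
    Matrix.of fun f g => ∏ i, ρ.site (e i) (f i) (g i)
  set R : Matrix ({v // v ∉ Set.range e} → Fin d) ({v // v ∉ Set.range e} → Fin d) ℂ :=
    Matrix.of fun f g => ∏ v : {v // v ∉ Set.range e}, ρ.site v (f v) (g v)
  have h1 : ρ.toOp = (P.kronecker R).submatrix (splitEquiv e he) (splitEquiv e he) := by
    ext σ τ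
    rw [Matrix.submatrix_apply, splitEquiv_apply, splitEquiv_apply, Matrix.kronecker,
      Matrix.kroneckerMap_apply]
    simp only [ProductState.toOp, P, R, Matrix.of_apply]
    rw [← Fintype.prod_subtype_mul_prod_subtype (fun v => v ∈ Set.range e)]
    congr 1
    have := (Equiv.ofInjective e he).prod_comp
      (fun v : {v // v ∈ Set.range e} => ρ.site v (σ v) (τ v))
    simp only [Equiv.ofInjective_apply] at this
    convert this.symm
  have h2 : R.trace = 1 := by
    simp only [Matrix.trace, Matrix.diag, R, Matrix.of_apply]
    rw [← Fintype.piFinset_univ, ← Finset.prod_univ_sum (fun _ => Finset.univ)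
      (fun (v : {v // v ∉ Set.range e}) a => ρ.site v a a)]
    exact Finset.prod_eq_one fun v _ => ρ.trace_eq_one v
  have h3 : (b.kronecker (1 : Matrix ({v // v ∉ Set.range e} → Fin d) ({v // v ∉ Set.range e} → Fin d) ℂ)) * (P.kronecker R) =
      (b * P).kronecker R := by
    have := Matrix.mul_kronecker_mul b P (1 : Matrix ({v // v ∉ Set.range e} → Fin d) ({v // v ∉ Set.range e} → Fin d) ℂ) R
    rw [one_mul] at this
    exact this.symm
  rw [h1, extendOp, Matrix.submatrix_mul_equiv, h3]
  have h4 : (((b * P).kronecker R).submatrix (splitEquiv e he) (splitEquiv e he)).trace =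
      ((b * P).kronecker R).trace :=
    (splitEquiv e he).sum_comp fun i => (b * P).kronecker R i i
  rw [h4, show ((b * P).kronecker R).trace = (b * P).trace * R.trace from Matrix.trace_kronecker _ _,
    h2, mul_one]
  rfl

end Extend

/-! ### The numbers computed from an instance -/

theorem nthElement_eq {m : ℕ} (s : Finset (Fin m)) {i : ℕ} (h : i < s.card) :
    nthElement s i = (s.orderEmbOfFin rfl ⟨i, h⟩ : ℕ) := by
  rw [nthElement, Finset.orderEmbOfFin_apply]
  simp [h]

theorem mem_iff_exists_orderEmbOfFin {m : ℕ} (s : Finset (Fin m)) (v : Fin m) :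
    v ∈ s ↔ ∃ i, s.orderEmbOfFin rfl i = v := by
  have := s.range_orderEmbOfFin rfl
  rw [← Finset.mem_coe, ← this]; rfl

theorem card_filter_lt_orderEmbOfFin {m : ℕ} (s : Finset (Fin m)) (i : Fin s.card) :
    (s.filter (· < s.orderEmbOfFin rfl i)).card = i := by
  have : s.filter (· < s.orderEmbOfFin rfl i) =
      (Finset.univ.filter (· < i)).map (s.orderEmbOfFin rfl).toEmbedding := by
    ext v
    simp only [Finset.mem_filter, Finset.mem_map, Finset.mem_univ, true_and]
    constructor
    · rintro ⟨hv, h⟩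
      obtain ⟨j, rfl⟩ := (mem_iff_exists_orderEmbOfFin s v).1 hv
      exact ⟨j, by simpa using h, rfl⟩
    · rintro ⟨j, hj, rfl⟩
      exact ⟨Finset.orderEmbOfFin_mem _ _ _, by simpa using hj⟩
  rw [this, Finset.card_map]
  have h2 : Finset.univ.filter (· < i) = Finset.Iio i := by ext; simp
  rw [h2, Fin.card_Iio]

/-- The number of a configuration, whose base-`d` digits are the states of the spins. -/
def code {r d : ℕ} (f : Fin r → Fin d) : ℕ := (finFunctionFinEquiv f : ℕ)

theorem code_lt {r d : ℕ} (f : Fin r → Fin d) : code f < d ^ r := (finFunctionFinEquiv f).2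

theorem code_eq {r d : ℕ} (f : Fin r → Fin d) : code f = ∑ i, (f i : ℕ) * d ^ (i : ℕ) :=
  finFunctionFinEquiv_apply f

theorem code_injective {r d : ℕ} : Function.Injective (code (r := r) (d := d)) :=
  Fin.val_injective.comp finFunctionFinEquiv.injective

theorem code_div_mod {r d : ℕ} (f : Fin r → Fin d) (i : Fin r) :
    code f / d ^ (i : ℕ) % d = f i :=
  congrArg Fin.val (congrFun (finFunctionFinEquiv.symm_apply_apply f) i)

theorem sum_range_eq_sum_code {r d : ℕ} (F : ℕ → ℂ) :
    ∑ a ∈ Finset.range (d ^ r), F a = ∑ f : Fin r → Fin d, F (code f) := by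
  rw [Finset.sum_range, ← finFunctionFinEquiv.sum_comp]; rfl

section Layout

variable {n d : ℕ} {L : List ℕ} (hL : L.Nodup) (hn : ∀ v ∈ L, v < n)

/-- The spin at a given position of a list of spins. -/
def spin (hn : ∀ v ∈ L, v < n) (i : Fin L.length) : Fin n := ⟨L[i], hn _ (List.getElem_mem _)⟩

include hL in
theorem spin_injective : Function.Injective (spin hn) := fun _ _ h =>
  Fin.ext ((hL.getElem_inj_iff).1 (congrArg Fin.val h))

theorem mem_range_spin {v : Fin n} : v ∈ Set.range (spin hn) ↔ (v : ℕ) ∈ L := by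
  constructor
  · rintro ⟨i, rfl⟩; exact List.getElem_mem _
  · intro h
    obtain ⟨i, hi, h⟩ := List.mem_iff_getElem.1 h
    exact ⟨⟨i, hi⟩, Fin.ext h⟩

variable {I : Input} (hd : I.d = d)

include hL hd in
theorem digit_code (f : Fin L.length → Fin d) (i : Fin L.length) :
    I.digit L (code f) (spin hn i) = f i := by
  rw [Input.digit, show ((spin hn i : Fin n) : ℕ) = L[(i : ℕ)] from rfl, hL.idxOf_getElem, hd]
  exact code_div_mod f i

/-- How the table of spins of the label `x` describes the subsystem `X`. -/
def Lists (I : Input) (x : ℕ) (X : Finset (Fin n)) : Prop :=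
  I.numSites x = X.card ∧ ∀ i < X.card, I.site x i = nthElement X i

variable {x : ℕ} {X : Finset (Fin n)} (hx : Lists I x X) (hX : ∀ v ∈ X, (v : ℕ) ∈ L)

include hx in
theorem Lists.sum (φ : ℕ → ℕ → ℕ) : ∑ l ∈ Finset.range (I.numSites x), φ l (I.site x l) =
    ∑ l : Fin X.card, φ l (X.orderEmbOfFin rfl l : Fin n) := by
  rw [hx.1, Finset.sum_range]
  refine Finset.sum_congr rfl fun l _ => ?_
  rw [hx.2 l l.2, nthElement_eq X l.2]

include hL hd hx hX in
open Classical in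
theorem share_code (f : Fin L.length → Fin d) : I.share L x (I.numSites x) (code f) =
    ∑ i with spin hn i ∈ X, (f i : ℕ) * d ^ (i : ℕ) := by
  rw [Input.share, hx.sum fun l v => I.digit L (code f) v * I.d ^ L.idxOf v]
  have hmem : ∀ l, ∃ i, spin hn i = X.orderEmbOfFin rfl l := fun l =>
    (mem_range_spin hn).2 (hX _ (Finset.orderEmbOfFin_mem _ _ _))
  choose g hg using hmem
  refine Finset.sum_bij (fun l _ => g l) (fun l _ => ?_) (fun l _ l' _ h => ?_) (fun i hi => ?_)
    (fun l _ => ?_)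
  · simp [hg]
  · exact (X.orderEmbOfFin rfl).injective (by rw [← hg, ← hg, h])
  · obtain ⟨l, hl⟩ := (mem_iff_exists_orderEmbOfFin X _).1 (Finset.mem_filter.1 hi).2
    exact ⟨l, Finset.mem_univ _, spin_injective hL hn ((hg l).trans hl)⟩
  · rw [← hg, digit_code hL hn hd, show ((spin hn (g l) : Fin n) : ℕ) = L[(g l : ℕ)] from rfl,
      hL.idxOf_getElem, hd]

include hL hd hx hX in
/-- The two numbers that the algorithm compares are equal iff the configurations coincide off `X`. -/
theorem share_code_eq_iff (f g : Fin L.length → Fin d) :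
    code f + I.share L x (I.numSites x) (code g) = code g + I.share L x (I.numSites x) (code f) ↔
      ∀ i, spin hn i ∉ X → f i = g i := by
  classical
  have hsplit : ∀ f : Fin L.length → Fin d, code f =
      ∑ i with spin hn i ∈ X, (f i : ℕ) * d ^ (i : ℕ) +
        ∑ i with spin hn i ∉ X, (f i : ℕ) * d ^ (i : ℕ) := fun f => by
    rw [code_eq, Finset.sum_filter_add_sum_filter_not]
  rw [share_code hL hn hd hx hX, share_code hL hn hd hx hX]
  constructor
  · intro h i hi
    -- Replacing the states of the spins of `X` in `f` by those in `g` yields the number of `g`.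
    have h2 : code (fun i => if spin hn i ∈ X then g i else f i) = code g := by
      rw [hsplit fun i => if spin hn i ∈ X then g i else f i]
      have e1 : ∑ i with spin hn i ∈ X,
          ((if spin hn i ∈ X then g i else f i : Fin d) : ℕ) * d ^ (i : ℕ) =
          ∑ i with spin hn i ∈ X, (g i : ℕ) * d ^ (i : ℕ) :=
        Finset.sum_congr rfl fun i hi => by rw [if_pos (Finset.mem_filter.1 hi).2]
      have e2 : ∑ i with spin hn i ∉ X,
          ((if spin hn i ∈ X then g i else f i : Fin d) : ℕ) * d ^ (i : ℕ) =
          ∑ i with spin hn i ∉ X, (f i : ℕ) * d ^ (i : ℕ) :=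
        Finset.sum_congr rfl fun i hi => by rw [if_neg (Finset.mem_filter.1 hi).2]
      have h3 := hsplit f
      rw [e1, e2]
      omega
    have := congrFun (code_injective h2) i
    simpa [hi] using this
  · intro h
    have e : ∑ i with spin hn i ∉ X, (f i : ℕ) * d ^ (i : ℕ) =
        ∑ i with spin hn i ∉ X, (g i : ℕ) * d ^ (i : ℕ) :=
      Finset.sum_congr rfl fun i hi => by rw [h i (Finset.mem_filter.1 hi).2]
    have h3 := hsplit f
    have h4 := hsplit g
    omega

include hL hd hx hX in
theorem localCode_code (σ : Fin n → Fin d) :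
    I.localCode L x (I.numSites x) (code fun i => σ (spin hn i)) =
      code fun l => σ (X.orderEmbOfFin rfl l) := by
  rw [Input.localCode, hx.sum fun l v => I.digit L (code fun i => σ (spin hn i)) v * I.d ^ l,
    code_eq fun l => σ (X.orderEmbOfFin rfl l)]
  refine Finset.sum_congr rfl fun l _ => ?_
  obtain ⟨i, hi⟩ := (mem_range_spin hn).2 (hX _ (Finset.orderEmbOfFin_mem X rfl l))
  rw [← hi, digit_code hL hn hd, hd]

theorem localConfig_code [NeZero d] (X : Finset (Fin n)) (σ : Fin n → Fin d) (v : Fin n) :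
    localConfig X (code fun l => σ (X.orderEmbOfFin rfl l)) v = if v ∈ X then σ v else 0 := by
  rw [localConfig]
  split_ifs with hv
  · obtain ⟨l, rfl⟩ := (mem_iff_exists_orderEmbOfFin X v).1 hv
    rw [card_filter_lt_orderEmbOfFin]
    exact Fin.ext (code_div_mod (fun l => σ (X.orderEmbOfFin rfl l)) l)
  · rfl

include hL hd hx hX in
/-- The matrices of the algorithm on the spins in `L` represent the operators on the whole system. -/
theorem extendOp_embed [NeZero d] {B : Op n d} (hB : ActsOn X B) :
    extendOp (spin hn) (spin_injective hL hn)
      (Matrix.of fun f g => I.embed L (localEntry X B) x (code f) (code g)) = B := by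
  classical
  obtain ⟨b, hb⟩ := hB
  ext σ τ
  rw [extendOp_apply, Matrix.of_apply, Input.embed]
  simp only [share_code_eq_iff hL hn hd hx hX]
  have hiff : (∀ v, v ∉ X → σ v = τ v) ↔ (∀ v, v ∉ Set.range (spin hn) → σ v = τ v) ∧
      ∀ i, spin hn i ∉ X → σ (spin hn i) = τ (spin hn i) := by
    constructor
    · exact fun h => ⟨fun v hv => h v fun h' => hv ((mem_range_spin hn).2 (hX v h')),
        fun i hi => h _ hi⟩
    · rintro ⟨h1, h2⟩ v hv
      by_cases h : v ∈ Set.range (spin hn)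
      · obtain ⟨i, rfl⟩ := h
        exact h2 i hv
      · exact h1 v h
  by_cases h : ∀ v, v ∉ X → σ v = τ v
  · rw [if_pos (hiff.1 h).1, if_pos (hiff.1 h).2, localCode_code hL hn hd hx hX,
      localCode_code hL hn hd hx hX, localEntry, if_pos ⟨code_lt _, code_lt _⟩, (hb σ τ).1 h,
      (hb _ _).1 fun v hv => by rw [localConfig_code, localConfig_code, if_neg hv, if_neg hv]]
    congr 1 <;> ext v : 1 <;> rw [localConfig_code, if_pos v.2]
  · rw [(hb σ τ).2 h]
    split_ifs with h1 h2
    · exact absurd (hiff.2 ⟨h1, h2⟩) h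
    · rfl
    · rfl

end Layout

/-! ### Correctness of the computed numbers -/

section Extend

variable {n d r : ℕ} {e : Fin r → Fin n} (he : Function.Injective e)

theorem extendOp_add (b c : Matrix (Fin r → Fin d) (Fin r → Fin d) ℂ) :
    extendOp e he (b + c) = extendOp e he b + extendOp e he c := by
  ext σ τ
  simp [extendOp, Matrix.kronecker, add_mul]

theorem extendOp_zero : extendOp e he (0 : Matrix (Fin r → Fin d) (Fin r → Fin d) ℂ) = 0 := by
  ext σ τ
  simp [extendOp, Matrix.kronecker]

end Extend

section Instance

/-- The part of the Hamiltonian with labels in `B`. -/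
noncomputable def LocalHamiltonian.part {n d : ℕ} (H : LocalHamiltonian n d) (B : List ℕ) :
    Op n d :=
  ∑ x ∈ Finset.univ.filter fun x : Fin H.numTerms => (x : ℕ) ∈ B, H.weighted x

variable {n d : ℕ} [NeZero d] {D : ℕ} {H : LocalHamiltonian n d} {A : Op n d}
  {o : Fin H.numTerms} {ρ : ProductState n d} {t ε : ℝ} {I : Input}
  (hI : I = instanceInput D H A o ρ t ε)

include hI

theorem d_eq : I.d = d := by subst hI; rfl
theorem degreeBound_eq : I.degreeBound = D := by subst hI; rfl
theorem obs_eq : I.obs = o := by subst hI; rfl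
theorem time_eq : I.num .time 0 0 0 = t := by subst hI; rfl

theorem lists_region (x : Fin H.numTerms) : Lists I x (H.region x) := by
  subst hI
  exact ⟨dif_pos x.2, fun i _ => dif_pos x.2⟩

theorem numSites_le {k : ℕ} (hk : H.IsLocal k) (x : ℕ) : I.numSites x ≤ k := by
  by_cases hx : x < H.numTerms
  · exact (lists_region hI ⟨x, hx⟩).1.trans_le (hk _)
  · subst hI; exact (dif_neg hx).trans_le (Nat.zero_le _)

theorem numNbrs_le (hD : H.interactionGraph.maxDegree ≤ D) (x : ℕ) :
    I.numNbrs x ≤ I.degreeBound := by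
  rw [degreeBound_eq hI]
  subst hI
  by_cases hx : x < H.numTerms
  · exact (dif_pos hx).trans_le ((H.interactionGraph.degree_le_maxDegree _).trans hD)
  · exact (dif_neg hx).trans_le (Nat.zero_le _)

theorem mem_nbrs_iff {x z : ℕ} : z ∈ I.nbrs x ↔
    ∃ (hx : x < H.numTerms) (hz : z < H.numTerms), H.interactionGraph.Adj ⟨x, hx⟩ ⟨z, hz⟩ := by
  simp only [Input.nbrs, List.mem_map, List.mem_range]
  by_cases hx : x < H.numTerms
  · have h1 : I.numNbrs x = (H.interactionGraph.neighborFinset ⟨x, hx⟩).card := by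
      subst hI; exact (dif_pos hx)
    have h2 : ∀ i, I.nat .neighbor x i =
        nthElement (H.interactionGraph.neighborFinset ⟨x, hx⟩) i := by
      subst hI; exact fun i => (dif_pos hx)
    simp only [hx, exists_true_left, h1, h2, ← SimpleGraph.mem_neighborFinset,
      mem_iff_exists_orderEmbOfFin]
    constructor
    · rintro ⟨i, hi, rfl⟩
      rw [nthElement_eq _ hi]
      exact ⟨Fin.is_lt _, ⟨i, hi⟩, rfl⟩
    · rintro ⟨hz, i, hi⟩
      exact ⟨i, i.2, by rw [nthElement_eq _ i.2]; exact congrArg Fin.val hi⟩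
  · have h1 : I.numNbrs x = 0 := by subst hI; exact (dif_neg hx)
    simp [h1, hx]

/-- The explorations choose labels of terms, none of them twice. -/
theorem chosen_explore (w u : ℕ) : (I.explore w u).chosen.Nodup ∧
    (∀ x ∈ (I.explore w u).chosen, x < H.numTerms) := by
  have key : (I.explore w u).chosen.Nodup ∧
      (∀ x ∈ (I.explore w u).chosen, x ∈ (I.explore w u).seen ∧ x < H.numTerms) ∧
      ∀ x ∈ (I.explore w u).cand, x < H.numTerms := by
    have hobs : I.obs < H.numTerms := by rw [obs_eq hI]; exact o.2
    have hnbrs : ∀ x, ∀ z ∈ I.nbrs x, z < H.numTerms := fun x z hz =>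
      ((mem_nbrs_iff hI).1 hz).2.1
    induction u with
    | zero => simpa [Input.explore, Input.start, hobs] using hnbrs _
    | succ u ih =>
      rw [Input.explore]
      generalize I.explore w u = e at ih
      obtain ⟨h1, h2, h3⟩ := ih
      have hy : e.cand.getD u I.obs < H.numTerms := by
        by_cases h : u < e.cand.length
        · rw [List.getD_eq_getElem _ _ h]; exact h3 _ (List.getElem_mem _)
        · rw [List.getD_eq_default _ _ (by omega)]; exact hobs
      simp only [Input.step]
      generalize e.cand.getD u I.obs = y at hy
      have hcand : ∀ x ∈ e.cand ++ I.nbrs y, x < H.numTerms := fun x hx =>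
        (List.mem_append.1 hx).elim (h3 x) (hnbrs y x)
      have hins : ∀ x ∈ e.chosen, x ∈ insert y e.seen ∧ x < H.numTerms := fun x hx =>
        ⟨Finset.mem_insert_of_mem (h2 x hx).1, (h2 x hx).2⟩
      split_ifs with g1 g2 g3 g4
      · exact ⟨h1, h2, h3⟩
      · exact ⟨h1, h2, h3⟩
      · exact ⟨h1, hins, h3⟩
      · exact ⟨h1, hins, hcand⟩
      · refine ⟨?_, ?_, hcand⟩
        · refine h1.append (List.nodup_singleton y) (List.disjoint_singleton.2 fun h => ?_)
          exact g1 (h2 y h).1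
        · intro x hx
          rcases List.mem_append.1 hx with h | h
          · exact hins x h
          · rw [List.mem_singleton.1 h]; exact ⟨Finset.mem_insert_self _ _, hy⟩
  exact ⟨key.1, fun x hx => (key.2.1 x hx).2⟩

section Matrices

variable {L : List ℕ} (hL : L.Nodup) (hn : ∀ v ∈ L, v < n)

theorem extendOp_hamMatrix {B : List ℕ} (hB : B.Nodup) (hBN : ∀ x ∈ B, x < H.numTerms)
    (hX : ∀ x : Fin H.numTerms, (x : ℕ) ∈ B → ∀ v ∈ H.region x, (v : ℕ) ∈ L) :
    extendOp (spin hn) (spin_injective hL hn)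
      (Matrix.of fun f g => I.hamMatrix L B (code f) (code g)) =
      H.part B := by
  induction B with
  | nil =>
    simp only [LocalHamiltonian.part, Input.hamMatrix, List.map_nil, List.sum_nil, List.not_mem_nil, Finset.filter_false,
      Finset.sum_empty]
    exact extendOp_zero (spin_injective hL hn)
  | cons y B ih =>
    obtain ⟨hyB, hB⟩ := List.nodup_cons.1 hB
    have hy := hBN y List.mem_cons_self
    have hf : (fun a b => I.num .coeff y 0 0 * I.num .term y a b) =
        localEntry (H.region ⟨y, hy⟩) (H.weighted ⟨y, hy⟩) := by
      funext a b
      subst hI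
      simp only [instanceInput, hy, dif_pos, localEntry, LocalHamiltonian.weighted,
        Matrix.smul_apply, smul_eq_mul, mul_ite, mul_zero]
    have hset : Finset.univ.filter (fun x : Fin H.numTerms => (x : ℕ) ∈ y :: B) =
        insert ⟨y, hy⟩ (Finset.univ.filter fun x : Fin H.numTerms => (x : ℕ) ∈ B) := by
      ext x; simp [Fin.ext_iff]
    have hmat : (Matrix.of fun f g : Fin L.length → Fin d =>
          I.hamMatrix L (y :: B) (code f) (code g)) =
        (Matrix.of fun f g => I.embed L (localEntry (H.region ⟨y, hy⟩) (H.weighted ⟨y, hy⟩)) y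
          (code f) (code g)) + Matrix.of fun f g => I.hamMatrix L B (code f) (code g) := by
      ext f g
      simp only [Input.hamMatrix, List.map_cons, List.sum_cons, hf, Matrix.add_apply,
        Matrix.of_apply]
    rw [LocalHamiltonian.part, hset, Finset.sum_insert (by simpa using hyB), ← LocalHamiltonian.part,
      hmat, extendOp_add, ih hB (fun x hx => hBN x (List.mem_cons_of_mem _ hx))
      (fun x hx => hX x (List.mem_cons_of_mem _ hx)),
      extendOp_embed hL hn (d_eq hI) (lists_region hI ⟨y, hy⟩)
        (hX ⟨y, hy⟩ List.mem_cons_self) (H.actsOn_weighted _)]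

theorem extendOp_obsMatrix (hA : ActsOn (H.region o) A)
    (hX : ∀ v ∈ H.region o, (v : ℕ) ∈ L) :
    extendOp (spin hn) (spin_injective hL hn)
      (Matrix.of fun f g => I.obsMatrix L (code f) (code g)) = A := by
  have h := extendOp_embed hL hn (d_eq hI) (lists_region hI o) hX hA
  rw [← obs_eq hI] at h
  have hf : (fun a b => I.num .observable a b 0) = localEntry (H.region o) A := by
    subst hI; rfl
  rw [Input.obsMatrix, hf]
  exact h

theorem commMatrix_code (B : List ℕ) (m : ℕ) (f g : Fin L.length → Fin d) :
    I.commMatrix L B m (code f) (code g) =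
      adPow (Matrix.of fun f g : Fin L.length → Fin d => I.hamMatrix L B (code f) (code g))
        (Matrix.of fun f g => I.obsMatrix L (code f) (code g)) m f g := by
  induction m generalizing f g with
  | zero => rfl
  | succ m ih =>
    rw [Input.commMatrix, d_eq hI, sum_range_eq_sum_code, adPow, Matrix.sub_apply, Matrix.mul_apply,
      Matrix.mul_apply, ← Finset.sum_sub_distrib]
    exact Finset.sum_congr rfl fun h _ => by rw [ih, ih]; rfl

include hL in
theorem stateMatrix_code (f g : Fin L.length → Fin d) :
    I.stateMatrix L (code f) (code g) = ∏ i, ρ.site (spin hn i) (f i) (g i) := by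
  rw [Input.stateMatrix, ← Fin.prod_univ_fun_getElem]
  refine Finset.prod_congr rfl fun i _ => ?_
  have h1 := digit_code hL hn (d_eq hI) f i
  have h2 := digit_code hL hn (d_eq hI) g i
  change I.num .state (spin hn i : Fin n) (I.digit L (code f) (spin hn i : Fin n))
    (I.digit L (code g) (spin hn i : Fin n)) = _
  rw [h1, h2]
  subst hI
  exact dif_pos ⟨Fin.is_lt _, Fin.is_lt _, Fin.is_lt _⟩

end Matrices

theorem taylorCoeff_eq (m : ℕ) :
    I.taylorCoeff m = (Complex.I * t) ^ m / (m.factorial : ℂ) := by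
  induction m with
  | zero => simp [Input.taylorCoeff]
  | succ m ih =>
    rw [Input.taylorCoeff, ih, time_eq hI, Nat.factorial_succ, Nat.cast_mul, pow_succ,
      div_mul_eq_mul_div, div_div, mul_comm (m.factorial : ℂ)]

theorem taylorValue_eq (hA : ActsOn (H.region o) A) {B : List ℕ} (hB : B.Nodup)
    (hBN : ∀ x ∈ B, x < H.numTerms) (ho : I.obs ∈ B) (M : ℕ) :
    I.taylorValue B M = ∑ m ∈ Finset.range (M + 1), I.taylorCoeff m *
      (adPow (H.part B) A m * ρ.toOp).trace := by
  have hL := I.nodup_layout B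
  have hn : ∀ v ∈ I.layout B, v < n := by
    intro v hv
    obtain ⟨x, hx, i, hi, rfl⟩ := Input.mem_layout.1 hv
    have h := lists_region hI ⟨x, hBN x hx⟩
    dsimp only at h
    rw [h.1] at hi
    rw [h.2 i hi, nthElement_eq _ hi]
    exact Fin.is_lt _
  have hX : ∀ x : Fin H.numTerms, (x : ℕ) ∈ B → ∀ v ∈ H.region x, (v : ℕ) ∈ I.layout B := by
    intro x hx v hv
    obtain ⟨i, rfl⟩ := (mem_iff_exists_orderEmbOfFin _ _).1 hv
    have h := lists_region hI x
    exact Input.mem_layout.2 ⟨x, hx, i, h.1.symm ▸ i.2, by rw [h.2 i i.2, nthElement_eq _ i.2]⟩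
  rw [Input.taylorValue]
  refine Finset.sum_congr rfl fun m _ => ?_
  rw [← extendOp_hamMatrix hI hL hn hB hBN hX]
  conv_rhs => rw [← extendOp_obsMatrix hI hL hn hA (hX o (obs_eq hI ▸ ho))]
  rw [adPow_extendOp, trace_extendOp_mul, d_eq hI, sum_range_eq_sum_code]
  congr 1
  refine Finset.sum_congr rfl fun f _ => ?_
  rw [sum_range_eq_sum_code]
  refine Finset.sum_congr rfl fun g _ => ?_
  rw [commMatrix_code hI, stateMatrix_code hI hL hn]

/-- A nested commutator vanishes as soon as one of its terms commutes with the inner commutator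
because it overlaps with none of the earlier terms. -/
theorem nested_eq_zero_or_chained (hA : ActsOn (H.region o) A) (l : List (Fin H.numTerms)) :
    H.nested A l = 0 ∨ I.Chained (l.map Fin.val) := by
  induction l with
  | nil => exact .inr trivial
  | cons x l ih =>
    rcases ih with h | h
    · left; rw [LocalHamiltonian.nested, h, mul_zero, zero_mul, sub_zero]
    by_cases hx : ∀ y ∈ o :: l, x ≠ y ∧ ¬ H.interactionGraph.Adj y x
    · exact .inl (H.nested_cons_eq_zero hA hx)
    · right
      push Not at hx
      obtain ⟨y, hy, hxy⟩ := hx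
      refine ⟨h, y, ?_, ?_⟩
      · rw [obs_eq hI]; exact List.mem_map_of_mem (f := Fin.val) hy
      · by_cases hne : x = y
        · exact .inl (congrArg _ hne)
        · exact .inr ((mem_nbrs_iff hI).2 ⟨y.2, x.2, hxy hne⟩)

/-- The signed sum over the explorations is the Taylor polynomial of the full time evolution. -/
theorem output_eq (hA : ActsOn (H.region o) A) (hD : H.interactionGraph.maxDegree ≤ D) (M : ℕ) :
    I.output M = ∑ m ∈ Finset.range (M + 1), (Complex.I * t) ^ m / (m.factorial : ℂ) *
      (adPow H.toOp A m * ρ.toOp).trace := by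
  classical
  have htr : ∀ m, ∀ (P : Fin H.numTerms → Prop) [DecidablePred P],
      (adPow (∑ x with P x, H.weighted x) A m * ρ.toOp).trace =
        ∑ l ∈ words (Fin H.numTerms) m,
          (if ∀ x ∈ l, P x then 1 else 0) * (H.nested A l * ρ.toOp).trace := by
    intro m P _
    rw [H.adPow_sum A P, Finset.sum_mul, Matrix.trace_sum]
    refine Finset.sum_congr rfl fun l _ => ?_
    split_ifs <;> simp
  rw [Input.output]
  have h1 : ∀ w, I.taylorValue (I.explore w (I.steps M)).chosen M = _ := fun w =>
    taylorValue_eq hI hA (chosen_explore hI w (I.steps M)).1 (chosen_explore hI w (I.steps M)).2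
      (I.obs_mem_chosen_explore w (I.steps M)) M
  simp only [h1, Finset.mul_sum]
  rw [Finset.sum_comm]
  refine Finset.sum_congr rfl fun m hm => ?_
  rw [← taylorCoeff_eq hI, H.adPow_toOp, Finset.sum_mul, Matrix.trace_sum, Finset.mul_sum]
  have h2 : ∀ w, (I.explore w (I.steps M)).sign * (I.taylorCoeff m *
      (adPow (H.part (I.explore w (I.steps M)).chosen) A m
        * ρ.toOp).trace) = ∑ l ∈ words (Fin H.numTerms) m, I.taylorCoeff m *
          ((I.explore w (I.steps M)).sign * (if ∀ y ∈ l.map Fin.val,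
            y ∈ (I.explore w (I.steps M)).chosen then 1 else 0) *
          (H.nested A l * ρ.toOp).trace) := by
    intro w
    rw [LocalHamiltonian.part, htr, Finset.mul_sum, Finset.mul_sum]
    refine Finset.sum_congr rfl fun l _ => ?_
    simp only [List.forall_mem_map]
    ring
  simp only [h2]
  rw [Finset.sum_comm]
  refine Finset.sum_congr rfl fun l hl => ?_
  rw [← Finset.mul_sum, ← Finset.sum_mul]
  rcases nested_eq_zero_or_chained hI hA l with h | h
  · simp [h]
  · have hlen : (l.map Fin.val).length ≤ M := by
      rw [List.length_map, length_of_mem_words hl]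
      have := Finset.mem_range.1 hm
      omega
    rw [I.sum_sign_explore h hlen (numNbrs_le hI hD), one_mul]

end Instance

/-! ### The truncation error -/

theorem tStar_pos {D : ℕ} (hD : 1 ≤ D) : 0 < tStar D := by
  rw [tStar]; positivity

section Truncation

variable {n d : ℕ} (H : LocalHamiltonian n d) (A : Op n d) (ρ : ProductState n d) (t : ℝ)

open scoped Matrix.Norms.L2Operator in
/-- The Taylor series of the expectation in the time. -/
theorem hasSum_expectation :
    HasSum (fun m : ℕ => (Complex.I * t) ^ m / (m.factorial : ℂ) *
      (adPow H.toOp A m * ρ.toOp).trace) (expectation H A ρ t) := by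
  have h := hasSum_adPow H.toOp A (Complex.I * t)
  have h2 := ((Matrix.traceLinearMap (Fin n → Fin d) ℂ ℂ).comp
    (LinearMap.mulRight ℂ ρ.toOp)).toContinuousLinearMap.hasSum h
  have h3 : ∀ m : ℕ, (Complex.I * t) ^ m / (m.factorial : ℂ) * (adPow H.toOp A m * ρ.toOp).trace =
      ((Complex.I * t) ^ m / (m.factorial : ℂ)) • (adPow H.toOp A m * ρ.toOp).trace := fun _ => rfl
  simp only [h3, ← Matrix.trace_smul, ← Matrix.smul_mul]
  exact h2

variable {H A} {o : Fin H.numTerms} {D : ℕ}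

/-- Up to the threshold time the Taylor series is dominated by a geometric series. -/
theorem norm_expectation_sub_le (hA : ActsOn (H.region o) A)
    (hD : H.interactionGraph.maxDegree ≤ D) (h1 : 1 ≤ D) (ht : |t| < tStar D) (N : ℕ) :
    ‖expectation H A ρ t - ∑ m ∈ Finset.range N, (Complex.I * t) ^ m / (m.factorial : ℂ) *
      (adPow H.toOp A m * ρ.toOp).trace‖ ≤
        (|t| / tStar D) ^ N / (1 - |t| / tStar D) * opNorm A := by
  have h1' : (1 : ℝ) ≤ D := by exact_mod_cast h1
  have hτ : 2 * (D + 1) * |t| ≤ |t| / tStar D := by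
    -- This is `2 (D + 1) ≤ 2 e D`, which holds because `2 ≤ e` and `1 ≤ D`.
    have he := Real.exp_one_gt_two
    rw [tStar, div_div_eq_mul_div, div_one, mul_comm]
    refine mul_le_mul_of_nonneg_left ?_ (abs_nonneg t)
    nlinarith
  rw [norm_sub_rev]
  refine (norm_sub_le_of_geometric_bound_of_hasSum ((div_lt_one (tStar_pos h1)).2 ht) (C := opNorm A)
    (fun m => ?_) (hasSum_expectation H A ρ t) N).trans_eq (by ring)
  have hm : (0 : ℝ) < m.factorial := by positivity
  have hnorm : opNorm (adPow H.toOp A m) ≤ m.factorial * (2 * (D + 1)) ^ m * opNorm A :=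
    H.norm_adPow_le hA hD m
  calc ‖(Complex.I * t) ^ m / (m.factorial : ℂ) * (adPow H.toOp A m * ρ.toOp).trace‖
      = |t| ^ m / m.factorial * ‖(adPow H.toOp A m * ρ.toOp).trace‖ := by simp
    _ ≤ |t| ^ m / m.factorial * (m.factorial * (2 * (D + 1)) ^ m * opNorm A) :=
        mul_le_mul_of_nonneg_left ((ρ.norm_trace_mul_le _).trans hnorm) (by positivity)
    _ = (2 * (D + 1) * |t|) ^ m * opNorm A := by
        rw [mul_pow (2 * ((D : ℝ) + 1))]; field_simp
    _ ≤ (|t| / tStar D) ^ m * opNorm A :=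
        mul_le_mul_of_nonneg_right (pow_le_pow_left₀ (by positivity) hτ m) (norm_nonneg _)
    _ = opNorm A * (|t| / tStar D) ^ m := mul_comm _ _

end Truncation

/-! ### The run time -/

theorem runTimeScale_nonneg {D : ℕ} (h1 : 1 ≤ D) {t ε : ℝ} (ht : |t| < tStar D) (hε : 0 < ε) :
    0 ≤ runTimeScale D t ε := by
  have := sub_pos.2 ((div_lt_one (tStar_pos h1)).2 ht)
  rw [runTimeScale]; positivity

/-- A degree `M + 1` is needed only if the run time scale has reached `e ^ (M + 1)`. -/
theorem exp_le_runTimeScale {D : ℕ} (h1 : 1 ≤ D) {t ε : ℝ} (ht : |t| < tStar D) (hε : 0 < ε) {M : ℕ}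
    (hM : ε < (|t| / tStar D) ^ (M + 1) / (1 - |t| / tStar D)) :
    Real.exp (M + 1 : ℕ) ≤ runTimeScale D t ε := by
  have hlog : Real.log (tStar D / |t|) = - Real.log (|t| / tStar D) := by
    rw [← Real.log_inv, inv_div]
  have hτ1 := (div_lt_one (tStar_pos h1)).2 ht
  have hτ0 : 0 ≤ |t| / tStar D := div_nonneg (abs_nonneg t) (tStar_pos h1).le
  rw [runTimeScale, hlog]
  generalize |t| / tStar D = τ at hM hτ1 hτ0
  have hpos : 0 < τ := by
    refine hτ0.lt_of_ne fun h => ?_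
    rw [← h] at hM
    simp at hM
    exact absurd hM (not_lt.2 hε.le)
  have h1τ : 0 < 1 - τ := sub_pos.2 hτ1
  have hl : 0 < -Real.log τ := neg_pos.2 (Real.log_neg hpos hτ1)
  have hb : Real.exp ((M + 1 : ℕ) * -Real.log τ) ≤ 1 / (1 - τ) * (1 / ε) := by
    rw [mul_neg, Real.exp_neg, mul_comm, Real.exp_mul, Real.exp_log hpos, Real.rpow_natCast]
    rw [lt_div_iff₀ h1τ] at hM
    rw [← one_div, one_div_mul_one_div]
    exact one_div_le_one_div_of_le (by positivity) (by linarith)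
  calc Real.exp (M + 1 : ℕ) = Real.exp ((M + 1 : ℕ) * -Real.log τ) ^ (1 / -Real.log τ) := by
        rw [← Real.exp_mul, mul_assoc, mul_one_div_cancel hl.ne', mul_one]
    _ ≤ _ := Real.rpow_le_rpow (Real.exp_pos _).le hb (by positivity)

/-- Raised to the power `M + 1`, this bounds the lengths of all loops of the algorithm with degree `M`.
The factors account for the number of explorations, the dimension of the state space of the chosen
subsystems, their number of spins, and the degree. -/
def loopBase (d k D : ℕ) : ℕ := 3 ^ D * d ^ (k * (D + 1)) * (k + 1) * 2

theorem loopBase_pow (d k D N : ℕ) : loopBase d k D ^ N =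
    3 ^ (D * N) * d ^ (k * (D + 1) * N) * (k + 1) ^ N * 2 ^ N := by
  simp only [loopBase, mul_pow, ← pow_mul]

/-- On an instance the algorithm computes its result within the loop bound of the least degree for which
the error bound is at most `ε`. -/
theorem ens_algorithm {n d k D : ℕ} [NeZero d] (h1 : 1 ≤ D) {H : LocalHamiltonian n d} {A : Op n d}
    {o : Fin H.numTerms} {ρ : ProductState n d} {t ε : ℝ} (hk : H.IsLocal k)
    (hD : H.interactionGraph.maxDegree ≤ D) {M : ℕ}
    (hlt : ∀ m < M, ε < (|t| / tStar D) ^ (m + 1) / (1 - |t| / tStar D))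
    (hle : (|t| / tStar D) ^ (M + 1) / (1 - |t| / tStar D) ≤ ε) :
    Ens (instanceInput D H A o ρ t ε) (loopBase d k D ^ (M + 1)) algorithm Memory.blank
      fun s => s.num 0 0 = (instanceInput D H A o ρ t ε).output M := by
  obtain ⟨I, hI⟩ : ∃ I, I = instanceInput D H A o ρ t ε := ⟨_, rfl⟩
  rw [← hI]
  have hd : 0 < d := NeZero.pos d
  have hdeg := degreeBound_eq hI
  have a1 : D * (M + 1) + 1 ≤ 3 ^ (D * (M + 1)) := Nat.lt_pow_self (by norm_num)
  have a2 : 0 < d ^ (k * (D + 1) * (M + 1)) := by positivity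
  have a3 : k + 1 ≤ (k + 1) ^ (M + 1) := Nat.le_self_pow (by omega) _
  have a4 : M + 1 + 1 ≤ 2 ^ (M + 1) := Nat.lt_two_pow_self
  have a5 : D ≤ D * (M + 1) := Nat.le_mul_of_pos_right _ (by omega)
  have a6 : k * (D * (M + 1) + 1) ≤ k * (D + 1) * (M + 1) := by
    rw [mul_assoc]; exact Nat.mul_le_mul_left _ (by linarith)
  have a7 := Nat.pow_le_pow_right hd a6
  have hZ := loopBase_pow d k D (M + 1)
  have hb : 0 < (k + 1) ^ (M + 1) := by positivity
  have hu : 0 < 2 ^ (M + 1) := by positivity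
  have hx : 0 < 3 ^ (D * (M + 1)) := by positivity
  -- Every bound needed below is a product of some of the four factors.
  have le₁ : 3 ^ (D * (M + 1)) ≤ loopBase d k D ^ (M + 1) := by
    rw [hZ, mul_assoc, mul_assoc]; exact Nat.le_mul_of_pos_right _ (by positivity)
  have le₂ : d ^ (k * (D + 1) * (M + 1)) ≤ loopBase d k D ^ (M + 1) := by
    calc d ^ (k * (D + 1) * (M + 1)) ≤ d ^ (k * (D + 1) * (M + 1)) *
          (3 ^ (D * (M + 1)) * (k + 1) ^ (M + 1) * 2 ^ (M + 1)) :=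
          Nat.le_mul_of_pos_right _ (by positivity)
      _ = _ := by rw [hZ]; ring
  have le₃ : 3 ^ (D * (M + 1)) * (k + 1) ^ (M + 1) ≤ loopBase d k D ^ (M + 1) := by
    rw [hZ, mul_right_comm (3 ^ _), mul_assoc]; exact Nat.le_mul_of_pos_right _ (by positivity)
  have le₄ : 2 ^ (M + 1) ≤ loopBase d k D ^ (M + 1) := by
    rw [hZ]; exact Nat.le_mul_of_pos_left _ (by positivity)
  have le₅ : k * (D * (M + 1) + 1) ≤ loopBase d k D ^ (M + 1) := by
    refine le_trans ?_ le₃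
    rw [mul_comm k]
    exact Nat.mul_le_mul a1 (by omega)
  have hsteps : I.steps M = D * (M + 1) := by rw [Input.steps, hdeg]
  refine (ens_chooseDegree (time_eq hI) (by subst hI; rfl) (by subst hI; rfl) (tStar_pos h1)
    (by omega) hlt hle).seq' fun s ha hM => ?_
  refine ens_sumExplorations (k := k) (by rw [d_eq hI]; exact hd) hM
    (fun y => by rw [ha.nat _ (by decide)]; rfl) (fun y => by rw [ha.nat _ (by decide)]; rfl)
    (numSites_le hI hk) (numNbrs_le hI hD) (by rw [hdeg]; omega) (by omega)
    ((Nat.le_mul_of_pos_right k (by omega)).trans le₅) ?_ ?_ ?_ ?_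
  all_goals rw [hsteps]
  · omega
  · exact le₁
  · exact le₅
  · rw [d_eq hI]; exact a7.trans le₂

/-- The run time is polynomial in `e ^ M`, where `M` is the degree of the Taylor polynomial. -/
theorem exists_polynomial (P : Prog) (K : ℕ) (hK : 0 < K) :
    ∃ p : Polynomial ℝ, ∀ (M : ℕ) (x : ℝ), 0 ≤ x → Real.exp M ≤ 1 + x →
      (P.bound (K ^ (M + 1)) : ℝ) ≤ p.eval x := by
  obtain ⟨c, q, hc⟩ := P.exists_bound_le
  refine ⟨Polynomial.C ((c : ℝ) * (2 * K) ^ q) * (1 + Polynomial.X) ^ K ^ q, fun M x hx h => ?_⟩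
  have hK1 : 1 ≤ K ^ (M + 1) := Nat.one_le_pow _ _ hK
  have h1 : P.bound (K ^ (M + 1)) ≤ c * (2 * K) ^ q * (K ^ q) ^ M := by
    refine (hc _).trans ?_
    rw [mul_assoc]
    refine Nat.mul_le_mul_left c ?_
    calc (K ^ (M + 1) + 1) ^ q ≤ (2 * K ^ (M + 1)) ^ q := Nat.pow_le_pow_left (by omega) q
      _ = (2 * K) ^ q * (K ^ q) ^ M := by ring
  -- A constant `G` is at most `e ^ G`, so `G ^ M` is at most the power `G` of `e ^ M`.
  have h2 : ((K ^ q : ℕ) : ℝ) ^ M ≤ (1 + x) ^ K ^ q := by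
    have h3 : ((K ^ q : ℕ) : ℝ) ≤ Real.exp (K ^ q : ℕ) :=
      (le_add_of_nonneg_right zero_le_one).trans (Real.add_one_le_exp _)
    calc ((K ^ q : ℕ) : ℝ) ^ M ≤ Real.exp (K ^ q : ℕ) ^ M :=
          pow_le_pow_left₀ (Nat.cast_nonneg _) h3 M
      _ = Real.exp M ^ K ^ q := by
          rw [← Real.exp_nat_mul, ← Real.exp_nat_mul, mul_comm]
      _ ≤ (1 + x) ^ K ^ q := pow_le_pow_left₀ (Real.exp_pos _).le h _
  calc (P.bound (K ^ (M + 1)) : ℝ) ≤ (c : ℝ) * (2 * K) ^ q * ((K ^ q : ℕ) : ℝ) ^ M := by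
        exact_mod_cast h1
    _ ≤ (c : ℝ) * (2 * K) ^ q * (1 + x) ^ K ^ q := mul_le_mul_of_nonneg_left h2 (by positivity)
    _ = _ := by simp

end ShortTime

theorem mainTheorem11 :
    ∃ P : ShortTime.Prog, ∀ (d k D : ℕ) [NeZero d], 1 ≤ D →
      ∃ p : Polynomial ℝ, ∀ (n : ℕ) (H : ShortTime.LocalHamiltonian n d) (A : ShortTime.Op n d)
        (o : Fin H.numTerms) (ρ : ShortTime.ProductState n d) (t ε : ℝ),
        H.IsLocal k →
        H.interactionGraph.maxDegree ≤ D →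
        ShortTime.IsSupport A (H.region o) →
        |t| < ShortTime.tStar D →
        0 < ε →
        ∃ (s : ShortTime.Memory) (T : ℕ),
          ShortTime.Runs (ShortTime.instanceInput D H A o ρ t ε) P ShortTime.Memory.blank s T ∧
          (T : ℝ) ≤ p.eval (ShortTime.runTimeScale D t ε) ∧
          ‖ShortTime.expectation H A ρ t - s.num 0 0‖ ≤ ε * ShortTime.opNorm A := by
  refine ⟨ShortTime.algorithm, fun d k D _ h1 => ?_⟩
  have hK : 0 < ShortTime.loopBase d k D := by
    have := NeZero.pos d
    rw [ShortTime.loopBase]; positivity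
  obtain ⟨p, hp⟩ := ShortTime.exists_polynomial ShortTime.algorithm _ hK
  refine ⟨p, fun n H A o ρ t ε hk hD hA ht hε => ?_⟩
  have hτ1 := (div_lt_one (ShortTime.tStar_pos h1)).2 ht
  have hτ0 : 0 ≤ |t| / ShortTime.tStar D := div_nonneg (abs_nonneg t) (ShortTime.tStar_pos h1).le
  have hex : ∃ M : ℕ, (|t| / ShortTime.tStar D) ^ (M + 1) / (1 - |t| / ShortTime.tStar D) ≤ ε := by
    obtain ⟨M, hM⟩ := exists_pow_lt_of_lt_one (mul_pos hε (sub_pos.2 hτ1)) hτ1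
    refine ⟨M, (div_le_iff₀ (sub_pos.2 hτ1)).2 (le_trans ?_ hM.le)⟩
    exact pow_le_pow_of_le_one hτ0 hτ1.le (Nat.le_succ M)
  classical
  obtain ⟨M, hle, hlt⟩ : ∃ M : ℕ,
      (|t| / ShortTime.tStar D) ^ (M + 1) / (1 - |t| / ShortTime.tStar D) ≤ ε ∧
      ∀ m < M, ε < (|t| / ShortTime.tStar D) ^ (m + 1) / (1 - |t| / ShortTime.tStar D) :=
    ⟨Nat.find hex, Nat.find_spec hex, fun m hm => not_le.1 (Nat.find_min hex hm)⟩
  obtain ⟨s, T, hrun, hT, hs⟩ := ShortTime.ens_algorithm (A := A) (o := o) (ρ := ρ) h1 hk hD hlt hle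
  refine ⟨s, T, hrun, ?_, ?_⟩
  · have hx := ShortTime.runTimeScale_nonneg h1 ht hε
    refine le_trans (Nat.cast_le.2 hT) (hp M _ hx ?_)
    cases M with
    | zero => simpa using hx
    | succ M =>
      exact (ShortTime.exp_le_runTimeScale h1 ht hε (hlt M (Nat.lt_succ_self M))).trans
        (le_add_of_nonneg_left zero_le_one)
  · rw [hs, ShortTime.output_eq rfl hA.1 hD]
    exact (ShortTime.norm_expectation_sub_le ρ t hA.1 hD h1 ht (M + 1)).trans
      (mul_le_mul_of_nonneg_right hle (norm_nonneg _))
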